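/- **Setting.** Let $\mathbb T=\mathbb R/\mathbb Z$ and let $p(x)=\sum_{k}\hat p_k\,\mathrm e^{2\pi\mathrm i k\cdot x}$, $x\in\mathbb T^d$, be a $d$-variate trigonometric polynomial ($d\ge 1$) with finite non-empty $\operatorname{supp}\hat p=\{k\in\mathbb Z^d:\hat p_k\ne0\}$; write $n:=|\operatorname{supp}\hat p|$. For $\Gamma\subset\mathbb Z^d$ finite let $\mathcal P_t(\Gamma)$ and $\mathcal P_{(1,\dots,t)}(\Gamma)$ be the projections to the $t$-th and to the first $t$ components, and $K_t:=\max\mathcal P_t(\Gamma)-\min\mathcal P_t(\Gamma)+1$. **Algorithm** (dimension-incremental sparse FFT with single reconstructing rank-1 lattices). Input: $\Gamma$, $p$ as a black box, a threshold $\delta>0$, a sparsity parameter $s$, a number $r$ of detection iterations. All random components below are independent and uniform on $\mathbb T$. - *One-dimensional detection*, for $t=1,\dots,d$: $I^{(t)}$ is the union over $r$ iterations of the following sets. Draw $x'_j$, $j\ne t$, compute $\frac1{K_t}\sum_{\ell<K_t}p(x_1',\dots,x_{t-1}',\frac{\ell}{K_t},x_{t+1}',\dots,x_d')\,\mathrm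 e^{-2\pi\mathrm i\ell k/K_t}$ for $k\in\mathcal P_t(\Gamma)$ by FFT, and take those $k$ which have the (up to) $s$ largest absolute values that are $\ge\delta$. - *Dimension increment.* $I^{(1,\dots,1)}:=I^{(1)}$. For $t=2,\dots,d$ let $J_t:=(I^{(1,\dots,t-1)}\times I^{(t)})\cap\mathcal P_{(1,\dots,t)}(\Gamma)$. Construct deterministically a reconstructing rank-1 lattice for $J_t$: with $M'$ the least prime $\ge\max\{|I^{(1,\dots,t-1)}|^2,2,K_1,\dots,K_{t-1}\}$, choose $z'\in\mathbb Z^{t-1}$ component by component, each component minimal, such that $k\mapsto k\cdot z'\bmod M'$ is injective on $I^{(1,\dots,t-1)}$, and set $z:=(z',M')$, $M:=M'K_t$. Then $I^{(1,\dots,t)}$ is the union over $\tilde r$ iterations ($\tilde r=r$ if $t<d$, $\tilde r=1$ if $t=d$) of the following sets. Draw $x'_{t+1},\dots,x'_d$, compute $\frac1M\sum_{j<M}p(\frac{j}{M}z,x'_{t+1},\dots,x'_d)\,\mathrm e^{-2\pi\mathrm i jk\cdot z/M}$ for $k\in J_t$ by one FFT of length $M$, and take those $k$ which have the (up to) $s$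 largest absolute values that are $\ge\delta$. - *Output*: $I:=I^{(1,\dots,d)}$ and the computed coefficients. The number of samples is the number of evaluations of $p$. The number of arithmetic operations counts operations on numbers, comparisons and table accesses (including lattice construction, FFTs of arbitrary length, detection, and membership tests in $\mathcal P_{(1,\dots,t)}(\Gamma)$, charged $t$ each); addressing, forming the nodes handed to the black box, and the sets $\mathcal P_t(\Gamma)$ and numbers $K_t$ (part of the input) are free. **Theorem 4.7.** Let $\varepsilon\in(0,1)$, $N\ge1$, and apply the algorithm with - $\operatorname{supp}\hat p\subset\Gamma\subset\{-N,\dots,N\}^d$, - $0<\delta\le\min_{h\in\operatorname{supp}\hat p}|\hat p_h|/3$, - $s\ge n$, - $r:=\lceil 2n(\log2+\log d+\log n-\log\varepsilon)\rceil$. Assume $N\le c\,n$ and $d\le c\,n$ for a constant $c$. Write $\lambda(x):=\max\{1,|\log x|\}$. 1. There is a constant $C$ depending only on $c$ such that, with probability at least $1-\varepsilon$, the output $I$ equals $\operatorname{supp}\hat p$ and at the same time the number of samples is at most $$C\,d\,n^3N\,\lambda(n)\,\lambda(\varepsilon)$$ and the number of arithmetic operations is at most $$C\,d\,n^3N\,\lambda(n)^2\,\lambda(\varepsilon).$$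 2. For every $C_0\ge1$ there is a constant $C$ depending only on $c$ and $C_0$ such that, if also $s\le C_0\,n$, then for all random choices the number of samples is at most $$C\,d\,n^5N\,\lambda(n)^3\lambda(\varepsilon)^3$$ and the number of arithmetic operations is at most $$C\left(d\,n^6\lambda(n)^3\lambda(\varepsilon)^3+d\,n^5N\,\lambda(n)^4\lambda(\varepsilon)^3\,\lambda(|\log\varepsilon|)\right).$$ -/

import Mathlib

noncomputable section

namespace SparseFFT

open scoped Classical

/-! ## Cost model

A computation carries its result together with the number of evaluations of the black box `p` and
the number of arithmetic operations spent on it. All operations on data are counted with unit cost.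
Not counted are control flow and addressing (loop counters, positions in arrays and lists), the
forming of the nodes that are handed over to the black box, and the one-dimensional projections of
the search space with their minima and maxima, which belong to the input. -/

structure Counted (α : Type) where
  val : α
  samples : ℕ
  ops : ℕ

instance : Monad Counted where
  pure a := ⟨a, 0, 0⟩
  bind x f := ⟨(f x.val).val, x.samples + (f x.val).samples, x.ops + (f x.val).ops⟩

/-- The result `a` of one elementary operation: addition, subtraction, multiplication, division,
remainder, comparison or absolute value of numbers, evaluation of `exp (2 π i q)`, or one read or
write of a table of flags. -/
def arith {α : Type} (a : α) : Counted α := ⟨a, 0, 1⟩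

/-- One evaluation of the black box at the node `x`. -/
def evalAt {X : Type} (p : X → ℂ) (x : X) : Counted ℂ := ⟨p x, 1, 0⟩

/-- The array with the entries `f 0, …, f (n - 1)`, all of which are computed and paid for.
(Reading an entry outside of the array gives `0`.) -/
def tabulate {α : Type} [Zero α] (n : ℕ) (f : ℕ → Counted α) : Counted (ℕ → α) :=
  ⟨fun i => if i < n then (f i).val else 0,
    ∑ i ∈ Finset.range n, (f i).samples, ∑ i ∈ Finset.range n, (f i).ops⟩

/-! ## Fast Fourier transform -/

/-- `exp (2 π i q)` -/
def unity (q : ℝ) : ℂ := Complex.exp (2 * Real.pi * Complex.I * q)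

/-- Radix-2 FFT: `k ↦ ∑_{j < 2 ^ m} f j * exp (2 π i σ j k / 2 ^ m)` for `k < 2 ^ m`, with `σ = ±1`. -/
def fft (σ : ℝ) : ℕ → (ℕ → ℂ) → Counted (ℕ → ℂ)
  | 0, f => pure f
  | m + 1, f => do
    let e ← fft σ m (fun j => f (2 * j))
    let o ← fft σ m (fun j => f (2 * j + 1))
    tabulate (2 ^ (m + 1)) fun k => do
      let w ← arith (unity (σ * k / 2 ^ (m + 1)))
      let v ← arith (w * o (k % 2 ^ m))
      arith (e (k % 2 ^ m) + v)

/-- The normalized discrete Fourier transform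
`k ↦ (1 / n) * ∑_{j < n} x j * exp (- 2 π i j k / n)`, `k < n`, of arbitrary length `n ≥ 1`,
by Bluestein's algorithm (a convolution with a chirp, done by FFTs of length a power of two). -/
def dft (n : ℕ) (x : ℕ → ℂ) : Counted (ℕ → ℂ) := do
  let m := Nat.clog 2 (2 * n)
  let L := 2 ^ m
  let a ← tabulate L fun j =>
    if j < n then do
      let w ← arith (unity (-((j : ℝ) ^ 2 / (2 * n))))
      arith (x j * w)
    else pure 0
  let b ← tabulate L fun j =>
    if j < n then arith (unity ((j : ℝ) ^ 2 / (2 * n)))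
    else if L - j < n then arith (unity (((L - j : ℕ) : ℝ) ^ 2 / (2 * n)))
    else pure 0
  let A ← fft (-1) m a
  let B ← fft (-1) m b
  let P ← tabulate L fun k => arith (A k * B k)
  let c ← fft 1 m P
  tabulate n fun k => do
    let w ← arith (unity (-((k : ℝ) ^ 2 / (2 * n))))
    let v ← arith (c k * w)
    arith (v / ((L : ℂ) * n))

/-! ## Detection of the (up to) `s` largest coefficients of absolute value at least `δ` -/

/-- Insert position `j` into a list of positions ordered by decreasing absolute value of `c`. -/
def insertDesc (c : ℕ → ℂ) (j : ℕ) : List ℕ → Counted (List ℕ)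
  | [] => pure [j]
  | i :: l => do
    let b ← arith (decide (‖c i‖ < ‖c j‖))
    if b then pure (j :: i :: l)
    else do
      let l' ← insertDesc c j l
      pure (i :: l')

/-- The positions `j < n` of the (up to) `s` largest values `‖c j‖ ≥ δ`. -/
def detect (δ : ℝ) (s n : ℕ) (c : ℕ → ℂ) : Counted (List ℕ) :=
  (List.range n).foldlM (fun buf j => do
    let a ← arith ‖c j‖
    let b ← arith (decide (δ ≤ a))
    if b then do
      let l ← insertDesc c j buf
      pure (l.take s)
    else pure buf) []

/-- The candidates whose flag is set, paired with their current coefficient. -/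
def collect {κ : Type} (flag : ℕ → Bool) (c : ℕ → ℂ) : ℕ → List κ → Counted (List (κ × ℂ))
  | _, [] => pure []
  | j, k :: l => do
    let b ← arith (flag j)
    let l' ← collect flag c (j + 1) l
    pure (if b then (k, c j) :: l' else l')

/-- The detection iterations. For each entry `x` of `nodes` (the nodes `x 0, …, x (M - 1)` of one
sampling set) the function `p` is sampled at these nodes, the coefficient of a candidate `k` is
entry `key k` of the Fourier transform of the samples, and the (up to) `s` largest coefficients of
absolute value at least `δ` are detected. The result is the union, over all iterations, of
the detected candidates, paired with the coefficients computed in the last iteration. -/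
def detectionLoop {κ X : Type} [Zero κ] (p : X → ℂ) (δ : ℝ) (s M : ℕ) (nodes : List (ℕ → X))
    (cand : List κ) (key : κ → Counted ℕ) : Counted (List (κ × ℂ)) := do
  let keys ← tabulate cand.length fun j => key (cand.getD j 0)
  let res ← nodes.foldlM (fun (st : (ℕ → Bool) × (ℕ → ℂ)) x => do
    let y ← tabulate M fun j => evalAt p (x j)
    let f ← dft M y
    let c := fun j => f (keys j)
    let l ← detect δ s cand.length c
    let flag ← l.foldlM (fun (g : ℕ → Bool) j => arith (Function.update g j true)) st.1
    pure (flag, c)) (fun _ => false, fun _ => 0)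
  collect res.1 res.2 0 cand

/-! ## Component-by-component construction of reconstructing rank-1 lattices -/

/-- Primality of `q ≥ 2` by trial division by `2, …, ⌊√q⌋`. -/
def primeTest (q : ℕ) : Counted Bool :=
  (List.range' 2 (Nat.sqrt q - 1)).foldlM (fun b f => do
    let m ← arith (q % f)
    pure (b && decide (m ≠ 0))) true

/-- The first prime among `q, …, q + fuel - 1`. -/
def firstPrime (q : ℕ) : ℕ → Counted ℕ
  | 0 => pure q
  | fuel + 1 => do
    let b ← primeTest q
    if b then pure q else firstPrime (q + 1) fuel

/-- `b ^ e mod M`, where `e` is given by its binary digits, least significant digit first. -/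
def powMod (M : ℕ) (b : ℤ) : List Bool → Counted ℤ
  | [] => pure 1
  | bit :: l => do
    let v ← powMod M b l
    let w ← arith (v * v)
    let w ← arith (w % M)
    if bit then do
      let w ← arith (w * b)
      arith (w % M)
    else pure w

/-- The first number among `z, …, z + fuel - 1` whose flag is not set. -/
def firstFree (flag : ℤ → Bool) (z : ℤ) : ℕ → Counted ℤ
  | 0 => pure z
  | fuel + 1 => do
    let b ← arith (flag z)
    if b then firstFree flag (z + 1) fuel else pure z

/-- The next component of the generating vector, for a prime lattice size `M`: the least `z ≥ 0`
such that `u i + a i * z ≢ u j + a j * z (mod M)` for all `i, j < n` with `a i ≢ a j (mod M)`.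
Each such pair excludes one residue `z`, which is computed (the inverse mod `M` as a power with
exponent `M - 2`) and flagged. -/
def nextComponent (M n : ℕ) (u a : ℕ → ℤ) : Counted ℤ := do
  let flag ← (List.range n ×ˢ List.range n).foldlM (fun (g : ℤ → Bool) (ij : ℕ × ℕ) => do
    let b ← arith (a ij.1 - a ij.2)
    let b ← arith (b % M)
    if b = 0 then pure g
    else do
      let v ← powMod M b (Nat.bits (M - 2))
      let w ← arith (u ij.2 - u ij.1)
      let w ← arith (w * v)
      let w ← arith (w % M)
      arith (Function.update g w true)) (fun _ => false)
  firstFree flag 0 M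

variable {d : ℕ}

/-- Component-by-component construction, for the prime lattice size `M`, of the components
`z i`, `i < t`, of a generating vector such that the frequencies `k ∈ I` (with components `k i`,
`i < t`) have pairwise distinct residues `∑_{i < t} k i * z i` mod `M`. The array `zu.2` holds the
residues for the components treated so far. -/
def generatingVector (M t : ℕ) (I : List (Fin d → ℤ)) : Counted (Fin d → ℤ) := do
  let res ← ((List.finRange d).filter (fun i => decide (i.val < t))).foldlM
    (fun (zu : (Fin d → ℤ) × (ℕ → ℤ)) i => do
      let a : ℕ → ℤ := fun j => (I.getD j 0) i
      let zi ← nextComponent M I.length zu.2 a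
      let u ← tabulate I.length fun j => do
        let v ← arith (a j * zi)
        let v ← arith (zu.2 j + v)
        arith (v % M)
      pure (Function.update zu.1 i zi, u)) (0, fun _ => 0)
  pure res.1

/-! ## The search space and its projections -/

/-- Projection of the search space to component `t`. -/
def proj (Γ : Finset (Fin d → ℤ)) (t : Fin d) : Finset ℤ := Γ.image fun k => k t

/-- Length of the integer interval spanned by the projection to component `t`:
maximum minus minimum plus one. -/
def extent (Γ : Finset (Fin d → ℤ)) (t : Fin d) : ℕ :=
  if h : (proj Γ t).Nonempty then ((proj Γ t).max' h - (proj Γ t).min' h + 1).toNat else 1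

/-- Projection of a frequency to its components up to and including component `t`.
A vector of these components is represented by its extension by zeros. -/
def trunc (t : Fin d) (k : Fin d → ℤ) : Fin d → ℤ := fun i => if i ≤ t then k i else 0

/-- Projection of the search space to the components up to and including component `t`. -/
def projUpTo (Γ : Finset (Fin d → ℤ)) (t : Fin d) : Finset (Fin d → ℤ) := Γ.image (trunc t)

/-- Membership test in `projUpTo Γ t`; the comparison of vectors with `t + 1` components is charged
as `t + 1` operations. -/
def memTest (Γ : Finset (Fin d → ℤ)) (t : Fin d) (k : Fin d → ℤ) : Counted Bool :=
  ⟨decide (k ∈ projUpTo Γ t), 0, t.val + 1⟩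

/-! ## The algorithm -/

/-- All random choices of the algorithm with `r` detection iterations: `ω.1 t i` provides the
random node components in iteration `i` of the detection of the one-dimensional projection to
component `t`, and `ω.2 t i` those in iteration `i` of the detection of the projection to
components `0, …, t`. Components that an iteration does not need are ignored. -/
abbrev Randomness (d r : ℕ) : Type :=
  (Fin d → Fin r → Fin d → UnitAddCircle) × (Fin d → Fin r → Fin d → UnitAddCircle)

/-- The law of the random choices: all components are independent and uniformly distributed on the
circle `ℝ / ℤ` (`AddCircle.haarAddCircle` is the Haar probability measure). -/
def uniformLaw (d r : ℕ) : MeasureTheory.Measure (Randomness d r) :=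
  let μ : MeasureTheory.Measure (Fin d → Fin r → Fin d → UnitAddCircle) :=
    .pi fun _ => .pi fun _ => .pi fun _ => AddCircle.haarAddCircle
  μ.prod μ

/-- Detection of the components number `t` of the unknown frequencies. -/
def detectComponent (Γ : Finset (Fin d → ℤ)) (p : (Fin d → UnitAddCircle) → ℂ) (δ : ℝ)
    (sLocal : ℕ) {r : ℕ} (ω : Randomness d r) (t : Fin d) : Counted (List (ℤ × ℂ)) :=
  let K := extent Γ t
  let nodes : List (ℕ → Fin d → UnitAddCircle) := (List.finRange r).map fun i j =>
    Function.update (ω.1 t i) t (((j : ℝ) / K : ℝ) : UnitAddCircle)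
  detectionLoop p δ sLocal K nodes ((proj Γ t).sort (· ≤ ·))
    (fun k => do
      let m ← arith (k % K)
      pure m.toNat)

/-- One dimension increment: from the set `I` of detected projections to the components `i < t` to
the set of detected projections to the components `i ≤ t`. -/
def dimensionStep (Γ : Finset (Fin d → ℤ)) (p : (Fin d → UnitAddCircle) → ℂ) (δ : ℝ)
    (s sLocal : ℕ) {r : ℕ} (ω : Randomness d r) (t : Fin d) (I : List (Fin d → ℤ)) :
    Counted (List ((Fin d → ℤ) × ℂ)) := do
  let It ← detectComponent Γ p δ sLocal ω t
  let rt := if t.val + 1 < d then r else 1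
  let st := if t.val + 1 < d then sLocal else s
  -- the candidates: all pairs of an element of `I` and an element of `It` that lie in
  -- the projection of the search space
  let J ← (I ×ˢ It.map Prod.fst).foldlM (fun (J : List (Fin d → ℤ)) ka => do
    let b ← memTest Γ t (Function.update ka.1 t ka.2)
    pure (if b then Function.update ka.1 t ka.2 :: J else J)) []
  -- a reconstructing rank-1 lattice for `I` with prime lattice size `M'` ...
  let q := max (max (I.length ^ 2) 2) ((Finset.univ.filter (· < t)).sup (extent Γ))
  let M' ← firstPrime q q
  let z' ← generatingVector M' t.val I
  -- ... and its extension to a reconstructing rank-1 lattice for the candidates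
  let z : Fin d → ℤ := Function.update z' t (M' : ℤ)
  let M ← arith (M' * extent Γ t)
  let nodes : List (ℕ → Fin d → UnitAddCircle) := ((List.finRange r).take rt).map fun i j l =>
    if l ≤ t then (((j : ℝ) * (z l : ℝ) / M : ℝ) : UnitAddCircle) else ω.2 t i l
  detectionLoop p δ st M nodes J
    (fun k => do
      let v ← ((List.finRange d).filter (· ≤ t)).foldlM (fun (v : ℤ) l => do
        let w ← arith (k l * z l)
        arith (v + w)) 0
      let v ← arith (v % M)
      pure v.toNat)

/-- The detected frequencies (projected to the components `i < t`) and their coefficients after the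
first `t` components have been treated. -/
def stage (Γ : Finset (Fin d → ℤ)) (p : (Fin d → UnitAddCircle) → ℂ) (δ : ℝ) (s sLocal : ℕ)
    {r : ℕ} (ω : Randomness d r) : ℕ → Counted (List ((Fin d → ℤ) × ℂ))
  | 0 => pure []
  | t + 1 =>
    if h : t < d then
      if t = 0 then do
        let I ← detectComponent Γ p δ sLocal ω ⟨t, h⟩
        pure (I.map fun kc => (Pi.single ⟨t, h⟩ kc.1, kc.2))
      else do
        let I ← stage Γ p δ s sLocal ω t
        dimensionStep Γ p δ s sLocal ω ⟨t, h⟩ (I.map Prod.fst)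
    else stage Γ p δ s sLocal ω t

/-- The dimension-incremental reconstruction with single reconstructing rank-1 lattices: search
space `Γ`, black box `p`, absolute threshold `δ`, sparsity parameters `s` and `sLocal`, `r`
detection iterations, random choices `ω`. The output is the list of detected frequencies with the
computed Fourier coefficients. -/
def singleLatticeSFFT (Γ : Finset (Fin d → ℤ)) (p : (Fin d → UnitAddCircle) → ℂ) (δ : ℝ)
    (s sLocal : ℕ) {r : ℕ} (ω : Randomness d r) : Counted (List ((Fin d → ℤ) × ℂ)) :=
  stage Γ p δ s sLocal ω d

/-- The index set of an output. -/
def indexSet (out : List ((Fin d → ℤ) × ℂ)) : Finset (Fin d → ℤ) := (out.map Prod.fst).toFinset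

/-! ## Trigonometric polynomials and choice of the parameters -/

/-- The trigonometric polynomial with Fourier coefficients `phat`:
`p x = ∑_{k ∈ supp phat} phat k * exp (2 π i k · x)`. -/
def trigPoly (phat : (Fin d → ℤ) →₀ ℂ) (x : Fin d → UnitAddCircle) : ℂ :=
  phat.sum fun k a => a * UnitAddTorus.mFourier k x

/-- The number of detection iterations
`⌈2 |supp phat| (log 2 + log d + log |supp phat| - log ε)⌉`. -/
def iterations (phat : (Fin d → ℤ) →₀ ℂ) (ε : ℝ) : ℕ :=
  ⌈2 * (phat.support.card : ℝ) *
    (Real.log 2 + Real.log d + Real.log phat.support.card - Real.log ε)⌉₊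

/-- The choice of the parameters. The number `c` is the implied constant in the assumptions
`N ≲ |supp phat|` and `d ≲ |supp phat|`. -/
structure Admissible (c : ℝ) (N : ℕ) (Γ : Finset (Fin d → ℤ)) (phat : (Fin d → ℤ) →₀ ℂ)
    (δ : ℝ) (s : ℕ) (ε : ℝ) : Prop where
  one_le_d : 1 ≤ d
  one_le_N : 1 ≤ N
  eps_pos : 0 < ε
  eps_lt_one : ε < 1
  supp_nonempty : phat.support.Nonempty
  supp_subset : phat.support ⊆ Γ
  subset_grid : ∀ k ∈ Γ, ∀ i, |k i| ≤ (N : ℤ)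
  delta_pos : 0 < δ
  delta_le : ∀ h ∈ phat.support, δ ≤ ‖phat h‖ / 3
  supp_le_s : phat.support.card ≤ s
  N_le : (N : ℝ) ≤ c * phat.support.card
  d_le : (d : ℝ) ≤ c * phat.support.card

/-- `max {1, |log x|}`, the logarithmic factors in the bounds: without the maximum they would vanish
(and the bounds would fail) for `x = 1`. -/
def logFactor (x : ℝ) : ℝ := max 1 |Real.log x|

end SparseFFT

end

open SparseFFT

/-!
The theorem has three ingredients: the computed coefficients are exact, random sampling does not
overlook a frequency, and the work of every loop can be counted.

*Exactness.* The normalized discrete Fourier transform of the samples along a rank-1 lattice of size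
`M` with generating vector `z` gives at position `k · z mod M` the sum of all Fourier coefficients
whose frequency has the same residue (`dft_val` for Bluestein's algorithm, `nodeCoeff_modes`). If
the set `I` of frequencies found before is the exact projection of the support, then the
constructed lattice separates all projections that can occur (`stepVector_reconstructing`): the prime
lattice size `M' ≥ |I| ^ 2` exists by Bertrand's postulate, at most `|I| ^ 2 - |I|` residues are
excluded for each component (`nextComponent_val`), and `M'` exceeds the differences of components.
Hence the coefficient of a candidate `k` is a trigonometric polynomial in the remaining random
variables, the `fiberSum` of those frequencies whose projection is `k`. It vanishes if there are
none, so that nothing superfluous passes the threshold `δ > 0`, and since there are at most `s`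
nonzero coefficients none is dropped (`detectionLoop_exact`). By induction the output is the support
as soon as each projection is seen in some iteration (`stage_exact`, `indexSet_eq`).

*Probability.* A `fiberSum` `g` with largest coefficient `m` satisfies `m ≤ E|g|`, because `m` is the
absolute value of a Fourier coefficient of `g`, and `|g| ≤ n m`. With `δ ≤ m / 3` this gives
`P(|g| ≥ δ) ≥ 2 / (3 n)` (`prob_small_le`). By independence a projection is missed in all `r`
iterations with probability at most `(1 - 2 / (3 n)) ^ r ≤ ε / (2 d n)`, and there are at most
`2 d n` such events (`prob_allSeen`).

*Cost.* One dimension increment costs at most `stepCost` operations, in terms of a bound `A` for the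
size of the sets of frequencies and a bound `U` for the work spent on sorted insertion
(`dimensionStep_cost`). On the event that all projections are seen, `A = n` and only `n` coefficients
are inserted (`cost_of_allSeen`); in general `A = r s`, and at most all `A * 3 N` candidates are
inserted into a list of length at most `s` (`cost_of_any`). Both bounds then follow from
`total_cost_le`, where `A` is of order `y`, with `y = n` and `y = n ^ 2 λ(n) λ(ε)`, respectively.
-/

noncomputable section

namespace SparseFFT

/-! ### Sequences of counted computations -/

section Monad
variable {α β σ : Type}

@[simp] lemma pure_val (a : α) : (pure a : Counted α).val = a := rfl
@[simp] lemma pure_samples (a : α) : (pure a : Counted α).samples = 0 := rfl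
@[simp] lemma pure_ops (a : α) : (pure a : Counted α).ops = 0 := rfl
@[simp] lemma bind_val (x : Counted α) (f : α → Counted β) : (x >>= f).val = (f x.val).val := rfl
@[simp] lemma bind_samples (x : Counted α) (f : α → Counted β) :
    (x >>= f).samples = x.samples + (f x.val).samples := rfl
@[simp] lemma bind_ops (x : Counted α) (f : α → Counted β) :
    (x >>= f).ops = x.ops + (f x.val).ops := rfl
@[simp] lemma arith_val (a : α) : (arith a).val = a := rfl
@[simp] lemma arith_samples (a : α) : (arith a).samples = 0 := rfl
@[simp] lemma arith_ops (a : α) : (arith a).ops = 1 := rfl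
@[simp] lemma evalAt_val (p : α → ℂ) (a : α) : (evalAt p a).val = p a := rfl
@[simp] lemma evalAt_samples (p : α → ℂ) (a : α) : (evalAt p a).samples = 1 := rfl
@[simp] lemma evalAt_ops (p : α → ℂ) (a : α) : (evalAt p a).ops = 0 := rfl

@[simp] lemma tabulate_val [Zero α] (n : ℕ) (f : ℕ → Counted α) (i : ℕ) :
    (tabulate n f).val i = if i < n then (f i).val else 0 := rfl
@[simp] lemma tabulate_samples [Zero α] (n : ℕ) (f : ℕ → Counted α) :
    (tabulate n f).samples = ∑ i ∈ Finset.range n, (f i).samples := rfl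
@[simp] lemma tabulate_ops [Zero α] (n : ℕ) (f : ℕ → Counted α) :
    (tabulate n f).ops = ∑ i ∈ Finset.range n, (f i).ops := rfl

lemma Counted.ext' {x y : Counted α} (h1 : x.val = y.val) (h2 : x.samples = y.samples)
    (h3 : x.ops = y.ops) : x = y := by
  cases x; cases y; simp_all

instance : LawfulMonad Counted := LawfulMonad.mk'
  (id_map := fun x => Counted.ext' rfl (Nat.add_zero _) (Nat.add_zero _))
  (pure_bind := fun x f => Counted.ext' rfl (Nat.zero_add _) (Nat.zero_add _))
  (bind_assoc := fun x f g => Counted.ext' rfl (Nat.add_assoc _ _ _) (Nat.add_assoc _ _ _))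

/-- Loop rule: an invariant `P` is maintained, and the cost of a loop is at most the sum of the
bounds `g x` for its individual passes. -/
lemma foldlM_invariant {P : σ → Prop} {f : σ → α → Counted σ} (g : α → ℕ) {l : List α}
    (h : ∀ s, P s → ∀ x ∈ l, P (f s x).val ∧ (f s x).samples = 0 ∧ (f s x).ops ≤ g x)
    {a : σ} (ha : P a) :
    P (l.foldlM f a).val ∧ (l.foldlM f a).samples = 0 ∧ (l.foldlM f a).ops ≤ (l.map g).sum := by
  induction l generalizing a with
  | nil => exact ⟨ha, rfl, Nat.zero_le _⟩
  | cons x l ih =>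
    obtain ⟨h1, h2, h3⟩ := h a ha x (by simp)
    obtain ⟨i1, i2, i3⟩ := ih (fun s hs y hy => h s hs y (by simp [hy])) h1
    simp only [List.foldlM_cons, bind_val, bind_samples, bind_ops, List.map_cons, List.sum_cons]
    exact ⟨i1, by omega, by omega⟩

/-- Loop rule without invariant and with a uniform bound for the cost of a pass. -/
lemma foldlM_cost {f : σ → α → Counted σ} (b : ℕ) {l : List α}
    (h : ∀ s, ∀ x ∈ l, (f s x).samples = 0 ∧ (f s x).ops ≤ b) (a : σ) :
    (l.foldlM f a).samples = 0 ∧ (l.foldlM f a).ops ≤ l.length * b := by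
  have := (foldlM_invariant (P := fun _ => True) (fun _ => b)
    (fun s _ x hx => ⟨trivial, h s x hx⟩) (a := a) trivial).2
  simpa using this

end Monad

/-! ### Discrete Fourier transform -/

lemma unity_add (x y : ℝ) : unity (x + y) = unity x * unity y := by
  simp [unity, ← Complex.exp_add, mul_add]

@[simp] lemma unity_int (n : ℤ) : unity n = 1 := by
  have := Complex.exp_int_mul_two_pi_mul_I n
  rw [← this]
  simp only [unity]
  congr 1
  push_cast; ring

@[simp] lemma unity_zero : unity 0 = 1 := by simpa using unity_int 0

lemma unity_eq_of_sub_int {x y : ℝ} (n : ℤ) (h : x = y + n) : unity x = unity y := by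
  rw [h, unity_add, unity_int, mul_one]

lemma unity_nat_mul (j : ℕ) (x : ℝ) : unity (j * x) = unity x ^ j := by
  simp only [unity, ← Complex.exp_nat_mul]
  congr 1; push_cast; ring

lemma unity_eq_one_iff {x : ℝ} : unity x = 1 ↔ ∃ n : ℤ, x = n := by
  rw [unity, Complex.exp_eq_one_iff]
  have hpi := Complex.two_pi_I_ne_zero
  constructor
  · rintro ⟨n, hn⟩
    refine ⟨n, ?_⟩
    have : (x : ℂ) = n := by
      apply mul_left_cancel₀ hpi
      rw [hn]; ring
    exact_mod_cast this
  · rintro ⟨n, rfl⟩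
    exact ⟨n, by push_cast; ring⟩

/-- Orthogonality of characters of `ℤ / n`. -/
lemma sum_unity {n : ℕ} (hn : 0 < n) (a : ℤ) :
    ∑ j ∈ Finset.range n, unity (j * a / n) = if (n : ℤ) ∣ a then (n : ℂ) else 0 := by
  have hn' : (n : ℝ) ≠ 0 := by positivity
  have key : ∀ j : ℕ, unity (j * a / n) = unity ((a : ℝ) / n) ^ j := fun j => by
    rw [← unity_nat_mul, mul_div_assoc]
  simp_rw [key]
  split_ifs with h
  · obtain ⟨b, rfl⟩ := h
    have : unity (((n * b : ℤ) : ℝ) / n) = 1 := by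
      rw [unity_eq_one_iff]
      exact ⟨b, by push_cast; field_simp⟩
    rw [this]; simp
  · have h1 : unity ((a : ℝ) / n) ≠ 1 := by
      rw [Ne, unity_eq_one_iff]
      rintro ⟨b, hb⟩
      apply h
      refine ⟨b, ?_⟩
      rw [div_eq_iff hn'] at hb
      have : (a : ℝ) = ((n * b : ℤ) : ℝ) := by push_cast; linarith
      exact_mod_cast this
    rw [geom_sum_eq h1, ← unity_nat_mul, mul_div_cancel₀ _ hn', unity_int]
    simp

lemma sum_range_even_odd (n : ℕ) (f : ℕ → ℂ) :
    ∑ j ∈ Finset.range (2 * n), f j =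
      ∑ j ∈ Finset.range n, f (2 * j) + ∑ j ∈ Finset.range n, f (2 * j + 1) := by
  induction n with
  | zero => simp
  | succ n ih =>
    rw [show 2 * (n + 1) = 2 * n + 1 + 1 by ring, Finset.sum_range_succ, Finset.sum_range_succ,
      Finset.sum_range_succ, Finset.sum_range_succ, ih]
    ring

lemma fft_val {σ : ℝ} (hσ : σ = 1 ∨ σ = -1) (m : ℕ) (f : ℕ → ℂ) {k : ℕ} (hk : k < 2 ^ m) :
    (fft σ m f).val k = ∑ j ∈ Finset.range (2 ^ m), f j * unity (σ * j * k / 2 ^ m) := by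
  induction m generalizing f k with
  | zero =>
    obtain rfl : k = 0 := by simpa using hk
    simp [fft]
  | succ m ih =>
    have h2 : k % 2 ^ m < 2 ^ m := Nat.mod_lt _ (by positivity)
    -- the half-length transforms are periodic in `k` with period `2 ^ m`
    have per : ∀ j : ℕ, unity (σ * j * (k % 2 ^ m : ℕ) / 2 ^ m) = unity (σ * j * k / 2 ^ m) := by
      intro j
      obtain ⟨q, hq⟩ : ∃ q : ℕ, k = k % 2 ^ m + 2 ^ m * q := ⟨_, (Nat.mod_add_div k _).symm⟩
      have hk' : (k : ℝ) = (k % 2 ^ m : ℕ) + 2 ^ m * (q : ℝ) := by exact_mod_cast hq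
      symm
      rcases hσ with rfl | rfl
      · apply unity_eq_of_sub_int ((j * q : ℕ) : ℤ)
        rw [hk']; push_cast; field_simp
      · apply unity_eq_of_sub_int (-((j * q : ℕ) : ℤ))
        rw [hk']; push_cast; field_simp; ring
    simp only [fft, bind_val, arith_val, tabulate_val, if_pos hk, ih _ h2]
    rw [show Finset.range (2 ^ (m + 1)) = Finset.range (2 * 2 ^ m) by rw [pow_succ'],
      sum_range_even_odd, Finset.mul_sum]
    congr 1
    · refine Finset.sum_congr rfl fun j _ => ?_
      rw [per]
      congr 2
      push_cast; rw [pow_succ]; field_simp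
    · refine Finset.sum_congr rfl fun j _ => ?_
      rw [per, mul_left_comm, ← unity_add]
      congr 2
      push_cast; field_simp; ring

lemma fft_samples (σ : ℝ) (m : ℕ) (f : ℕ → ℂ) : (fft σ m f).samples = 0 := by
  induction m generalizing f with
  | zero => rfl
  | succ m ih => simp [fft, ih]

lemma fft_ops (σ : ℝ) (m : ℕ) (f : ℕ → ℂ) : (fft σ m f).ops = 3 * m * 2 ^ m := by
  induction m generalizing f with
  | zero => rfl
  | succ m ih =>
    simp only [fft, bind_ops, tabulate_ops, ih, arith_ops, Finset.sum_const, Finset.card_range,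
      smul_eq_mul]
    ring

/-- Cyclic convolution by means of discrete Fourier transforms. -/
lemma sum_unity_convolution {L : ℕ} (hL : 0 < L) (a b : ℕ → ℂ) (k : ℕ) :
    ∑ j ∈ Finset.range L, ((∑ u ∈ Finset.range L, a u * unity (-1 * u * j / L)) *
      ∑ v ∈ Finset.range L, b v * unity (-1 * v * j / L)) * unity (1 * j * k / L) =
    L * ∑ u ∈ Finset.range L, ∑ v ∈ Finset.range L,
      if (L : ℤ) ∣ (k : ℤ) - u - v then a u * b v else 0 := by
  have : ∀ j ∈ Finset.range L, ((∑ u ∈ Finset.range L, a u * unity (-1 * u * j / L)) *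
      ∑ v ∈ Finset.range L, b v * unity (-1 * v * j / L)) * unity (1 * j * k / L) =
      ∑ u ∈ Finset.range L, ∑ v ∈ Finset.range L,
        a u * b v * unity (j * ((k : ℤ) - u - v : ℤ) / L) := by
    intro j _
    rw [Finset.sum_mul_sum, Finset.sum_mul]
    refine Finset.sum_congr rfl fun u _ => ?_
    rw [Finset.sum_mul]
    refine Finset.sum_congr rfl fun v _ => ?_
    have : (j : ℝ) * ((k : ℤ) - u - v : ℤ) / L =
      -1 * u * j / L + -1 * v * j / L + 1 * j * k / L := by push_cast; ring
    rw [this, unity_add, unity_add]; ring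
  rw [Finset.sum_congr rfl this, Finset.sum_comm, Finset.mul_sum]
  refine Finset.sum_congr rfl fun u _ => ?_
  rw [Finset.sum_comm, Finset.mul_sum]
  refine Finset.sum_congr rfl fun v _ => ?_
  rw [← Finset.mul_sum, sum_unity hL]
  split_ifs <;> ring

/-- Bluestein's algorithm computes the normalized discrete Fourier transform. -/
lemma dft_val {n : ℕ} (x : ℕ → ℂ) {k : ℕ} (hk : k < n) :
    (dft n x).val k =
      (1 / n : ℂ) * ∑ j ∈ Finset.range n, x j * unity (-((j : ℝ) * k / n)) := by
  have hn : 0 < n := by omega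
  have hn' : (n : ℝ) ≠ 0 := by positivity
  have hL : 2 * n ≤ 2 ^ Nat.clog 2 (2 * n) := Nat.le_pow_clog (by norm_num) _
  simp only [dft, bind_val, arith_val, tabulate_val, if_pos hk]
  generalize Nat.clog 2 (2 * n) = m at hL ⊢
  have hL0 : 0 < 2 ^ m := by positivity
  have hkL : k < 2 ^ m := by omega
  rw [fft_val (Or.inl rfl) m _ hkL]
  set a : ℕ → ℂ := fun j => if j < n then x j * unity (-((j : ℝ) ^ 2 / (2 * n))) else 0 with ha
  set b : ℕ → ℂ := fun j => if j < n then unity ((j : ℝ) ^ 2 / (2 * n))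
    else if 2 ^ m - j < n then unity (((2 ^ m - j : ℕ) : ℝ) ^ 2 / (2 * n)) else 0 with hb
  have h1 : ∀ j ∈ Finset.range (2 ^ m), ∀ (A B : ℕ → ℂ), (∀ i < 2 ^ m, A i = a i) →
      (∀ i < 2 ^ m, B i = b i) →
      (tabulate (2 ^ m) fun k => arith ((fft (-1) m A).val k * (fft (-1) m B).val k)).val j =
      (∑ u ∈ Finset.range (2 ^ m), a u * unity (-1 * u * j / (2 ^ m : ℕ))) *
      ∑ v ∈ Finset.range (2 ^ m), b v * unity (-1 * v * j / (2 ^ m : ℕ)) := by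
    intro j hj A B hA hB
    rw [tabulate_val, if_pos (Finset.mem_range.1 hj), arith_val,
      fft_val (Or.inr rfl) m _ (Finset.mem_range.1 hj),
      fft_val (Or.inr rfl) m _ (Finset.mem_range.1 hj)]
    congr 1
    · exact Finset.sum_congr rfl fun u hu => by rw [hA u (Finset.mem_range.1 hu)]; push_cast; rfl
    · exact Finset.sum_congr rfl fun u hu => by rw [hB u (Finset.mem_range.1 hu)]; push_cast; rfl
  have h2 := fun j hj => h1 j hj
    (tabulate (2 ^ m) fun j => if j < n then (do
      let w ← arith (unity (-((j : ℝ) ^ 2 / (2 * n))))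
      arith (x j * w)) else pure 0).val
    (tabulate (2 ^ m) fun j =>
      if j < n then arith (unity ((j : ℝ) ^ 2 / (2 * n)))
      else if 2 ^ m - j < n then arith (unity (((2 ^ m - j : ℕ) : ℝ) ^ 2 / (2 * n)))
      else pure 0).val
    (fun i hi => by rw [tabulate_val, if_pos hi]; simp only [ha]; split_ifs <;> rfl)
    (fun i hi => by rw [tabulate_val, if_pos hi]; simp only [hb]; split_ifs <;> rfl)
  have h3 := sum_unity_convolution hL0 a b k
  rw [Finset.sum_congr rfl fun j hj => by rw [h2 j hj]]
  push_cast at h3 ⊢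
  rw [h3]
  -- only one `v` satisfies the congruence, and `b v` is the chirp at `k - u`
  have h4 : ∀ u ∈ Finset.range (2 ^ m), (∑ v ∈ Finset.range (2 ^ m),
      if (2 ^ m : ℤ) ∣ (k : ℤ) - u - v then a u * b v else 0) =
      if u < n then x u * unity (-((u : ℝ) ^ 2 / (2 * n))) *
        unity (((k : ℝ) - u) ^ 2 / (2 * n)) else 0 := by
    intro u hu
    by_cases hun : u < n
    · rw [if_pos hun]
      have hcast : ((2 ^ m : ℕ) : ℤ) = 2 ^ m := by push_cast; rfl
      rcases le_or_gt u k with huk | huk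
      · rw [Finset.sum_eq_single (k - u)]
        · rw [if_pos (by rw [Nat.cast_sub huk]; simp)]
          simp only [ha, hb, if_pos hun]
          rw [if_pos (by omega), Nat.cast_sub huk]
        · intro v hv hne
          rw [if_neg]
          rintro ⟨e, he⟩
          rw [Finset.mem_range] at hv
          apply hne
          have : e = 0 := by
            have := hcast ▸ he
            have e1 : e < 1 := by nlinarith
            have e2 : -1 < e := by nlinarith
            omega
          subst this
          omega
        · intro hv; exact absurd (Finset.mem_range.2 (by omega)) hv
      · rw [Finset.sum_eq_single (2 ^ m + k - u)]
        · rw [if_pos (by rw [Nat.cast_sub (by omega)]; exact ⟨-1, by push_cast; ring⟩)]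
          simp only [ha, hb, if_pos hun]
          rw [if_neg (by omega), if_pos (by omega),
            show 2 ^ m - (2 ^ m + k - u) = u - k by omega, Nat.cast_sub huk.le]
          congr 3; ring
        · intro v hv hne
          rw [if_neg]
          rintro ⟨e, he⟩
          rw [Finset.mem_range] at hv
          apply hne
          have : e = -1 := by
            have := hcast ▸ he
            have e1 : e < 0 := by nlinarith
            have e2 : -2 < e := by nlinarith
            omega
          subst this
          omega
        · intro hv; exact absurd (Finset.mem_range.2 (by omega)) hv
    · rw [if_neg hun]
      simp [ha, hun]
  rw [Finset.sum_congr rfl h4, ← Finset.sum_filter,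
    show (Finset.range (2 ^ m)).filter (· < n) = Finset.range n by ext; simp; omega]
  have hLC : (2 ^ m : ℂ) ≠ 0 := pow_ne_zero _ two_ne_zero
  have hnC : (n : ℂ) ≠ 0 := by exact_mod_cast hn.ne'
  rw [div_eq_iff (mul_ne_zero hLC hnC), show ∀ S : ℂ, 1 / (n : ℂ) * S * (2 ^ m * n) = 2 ^ m * S
    from fun S => by field_simp, mul_assoc, Finset.sum_mul]
  congr 1
  refine Finset.sum_congr rfl fun j _ => ?_
  -- Bluestein's identity `- 2 j k = - k ^ 2 - j ^ 2 + (k - j) ^ 2`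
  rw [show -((j : ℝ) * k / n) = -((k : ℝ) ^ 2 / (2 * n)) + (-((j : ℝ) ^ 2 / (2 * n)) +
    (k - j) ^ 2 / (2 * n)) by field_simp; ring, unity_add, unity_add]
  ring

lemma dft_samples (n : ℕ) (x : ℕ → ℂ) : (dft n x).samples = 0 := by
  simp only [dft, bind_samples, tabulate_samples, fft_samples, arith_samples]
  rw [Finset.sum_eq_zero, Finset.sum_eq_zero]
  · simp
  · intro j _; split_ifs <;> rfl
  · intro j _; split_ifs <;> rfl

/-- Bound for the number of operations of `dft n`. -/
def dftCost (n : ℕ) : ℕ := 4 * n * (9 * Nat.clog 2 (2 * n) + 5)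

lemma dftCost_mono {m n : ℕ} (h : m ≤ n) : dftCost m ≤ dftCost n := by
  unfold dftCost
  have : Nat.clog 2 (2 * m) ≤ Nat.clog 2 (2 * n) := Nat.clog_mono_right 2 (by omega)
  gcongr

lemma dft_ops {n : ℕ} (hn : 0 < n) (x : ℕ → ℂ) : (dft n x).ops ≤ dftCost n := by
  have hL : 2 ^ Nat.clog 2 (2 * n) ≤ 4 * n := by
    have h1 := Nat.pow_pred_clog_lt_self (b := 2) (by norm_num) (x := 2 * n) (by omega)
    have h2 : 0 < Nat.clog 2 (2 * n) := Nat.clog_pos (by norm_num) (by omega)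
    obtain ⟨m, hm⟩ : ∃ m, Nat.clog 2 (2 * n) = m + 1 := ⟨_, (Nat.succ_pred_eq_of_pos h2).symm⟩
    rw [hm] at h1 ⊢
    rw [Nat.pred_succ] at h1
    rw [pow_succ]; omega
  simp only [dft, bind_ops, tabulate_ops, fft_ops, arith_ops, dftCost]
  generalize Nat.clog 2 (2 * n) = m at hL ⊢
  have h1 : ∀ (f : ℕ → Counted ℂ) (b : ℕ), (∀ j, (f j).ops ≤ b) →
      ∑ j ∈ Finset.range (2 ^ m), (f j).ops ≤ 2 ^ m * b := fun f b h => by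
    simpa using Finset.sum_le_card_nsmul (Finset.range (2 ^ m)) _ b fun j _ => h j
  have hA := h1 (fun j => if j < n then (do
      let w ← arith (unity (-((j : ℝ) ^ 2 / (2 * n))))
      arith (x j * w)) else pure 0) 2 (fun j => by
        split_ifs
        · exact le_rfl
        · exact Nat.zero_le _)
  have hB := h1 (fun j => if j < n then arith (unity ((j : ℝ) ^ 2 / (2 * n)))
    else if 2 ^ m - j < n then arith (unity (((2 ^ m - j : ℕ) : ℝ) ^ 2 / (2 * n)))
    else pure 0) 1 (fun j => by
        split_ifs
        · exact le_rfl
        · exact le_rfl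
        · exact Nat.zero_le _)
  simp only [Finset.sum_const, Finset.card_range, smul_eq_mul]
  have h9 : 9 * m * 2 ^ m ≤ 9 * m * (4 * n) := by gcongr
  generalize 2 ^ m = L at *
  nlinarith

/-! ### Detection of the large coefficients -/

lemma insertDesc_perm (c : ℕ → ℂ) (j : ℕ) (l : List ℕ) : (insertDesc c j l).val.Perm (j :: l) := by
  induction l with
  | nil => exact List.Perm.refl _
  | cons i l ih =>
    simp only [insertDesc, bind_val, arith_val]
    by_cases h : ‖c i‖ < ‖c j‖
    · simp only [h, decide_true, if_true, pure_val]
      exact List.Perm.refl _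
    · simp only [h, decide_false, Bool.false_eq_true, if_false, bind_val, pure_val]
      exact (ih.cons i).trans (List.Perm.swap _ _ _)

lemma insertDesc_cost (c : ℕ → ℂ) (j : ℕ) (l : List ℕ) :
    (insertDesc c j l).samples = 0 ∧ (insertDesc c j l).ops ≤ l.length := by
  induction l with
  | nil => exact ⟨rfl, le_rfl⟩
  | cons i l ih =>
    simp only [insertDesc, bind_samples, bind_ops, arith_val, arith_samples, arith_ops,
      List.length_cons]
    by_cases h : ‖c i‖ < ‖c j‖
    · simp [h]
    · simp only [h, decide_false, Bool.false_eq_true, if_false, bind_samples, bind_ops,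
        pure_samples, pure_ops]
      omega

/-- The positions `j < n` with `‖c j‖ ≥ δ`. -/
def large (δ : ℝ) (n : ℕ) (c : ℕ → ℂ) : Finset ℕ := (Finset.range n).filter fun j => δ ≤ ‖c j‖

lemma mem_large {δ : ℝ} {n : ℕ} {c : ℕ → ℂ} {j : ℕ} : j ∈ large δ n c ↔ j < n ∧ δ ≤ ‖c j‖ := by
  simp [large]

lemma large_card_le (δ : ℝ) (n : ℕ) (c : ℕ → ℂ) : (large δ n c).card ≤ n :=
  (Finset.card_filter_le _ _).trans (Finset.card_range n).le

lemma large_succ (δ : ℝ) (n : ℕ) (c : ℕ → ℂ) :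
    large δ (n + 1) c = if δ ≤ ‖c n‖ then insert n (large δ n c) else large δ n c := by
  rw [large, Finset.range_add_one, Finset.filter_insert]; rfl

lemma card_large_succ (δ : ℝ) (n : ℕ) (c : ℕ → ℂ) :
    (large δ (n + 1) c).card =
      if δ ≤ ‖c n‖ then (large δ n c).card + 1 else (large δ n c).card := by
  rw [large_succ]
  split_ifs
  · rw [Finset.card_insert_of_notMem]
    simp [mem_large]
  · rfl

lemma detect_succ (δ : ℝ) (s n : ℕ) (c : ℕ → ℂ) :
    detect δ s (n + 1) c = (do
      let buf ← detect δ s n c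
      let a ← arith ‖c n‖
      let b ← arith (decide (δ ≤ a))
      if b then do
        let l ← insertDesc c n buf
        pure (l.take s)
      else pure buf) := by
  rw [detect, List.range_succ, List.foldlM_append]
  simp only [List.foldlM_cons, List.foldlM_nil, bind_pure]
  rfl

lemma detect_length (δ : ℝ) (s n : ℕ) (c : ℕ → ℂ) :
    (detect δ s n c).val.length ≤ min s (large δ n c).card := by
  induction n with
  | zero => simp [detect]
  | succ n ih =>
    rw [detect_succ, card_large_succ]
    simp only [bind_val, arith_val]
    by_cases h : δ ≤ ‖c n‖
    · simp only [h, decide_true, if_true, bind_val, pure_val, List.length_take,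
        (insertDesc_perm c n _).length_eq, List.length_cons]
      omega
    · simpa [h] using ih

lemma detect_cost (δ : ℝ) (s n : ℕ) (c : ℕ → ℂ) :
    (detect δ s n c).samples = 0 ∧ (detect δ s n c).ops ≤
      2 * n + (large δ n c).card * min s (large δ n c).card := by
  induction n with
  | zero => simp [detect]
  | succ n ih =>
    rw [detect_succ, card_large_succ]
    have hl := detect_length δ s n c
    have hc := insertDesc_cost c n (detect δ s n c).val
    simp only [bind_samples, bind_ops, arith_val, arith_samples, arith_ops]
    by_cases h : δ ≤ ‖c n‖
    · simp only [h, decide_true, if_true, bind_samples, bind_ops, pure_samples, pure_ops]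
      refine ⟨by omega, ?_⟩
      have : (large δ n c).card * min s (large δ n c).card ≤
        (large δ n c).card * min s ((large δ n c).card + 1) := by gcongr; omega
      have : min s (large δ n c).card ≤ min s ((large δ n c).card + 1) := by omega
      rw [add_mul]
      omega
    · simp only [h, decide_false, if_false, Bool.false_eq_true, pure_samples, pure_ops]
      exact ⟨by omega, by omega⟩

lemma detect_subset {δ : ℝ} {s n : ℕ} {c : ℕ → ℂ} {j : ℕ} (hj : j ∈ (detect δ s n c).val) :
    j ∈ large δ n c := by
  induction n with
  | zero => simp [detect] at hj
  | succ n ih =>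
    rw [detect_succ] at hj
    simp only [bind_val, arith_val] at hj
    rw [large_succ]
    by_cases h : δ ≤ ‖c n‖
    · simp only [h, decide_true, if_true, bind_val, pure_val] at hj ⊢
      have := (insertDesc_perm c n _).mem_iff.1 (List.mem_of_mem_take hj)
      rw [List.mem_cons] at this
      rw [Finset.mem_insert]
      exact this.imp_right ih
    · simp only [h, decide_false, if_false, Bool.false_eq_true, pure_val] at hj ⊢
      exact ih hj

/-- If there are at most `s` large coefficients then all of them are detected. -/
lemma mem_detect {δ : ℝ} {s n : ℕ} {c : ℕ → ℂ} (hs : (large δ n c).card ≤ s) {j : ℕ} :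
    j ∈ (detect δ s n c).val ↔ j ∈ large δ n c := by
  refine ⟨detect_subset, fun hj => ?_⟩
  induction n with
  | zero => simp [large] at hj
  | succ n ih =>
    have hl := detect_length δ s n c
    rw [card_large_succ] at hs
    rw [large_succ] at hj
    rw [detect_succ]
    simp only [bind_val, arith_val]
    by_cases h : δ ≤ ‖c n‖
    · simp only [h, decide_true, if_true, bind_val, pure_val] at hj hs ⊢
      have hp := insertDesc_perm c n (detect δ s n c).val
      rw [List.take_of_length_le (by rw [hp.length_eq, List.length_cons]; omega), hp.mem_iff,
        List.mem_cons]
      exact (Finset.mem_insert.1 hj).imp_right (ih (by omega))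
    · simp only [h, decide_false, if_false, Bool.false_eq_true, pure_val] at hj hs ⊢
      exact ih hs hj

/-! ### The detection loop -/

section Loop
variable {κ X : Type}

lemma collect_cost (flag : ℕ → Bool) (c : ℕ → ℂ) (j : ℕ) (l : List κ) :
    (collect flag c j l).samples = 0 ∧ (collect flag c j l).ops = l.length := by
  induction l generalizing j with
  | nil => exact ⟨rfl, rfl⟩
  | cons k l ih =>
    simp only [collect, bind_samples, bind_ops, arith_samples, arith_ops, pure_samples, pure_ops,
      ih, List.length_cons, true_and]
    omega

lemma collect_sublist (flag : ℕ → Bool) (c : ℕ → ℂ) (j : ℕ) (l : List κ) :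
    ((collect flag c j l).val.map Prod.fst).Sublist l := by
  induction l generalizing j with
  | nil => exact List.Sublist.slnil
  | cons k l ih =>
    simp only [collect, bind_val, arith_val, pure_val]
    by_cases h : flag j = true
    · simp only [h, if_true, List.map_cons]
      exact (ih _).cons_cons k
    · simp only [h, if_false, Bool.false_eq_true]
      exact (ih _).cons k

lemma mem_collect {flag : ℕ → Bool} {c : ℕ → ℂ} {j : ℕ} {l : List κ} {k : κ} :
    k ∈ (collect flag c j l).val.map Prod.fst ↔ ∃ i, l[i]? = some k ∧ flag (j + i) = true := by
  induction l generalizing j with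
  | nil => simp [collect]
  | cons a l ih =>
    have h1 : k ∈ (collect flag c j (a :: l)).val.map Prod.fst ↔
        (flag j = true ∧ k = a) ∨ k ∈ (collect flag c (j + 1) l).val.map Prod.fst := by
      simp only [collect, bind_val, arith_val, pure_val]
      cases flag j <;> simp
    rw [h1, ih]
    constructor
    · rintro (⟨h, rfl⟩ | ⟨i, h, h'⟩)
      · exact ⟨0, rfl, h⟩
      · exact ⟨i + 1, h, by rwa [← add_assoc, add_right_comm]⟩
    · rintro ⟨i, h, h'⟩
      cases i with
      | zero => exact Or.inl ⟨h', by simpa using h.symm⟩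
      | succ i => exact Or.inr ⟨i, by simpa using h, by rwa [add_assoc, add_comm 1]⟩

lemma collect_length_le {flag : ℕ → Bool} {F : Finset ℕ} (hF : ∀ i, flag i = true → i ∈ F)
    (c : ℕ → ℂ) (j : ℕ) (l : List κ) :
    (collect flag c j l).val.length ≤ (F.filter (j ≤ ·)).card := by
  induction l generalizing j with
  | nil => simp [collect]
  | cons k l ih =>
    have hsub : F.filter (j + 1 ≤ ·) ⊆ F.filter (j ≤ ·) := by
      intro i; simp only [Finset.mem_filter]; exact fun h => ⟨h.1, by omega⟩
    simp only [collect, bind_val, arith_val, pure_val]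
    by_cases h : flag j = true
    · simp only [h, if_true, List.length_cons]
      refine lt_of_le_of_lt (ih (j + 1)) (Finset.card_lt_card ?_)
      refine (Finset.ssubset_iff_of_subset hsub).2 ⟨j, ?_, ?_⟩ <;> simp [hF j h]
    · simp only [h, if_false, Bool.false_eq_true]
      exact (ih (j + 1)).trans (Finset.card_le_card hsub)

/-- The coefficients of the candidates computed from the samples of `p` at the nodes
`x 0, …, x (M - 1)`. -/
def nodeCoeff [Zero κ] (p : X → ℂ) (M : ℕ) (cand : List κ) (key : κ → Counted ℕ) (x : ℕ → X) :
    ℕ → ℂ := fun j =>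
  (dft M (tabulate M fun j => evalAt p (x j)).val).val
    ((tabulate cand.length fun j => key (cand.getD j 0)).val j)

/-- One detection iteration of `detectionLoop`. -/
def detectionPass [Zero κ] (p : X → ℂ) (δ : ℝ) (s M : ℕ) (cand : List κ) (key : κ → Counted ℕ)
    (st : (ℕ → Bool) × (ℕ → ℂ)) (x : ℕ → X) : Counted ((ℕ → Bool) × (ℕ → ℂ)) := do
  let y ← tabulate M fun j => evalAt p (x j)
  let f ← dft M y
  let c := fun j => f ((tabulate cand.length fun j => key (cand.getD j 0)).val j)
  let l ← detect δ s cand.length c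
  let flag ← l.foldlM (fun (g : ℕ → Bool) j => arith (Function.update g j true)) st.1
  pure (flag, c)

lemma detectionLoop_eq [Zero κ] (p : X → ℂ) (δ : ℝ) (s M : ℕ) (nodes : List (ℕ → X))
    (cand : List κ) (key : κ → Counted ℕ) :
    detectionLoop p δ s M nodes cand key = (do
      let _ ← tabulate cand.length fun j => key (cand.getD j 0)
      let res ← nodes.foldlM (detectionPass p δ s M cand key) (fun _ => false, fun _ => 0)
      collect res.1 res.2 0 cand) := rfl

lemma setFlags_val (l : List ℕ) (g : ℕ → Bool) (j : ℕ) :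
    (l.foldlM (fun (g : ℕ → Bool) j => arith (Function.update g j true)) g).val j = true ↔
      g j = true ∨ j ∈ l := by
  induction l generalizing g with
  | nil => simp
  | cons i l ih =>
    rw [List.foldlM_cons, bind_val, ih, arith_val, List.mem_cons, Function.update_apply]
    by_cases h : j = i <;> simp [h]

lemma setFlags_cost (l : List ℕ) (g : ℕ → Bool) :
    (l.foldlM (fun (g : ℕ → Bool) j => arith (Function.update g j true)) g).samples = 0 ∧
    (l.foldlM (fun (g : ℕ → Bool) j => arith (Function.update g j true)) g).ops ≤ l.length := by
  simpa using foldlM_cost (f := fun (g : ℕ → Bool) j => arith (Function.update g j true)) (l := l) 1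
    (fun s x _ => ⟨rfl, le_rfl⟩) g

variable [Zero κ] (p : X → ℂ) (δ : ℝ) (s M : ℕ) (nodes : List (ℕ → X)) (cand : List κ)
  (key : κ → Counted ℕ)

lemma passes_val (st : (ℕ → Bool) × (ℕ → ℂ)) (j : ℕ) :
    (nodes.foldlM (detectionPass p δ s M cand key) st).val.1 j = true ↔
      st.1 j = true ∨
        ∃ x ∈ nodes, j ∈ (detect δ s cand.length (nodeCoeff p M cand key x)).val := by
  induction nodes generalizing st with
  | nil => simp
  | cons x nodes ih =>
    rw [List.foldlM_cons, bind_val, ih]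
    have : (detectionPass p δ s M cand key st x).val.1 j = true ↔ st.1 j = true ∨
        j ∈ (detect δ s cand.length (nodeCoeff p M cand key x)).val := by
      rw [← setFlags_val]; rfl
    rw [this, or_assoc]
    simp

lemma pass_cost (hM : 0 < M) (st : (ℕ → Bool) × (ℕ → ℂ)) (x : ℕ → X) {W : ℕ}
    (hW : (large δ cand.length (nodeCoeff p M cand key x)).card ≤ W) :
    (detectionPass p δ s M cand key st x).samples = M ∧
    (detectionPass p δ s M cand key st x).ops ≤
      dftCost M + 2 * cand.length + (W + 1) * min s W := by
  have h1 := detect_cost δ s cand.length (nodeCoeff p M cand key x)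
  have h2 := detect_length δ s cand.length (nodeCoeff p M cand key x)
  have h3 := setFlags_cost (detect δ s cand.length (nodeCoeff p M cand key x)).val st.1
  have h4 := dft_ops hM (tabulate M fun j => evalAt p (x j)).val
  have h5 := dft_samples M (tabulate M fun j => evalAt p (x j)).val
  have e1 : (detectionPass p δ s M cand key st x).samples =
      (tabulate M fun j => evalAt p (x j)).samples +
      ((dft M (tabulate M fun j => evalAt p (x j)).val).samples +
      ((detect δ s cand.length (nodeCoeff p M cand key x)).samples +
      (((detect δ s cand.length (nodeCoeff p M cand key x)).val.foldlM
        (fun (g : ℕ → Bool) j => arith (Function.update g j true)) st.1).samples + 0))) := rfl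
  have e2 : (detectionPass p δ s M cand key st x).ops =
      (tabulate M fun j => evalAt p (x j)).ops +
      ((dft M (tabulate M fun j => evalAt p (x j)).val).ops +
      ((detect δ s cand.length (nodeCoeff p M cand key x)).ops +
      (((detect δ s cand.length (nodeCoeff p M cand key x)).val.foldlM
        (fun (g : ℕ → Bool) j => arith (Function.update g j true)) st.1).ops + 0))) := rfl
  have h6 : (tabulate M fun j => evalAt p (x j)).samples = M := by simp
  have h7 : (tabulate M fun j => evalAt p (x j)).ops = 0 := by simp
  have h8 : (large δ cand.length (nodeCoeff p M cand key x)).card *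
      min s (large δ cand.length (nodeCoeff p M cand key x)).card ≤ W * min s W := by gcongr
  rw [e1, e2, h5, h1.1, h3.1, h6, h7]
  refine ⟨rfl, ?_⟩
  rw [add_mul, one_mul]
  have : min s (large δ cand.length (nodeCoeff p M cand key x)).card ≤ min s W := by omega
  omega

lemma passes_cost (hM : 0 < M) {W : ℕ}
    (hW : ∀ x ∈ nodes, (large δ cand.length (nodeCoeff p M cand key x)).card ≤ W)
    (st : (ℕ → Bool) × (ℕ → ℂ)) :
    (nodes.foldlM (detectionPass p δ s M cand key) st).samples = nodes.length * M ∧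
    (nodes.foldlM (detectionPass p δ s M cand key) st).ops ≤
      nodes.length * (dftCost M + 2 * cand.length + (W + 1) * min s W) := by
  induction nodes generalizing st with
  | nil => simp
  | cons x nodes ih =>
    have h1 := pass_cost p δ s M cand key hM st x (hW x (by simp))
    have h2 := ih (fun y hy => hW y (by simp [hy])) (detectionPass p δ s M cand key st x).val
    rw [List.foldlM_cons, bind_samples, bind_ops, List.length_cons, add_mul, add_mul]
    omega

lemma detectionLoop_cost (hM : 0 < M) {W b : ℕ}
    (hW : ∀ x ∈ nodes, (large δ cand.length (nodeCoeff p M cand key x)).card ≤ W)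
    (hb : ∀ k, (key k).samples = 0 ∧ (key k).ops ≤ b) :
    (detectionLoop p δ s M nodes cand key).samples = nodes.length * M ∧
    (detectionLoop p δ s M nodes cand key).ops ≤
      cand.length * (b + 1) +
        nodes.length * (dftCost M + 2 * cand.length + (W + 1) * min s W) := by
  have h1 := passes_cost p δ s M nodes cand key hM hW (fun _ => false, fun _ => 0)
  have h2 := collect_cost
    (nodes.foldlM (detectionPass p δ s M cand key) (fun _ => false, fun _ => 0)).val.1
    (nodes.foldlM (detectionPass p δ s M cand key) (fun _ => false, fun _ => 0)).val.2 0 cand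
  have h3 : ∑ j ∈ Finset.range cand.length, (key (cand.getD j 0)).ops ≤ cand.length * b := by
    simpa using Finset.sum_le_card_nsmul (Finset.range cand.length) _ b
      fun j _ => (hb (cand.getD j 0)).2
  rw [detectionLoop_eq]
  simp only [bind_samples, bind_ops, tabulate_samples, tabulate_ops, h1.1, h2, (hb _).1,
    Finset.sum_const_zero]
  refine ⟨by omega, ?_⟩
  rw [mul_add, mul_one]
  omega

lemma detectionLoop_sublist :
    ((detectionLoop p δ s M nodes cand key).val.map Prod.fst).Sublist cand :=
  collect_sublist _ _ _ _

lemma detectionLoop_length :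
    (detectionLoop p δ s M nodes cand key).val.length ≤ nodes.length * s := by
  have hF : ∀ i, (nodes.foldlM (detectionPass p δ s M cand key)
      (fun _ => false, fun _ => 0)).val.1 i = true → i ∈ (nodes.flatMap fun x =>
        (detect δ s cand.length (nodeCoeff p M cand key x)).val).toFinset := by
    intro i hi
    rw [passes_val] at hi
    simpa using hi
  refine (collect_length_le hF _ 0 cand).trans ((Finset.card_filter_le _ _).trans
    ((List.toFinset_card_le _).trans ?_))
  rw [List.length_flatMap]
  simpa using List.sum_le_card_nsmul (nodes.map fun x =>
    (detect δ s cand.length (nodeCoeff p M cand key x)).val.length) s (by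
      intro y hy
      obtain ⟨x, _, rfl⟩ := List.mem_map.1 hy
      exact (detect_length _ _ _ _).trans (min_le_left _ _))

lemma mem_detectionLoop {k : κ}
    (hs : ∀ x ∈ nodes, (large δ cand.length (nodeCoeff p M cand key x)).card ≤ s) :
    k ∈ (detectionLoop p δ s M nodes cand key).val.map Prod.fst ↔
      ∃ j, cand[j]? = some k ∧ ∃ x ∈ nodes, δ ≤ ‖nodeCoeff p M cand key x j‖ := by
  have : (detectionLoop p δ s M nodes cand key).val = (collect
    (nodes.foldlM (detectionPass p δ s M cand key) (fun _ => false, fun _ => 0)).val.1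
    (nodes.foldlM (detectionPass p δ s M cand key) (fun _ => false, fun _ => 0)).val.2 0
    cand).val := rfl
  rw [this, mem_collect]
  simp only [zero_add, passes_val, Bool.false_eq_true, false_or]
  refine exists_congr fun j => and_congr_right fun hj => ?_
  refine exists_congr fun x => and_congr_right fun hx => ?_
  rw [mem_detect (hs x hx), mem_large, and_iff_right]
  exact (List.getElem?_eq_some_iff.1 hj).1

end Loop

/-! ### Prime lattice sizes -/

lemma primeTest_cost (q : ℕ) : (primeTest q).samples = 0 ∧ (primeTest q).ops ≤ Nat.sqrt q := by
  have := foldlM_cost (f := fun b f => do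
    let m ← arith (q % f)
    pure (b && decide (m ≠ 0))) (l := List.range' 2 (Nat.sqrt q - 1)) 1
    (fun s x _ => ⟨rfl, le_rfl⟩) true
  rw [List.length_range', mul_one] at this
  exact ⟨this.1, this.2.trans (Nat.sub_le _ _)⟩

lemma primeTest_val {q : ℕ} (hq : 2 ≤ q) : (primeTest q).val = true ↔ q.Prime := by
  have key : ∀ (l : List ℕ) (b : Bool), (l.foldlM (fun (b : Bool) f => (do
      let m ← arith (q % f)
      pure (b && decide (m ≠ 0)) : Counted Bool)) b).val = true ↔
      b = true ∧ ∀ f ∈ l, ¬ f ∣ q := by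
    intro l
    induction l with
    | nil => simp
    | cons f l ih =>
      intro b
      have h1 : (b && decide (q % f ≠ 0)) = true ↔ b = true ∧ ¬ f ∣ q := by
        rw [Bool.and_eq_true_iff, decide_eq_true_iff, Nat.dvd_iff_mod_eq_zero]
      rw [List.foldlM_cons, bind_val, ih, List.forall_mem_cons, ← and_assoc]
      exact and_congr_left' h1
  have hs : 1 ≤ Nat.sqrt q := Nat.le_sqrt'.2 (by omega)
  rw [primeTest, key, Nat.prime_def_le_sqrt]
  simp only [true_and, List.mem_range'_1, hq]
  constructor
  · exact fun h m h2 hm => h m ⟨h2, by omega⟩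
  · exact fun h m hm => h m hm.1 (by omega)

lemma firstPrime_bounds (q fuel : ℕ) :
    q ≤ (firstPrime q fuel).val ∧ (firstPrime q fuel).val ≤ q + fuel := by
  induction fuel generalizing q with
  | zero => exact ⟨le_rfl, le_rfl⟩
  | succ fuel ih =>
    simp only [firstPrime, bind_val]
    split_ifs
    · exact ⟨le_rfl, by simp⟩
    · have := ih (q + 1); omega

lemma firstPrime_cost (q fuel : ℕ) : (firstPrime q fuel).samples = 0 ∧
    (firstPrime q fuel).ops ≤ fuel * Nat.sqrt (q + fuel) := by
  induction fuel generalizing q with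
  | zero => exact ⟨rfl, by simp [firstPrime]⟩
  | succ fuel ih =>
    have h1 := primeTest_cost q
    have h2 := ih (q + 1)
    rw [show q + 1 + fuel = q + (fuel + 1) by ring] at h2
    have h3 : Nat.sqrt q ≤ Nat.sqrt (q + (fuel + 1)) := Nat.sqrt_le_sqrt (by omega)
    simp only [firstPrime, bind_samples, bind_ops, h1.1]
    rw [add_mul]
    split_ifs
    · simp only [pure_samples, pure_ops]
      exact ⟨trivial, by omega⟩
    · exact ⟨by omega, by omega⟩

lemma firstPrime_prime {q fuel p : ℕ} (hq : 2 ≤ q) (hp : p.Prime) (h1 : q ≤ p) (h2 : p < q + fuel) :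
    (firstPrime q fuel).val.Prime := by
  induction fuel generalizing q with
  | zero => omega
  | succ fuel ih =>
    simp only [firstPrime, bind_val]
    split_ifs with h
    · exact (primeTest_val hq).1 h
    · have : q ≠ p := by
        rintro rfl; exact h ((primeTest_val hq).2 hp)
      exact ih (by omega) (by omega) (by omega)

/-- By Bertrand's postulate the search for a prime is successful. -/
lemma firstPrime_self_prime {q : ℕ} (hq : 2 ≤ q) : (firstPrime q q).val.Prime := by
  obtain ⟨p, hp, h1, h2⟩ := Nat.exists_prime_lt_and_le_two_mul q (by omega)
  refine firstPrime_prime hq hp h1.le (lt_of_le_of_ne (by omega) ?_)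
  rintro rfl
  exact Nat.not_prime_mul (by norm_num : 2 ≠ 1) (by omega : q ≠ 1) (by rwa [two_mul])

/-! ### Component-by-component construction -/

lemma powMod_cost (M : ℕ) (b : ℤ) (l : List Bool) :
    (powMod M b l).samples = 0 ∧ (powMod M b l).ops ≤ 4 * l.length := by
  induction l with
  | nil => exact ⟨rfl, le_rfl⟩
  | cons x l ih =>
    cases x
    · simp only [powMod, bind_samples, bind_ops, arith_samples, arith_ops, Bool.false_eq_true,
        if_false, pure_samples, pure_ops, List.length_cons]
      omega
    · simp only [powMod, bind_samples, bind_ops, arith_samples, arith_ops,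
        if_true, List.length_cons]
      omega

lemma intCast_emod (M : ℕ) (a : ℤ) : ((a % (M : ℤ) : ℤ) : ZMod M) = a :=
  (ZMod.intCast_eq_intCast_iff _ _ _).2 (Int.mod_modEq a M)

lemma powMod_val (M : ℕ) (b : ℤ) (n : ℕ) :
    ((powMod M b (Nat.bits n)).val : ZMod M) = (b : ZMod M) ^ n := by
  induction n using Nat.binaryRec' with
  | zero => simp [powMod]
  | bit x n h ih =>
    rw [Nat.bits_append_bit _ _ h]
    cases x
    · simp only [powMod, bind_val, arith_val, Bool.false_eq_true, if_false, pure_val,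
        intCast_emod, Int.cast_mul, ih, Nat.bit_false]
      ring
    · simp only [powMod, bind_val, arith_val, if_true,
        intCast_emod, Int.cast_mul, ih, Nat.bit_true]
      ring

lemma firstFree_cost (flag : ℤ → Bool) (z : ℤ) (fuel : ℕ) :
    (firstFree flag z fuel).samples = 0 ∧ (firstFree flag z fuel).ops ≤ fuel := by
  induction fuel generalizing z with
  | zero => exact ⟨rfl, le_rfl⟩
  | succ fuel ih =>
    have := ih (z + 1)
    simp only [firstFree, bind_samples, bind_ops, arith_samples, arith_ops, arith_val]
    by_cases h : flag z = true
    · simp only [h, if_true]; omega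
    · simp only [h, if_false, Bool.false_eq_true, pure_samples, pure_ops, true_and]; omega

lemma firstFree_val {flag : ℤ → Bool} {z w : ℤ} {fuel : ℕ} (h1 : z ≤ w) (h2 : w < z + fuel)
    (hw : flag w = false) : flag (firstFree flag z fuel).val = false ∧
      z ≤ (firstFree flag z fuel).val ∧ (firstFree flag z fuel).val < z + fuel := by
  induction fuel generalizing z with
  | zero => push_cast at h2; omega
  | succ fuel ih =>
    simp only [firstFree, bind_val, arith_val]
    by_cases h : flag z = true
    · simp only [h, if_true]
      have : z ≠ w := by rintro rfl; simp [h] at hw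
      have := ih (z := z + 1) (by omega) (by push_cast at h2; omega)
      push_cast
      exact ⟨this.1, by omega, by omega⟩
    · simp only [h, if_false, Bool.false_eq_true, pure_val]
      push_cast
      exact ⟨trivial, by omega, by omega⟩

/-- The residue excluded by a pair with first coordinates `u`, `u'` and with `b = a - a'`. -/
def excluded (M : ℕ) (u u' b : ℤ) : ℤ :=
  (u' - u) * (powMod M (b % M) (Nat.bits (M - 2))).val % M

lemma eq_excluded {M : ℕ} (hM : M.Prime) {u u' a a' z : ℤ} (hz : 0 ≤ z) (hz' : z < M)
    (ha : (a - a') % (M : ℤ) ≠ 0)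
    (h : ((u + a * z : ℤ) : ZMod M) = ((u' + a' * z : ℤ) : ZMod M)) :
    z = excluded M u u' (a - a') := by
  have : Fact M.Prime := ⟨hM⟩
  have hb : ((a - a' : ℤ) : ZMod M) ≠ 0 := by
    rw [Ne, ZMod.intCast_zmod_eq_zero_iff_dvd]
    rwa [Int.dvd_iff_emod_eq_zero]
  -- Fermat: `b ^ (M - 2)` is the inverse of `b`, also for `M = 2`
  have hinv : ((a - a' : ℤ) : ZMod M) * ((a - a' : ℤ) : ZMod M) ^ (M - 2) = 1 := by
    rw [← pow_succ', show M - 2 + 1 = M - 1 by have := hM.two_le; omega]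
    exact ZMod.pow_card_sub_one_eq_one hb
  have h1 : ((excluded M u u' (a - a') : ℤ) : ZMod M) = (z : ZMod M) := by
    rw [excluded, intCast_emod, Int.cast_mul, powMod_val, intCast_emod]
    push_cast at h hinv ⊢
    linear_combination (-(a - a' : ZMod M) ^ (M - 2)) * h + (z : ZMod M) * hinv
  rw [ZMod.intCast_eq_intCast_iff, Int.ModEq, Int.emod_eq_of_lt hz hz'] at h1
  rw [← h1, excluded, Int.emod_emod]

/-- One pass of the loop in `nextComponent`. -/
def flagPass (M : ℕ) (u a : ℕ → ℤ) (g : ℤ → Bool) (ij : ℕ × ℕ) : Counted (ℤ → Bool) := do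
  let b ← arith (a ij.1 - a ij.2)
  let b ← arith (b % M)
  if b = 0 then pure g
  else do
    let v ← powMod M b (Nat.bits (M - 2))
    let w ← arith (u ij.2 - u ij.1)
    let w ← arith (w * v)
    let w ← arith (w % M)
    arith (Function.update g w true)

lemma nextComponent_eq (M n : ℕ) (u a : ℕ → ℤ) : nextComponent M n u a = (do
    let flag ← (List.range n ×ˢ List.range n).foldlM (flagPass M u a) (fun _ => false)
    firstFree flag 0 M) := rfl

lemma flagPass_val (M : ℕ) (u a : ℕ → ℤ) (g : ℤ → Bool) (ij : ℕ × ℕ) :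
    (flagPass M u a g ij).val = if (a ij.1 - a ij.2) % (M : ℤ) = 0 then g
      else Function.update g (excluded M (u ij.1) (u ij.2) (a ij.1 - a ij.2)) true := by
  simp only [flagPass, bind_val, arith_val]
  by_cases h : (a ij.1 - a ij.2) % (M : ℤ) = 0
  · simp only [h, if_true, pure_val]
  · simp only [h, if_false, bind_val, arith_val, excluded]

lemma flagPasses_val (M : ℕ) (u a : ℕ → ℤ) (g : ℤ → Bool) (l : List (ℕ × ℕ)) (w : ℤ) :
    (l.foldlM (flagPass M u a) g).val w = true ↔ g w = true ∨ ∃ ij ∈ l,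
      (a ij.1 - a ij.2) % (M : ℤ) ≠ 0 ∧
        w = excluded M (u ij.1) (u ij.2) (a ij.1 - a ij.2) := by
  induction l generalizing g with
  | nil => simp
  | cons ij l ih =>
    have h1 : (flagPass M u a g ij).val w = true ↔ g w = true ∨
        ((a ij.1 - a ij.2) % (M : ℤ) ≠ 0 ∧
          w = excluded M (u ij.1) (u ij.2) (a ij.1 - a ij.2)) := by
      rw [flagPass_val]
      by_cases h : (a ij.1 - a ij.2) % (M : ℤ) = 0
      · simp [h]
      · rw [if_neg h, Function.update_apply]
        by_cases hw : w = excluded M (u ij.1) (u ij.2) (a ij.1 - a ij.2)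
        · rw [if_pos hw]; simp [h, hw]
        · rw [if_neg hw]; simp [hw]
    rw [List.foldlM_cons, bind_val, ih, h1, or_assoc]
    simp

lemma nextComponent_cost (M n : ℕ) (u a : ℕ → ℤ) : (nextComponent M n u a).samples = 0 ∧
    (nextComponent M n u a).ops ≤ n ^ 2 * (6 + 4 * Nat.size (M - 2)) + M := by
  have h1 := foldlM_cost (f := flagPass M u a) (6 + 4 * Nat.size (M - 2))
    (l := List.range n ×ˢ List.range n) (by
      intro g ij _
      have := powMod_cost M ((a ij.1 - a ij.2) % M) (Nat.bits (M - 2))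
      rw [← Nat.size_eq_bits_len]
      simp only [flagPass, bind_samples, bind_ops, arith_val, arith_samples, arith_ops]
      by_cases h : (a ij.1 - a ij.2) % (M : ℤ) = 0
      · simp only [h, if_true, pure_samples, pure_ops, true_and]; omega
      · simp only [h, if_false, bind_samples, bind_ops, arith_samples, arith_ops]; omega)
    (fun _ => false)
  rw [List.length_product, List.length_range, ← sq] at h1
  have h2 := firstFree_cost
    ((List.range n ×ˢ List.range n).foldlM (flagPass M u a) (fun _ => false)).val 0 M
  rw [nextComponent_eq, bind_samples, bind_ops]
  omega

/-- The pairs exclude at most `n ^ 2 - n` residues, so that a free one is left. -/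
lemma nextComponent_val {M n : ℕ} (hM : M.Prime) (hn : n ^ 2 ≤ M) (u a : ℕ → ℤ) {i j : ℕ}
    (hi : i < n) (hj : j < n)
    (h : ((u i + a i * (nextComponent M n u a).val : ℤ) : ZMod M) =
      ((u j + a j * (nextComponent M n u a).val : ℤ) : ZMod M)) :
    (a i - a j) % (M : ℤ) = 0 := by
  set flag := ((List.range n ×ˢ List.range n).foldlM (flagPass M u a) (fun _ => false)).val
    with hflag
  have hz : (nextComponent M n u a).val = (firstFree flag 0 M).val := rfl
  have hf : ∀ w, flag w = true ↔ ∃ i < n, ∃ j < n, (a i - a j) % (M : ℤ) ≠ 0 ∧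
      w = excluded M (u i) (u j) (a i - a j) := by
    intro w
    rw [hflag, flagPasses_val]
    constructor
    · rintro (h | ⟨⟨i, j⟩, hij, h⟩)
      · simp at h
      · rw [List.mem_product, List.mem_range, List.mem_range] at hij
        exact ⟨i, hij.1, j, hij.2, h⟩
    · rintro ⟨i, hi, j, hj, h⟩
      exact Or.inr ⟨(i, j), List.mem_product.2 ⟨List.mem_range.2 hi, List.mem_range.2 hj⟩, h⟩
  obtain ⟨w, hw, hw'⟩ : ∃ w ∈ Finset.Ico (0 : ℤ) M,
      w ∉ (Finset.range n).offDiag.image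
        fun ij => excluded M (u ij.1) (u ij.2) (a ij.1 - a ij.2) := by
    apply Finset.exists_mem_notMem_of_card_lt_card
    refine Finset.card_image_le.trans_lt ?_
    rw [Finset.offDiag_card, Finset.card_range, Int.card_Ico]
    have : 0 < n := by omega
    have : 0 < n * n := by positivity
    rw [sq] at hn
    simp only [sub_zero, Int.toNat_natCast]
    omega
  rw [Finset.mem_Ico] at hw
  have hwf : flag w = false := by
    rw [← Bool.not_eq_true, hf]
    rintro ⟨i, hi, j, hj, hij, rfl⟩
    apply hw'
    refine Finset.mem_image.2 ⟨(i, j), ?_, rfl⟩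
    rw [Finset.mem_offDiag, Finset.mem_range, Finset.mem_range]
    refine ⟨hi, hj, ?_⟩
    rintro (rfl : i = j)
    simp at hij
  obtain ⟨z1, z2, z3⟩ := firstFree_val (z := 0) hw.1 (by simpa using hw.2) hwf
  rw [zero_add] at z3
  rw [hz] at h
  by_contra hne
  have := eq_excluded hM z2 z3 hne h
  rw [(hf _).2 ⟨i, hi, j, hj, hne, this⟩] at z1
  exact absurd z1 (by simp)

section Vector
variable {d : ℕ}

/-- One pass of the loop in `generatingVector`. -/
def componentPass (M : ℕ) (I : List (Fin d → ℤ)) (zu : (Fin d → ℤ) × (ℕ → ℤ)) (i : Fin d) :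
    Counted ((Fin d → ℤ) × (ℕ → ℤ)) := do
  let zi ← nextComponent M I.length zu.2 (fun j => (I.getD j 0) i)
  let u ← tabulate I.length fun j => do
    let v ← arith ((I.getD j 0) i * zi)
    let v ← arith (zu.2 j + v)
    arith (v % M)
  pure (Function.update zu.1 i zi, u)

lemma generatingVector_eq (M t : ℕ) (I : List (Fin d → ℤ)) : generatingVector M t I = (do
    let res ← ((List.finRange d).filter (fun i => decide (i.val < t))).foldlM
      (componentPass M I) (0, fun _ => 0)
    pure res.1) := rfl

lemma componentPasses_val {M : ℕ} (hM : M.Prime) (I : List (Fin d → ℤ)) (hI : I.length ^ 2 ≤ M)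
    (l : List (Fin d)) (hl : l.Nodup) (z : Fin d → ℤ) (u : ℕ → ℤ) :
    let res := (l.foldlM (componentPass M I) (z, u)).val
    (∀ i, i ∉ l → res.1 i = z i) ∧
    (∀ j < I.length, (res.2 j : ZMod M) =
      u j + (l.map fun i => (I.getD j 0 i : ZMod M) * res.1 i).sum) ∧
    (∀ j < I.length, ∀ k < I.length, (res.2 j : ZMod M) = res.2 k →
      (u j : ZMod M) = u k ∧ ∀ i ∈ l, (I.getD j 0 i - I.getD k 0 i) % (M : ℤ) = 0) := by
  induction l generalizing z u with
  | nil => simp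
  | cons i l ih =>
    rw [List.nodup_cons] at hl
    set zi := (nextComponent M I.length u fun j => (I.getD j 0) i).val with hzi
    have hz1 : (componentPass M I (z, u) i).val.1 = Function.update z i zi := rfl
    have hu1 : ∀ j < I.length, ((componentPass M I (z, u) i).val.2 j : ZMod M) =
        ((u j + I.getD j 0 i * zi : ℤ) : ZMod M) := by
      intro j hj
      simp only [componentPass, bind_val, pure_val, tabulate_val, if_pos hj, arith_val, ← hzi,
        intCast_emod]
    obtain ⟨h1, h2, h3⟩ := ih hl.2 (componentPass M I (z, u) i).val.1
      (componentPass M I (z, u) i).val.2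
    have hres : ((i :: l).foldlM (componentPass M I) (z, u)).val =
      (l.foldlM (componentPass M I) ((componentPass M I (z, u) i).val.1,
        (componentPass M I (z, u) i).val.2)).val := rfl
    rw [hres]
    refine ⟨?_, ?_, ?_⟩
    · intro j hj
      rw [List.mem_cons, not_or] at hj
      rw [h1 j hj.2, hz1, Function.update_of_ne hj.1]
    · intro j hj
      rw [h2 j hj, hu1 j hj, List.map_cons, List.sum_cons, h1 i hl.1, hz1, Function.update_self]
      push_cast; ring
    · intro j hj k hk hjk
      obtain ⟨g1, g2⟩ := h3 j hj k hk hjk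
      rw [hu1 j hj, hu1 k hk] at g1
      have g3 := nextComponent_val hM hI u (fun j => (I.getD j 0) i) hj hk g1
      refine ⟨?_, ?_⟩
      · have g4 : (I.getD j 0 i : ZMod M) = I.getD k 0 i := by
          rw [ZMod.intCast_eq_intCast_iff_dvd_sub, dvd_sub_comm, Int.dvd_iff_emod_eq_zero]
          exact g3
        push_cast at g1
        rw [g4] at g1
        exact add_right_cancel g1
      · intro i' hi'
        rcases List.mem_cons.1 hi' with rfl | hi'
        · exact g3
        · exact g2 i' hi'

lemma sum_map_finRange_filter {R : Type*} [AddCommMonoid R] (q : Fin d → Prop) [DecidablePred q]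
    (f : Fin d → R) : (((List.finRange d).filter (fun i => decide (q i))).map f).sum =
      ∑ i with q i, f i := by
  rw [← List.sum_toFinset _ ((List.nodup_finRange d).filter _)]
  congr 1
  ext i; simp

/-- The residues of the frequencies of the list `I` with respect to the constructed generating
vector determine the first `t` components modulo `M`. -/
lemma generatingVector_val {M t : ℕ} (hM : M.Prime) {I : List (Fin d → ℤ)}
    (hI : I.length ^ 2 ≤ M) {k k' : Fin d → ℤ} (hk : k ∈ I) (hk' : k' ∈ I)
    (h : (M : ℤ) ∣ ∑ i with i.val < t, k i * (generatingVector M t I).val i -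
      ∑ i with i.val < t, k' i * (generatingVector M t I).val i) (i : Fin d) (hi : i.val < t) :
    (M : ℤ) ∣ k i - k' i := by
  obtain ⟨j, hj, rfl⟩ := List.mem_iff_getElem.1 hk
  obtain ⟨j', hj', rfl⟩ := List.mem_iff_getElem.1 hk'
  obtain ⟨-, h2, h3⟩ := componentPasses_val hM I hI
    ((List.finRange d).filter (fun i => decide (i.val < t))) ((List.nodup_finRange d).filter _)
    0 (fun _ => 0)
  have h4 := (h3 j hj j' hj' (by
    rw [h2 j hj, h2 j' hj', sum_map_finRange_filter, sum_map_finRange_filter]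
    have h5 := (ZMod.intCast_eq_intCast_iff_dvd_sub _ _ _).2 h
    push_cast at h5
    rw [List.getD_eq_getElem _ _ hj, List.getD_eq_getElem _ _ hj', Int.cast_zero, zero_add,
      zero_add]
    exact h5.symm)).2 i (by simpa using hi)
  rw [List.getD_eq_getElem _ _ hj, List.getD_eq_getElem _ _ hj'] at h4
  exact Int.dvd_of_emod_eq_zero h4

lemma generatingVector_cost (M t : ℕ) (I : List (Fin d → ℤ)) :
    (generatingVector M t I).samples = 0 ∧ (generatingVector M t I).ops ≤
      d * (I.length ^ 2 * (6 + 4 * Nat.size (M - 2)) + M + 3 * I.length) := by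
  have h1 := foldlM_cost (f := componentPass M I)
    (l := (List.finRange d).filter (fun i => decide (i.val < t)))
    (I.length ^ 2 * (6 + 4 * Nat.size (M - 2)) + M + 3 * I.length) (by
      intro zu i _
      have := nextComponent_cost M I.length zu.2 (fun j => (I.getD j 0) i)
      simp only [componentPass, bind_samples, bind_ops, tabulate_samples, tabulate_ops,
        arith_samples, arith_ops, pure_samples, pure_ops, Finset.sum_const, Finset.card_range,
        smul_eq_mul]
      omega) (0, fun _ => 0)
  have h2 : ((List.finRange d).filter (fun i => decide (i.val < t))).length ≤ d := by
    simpa using List.length_filter_le (fun i => decide (i.val < t)) (List.finRange d)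
  rw [generatingVector_eq]
  simp only [bind_samples, bind_ops, pure_samples, pure_ops, h1.1, add_zero, true_and]
  exact h1.2.trans (Nat.mul_le_mul_right _ h2)

end Vector

/-! ### Exactness of the computed coefficients -/

lemma dft_modes {X ι : Type} {M : ℕ} (p : X → ℂ) (x : ℕ → X) (S : Finset ι) (a : ι → ℤ)
    (w : ι → ℂ) (hp : ∀ j < M, p (x j) = ∑ h ∈ S, w h * unity (j * a h / M)) {k : ℕ} (hk : k < M) :
    (dft M (tabulate M fun j => evalAt p (x j)).val).val k =
      ∑ h ∈ S with (M : ℤ) ∣ a h - k, w h := by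
  have hM : 0 < M := by omega
  have hMC : (M : ℂ) ≠ 0 := by exact_mod_cast hM.ne'
  rw [dft_val _ hk]
  have h1 : ∀ j ∈ Finset.range M, (tabulate M fun j => evalAt p (x j)).val j *
      unity (-((j : ℝ) * k / M)) = ∑ h ∈ S, w h * unity (j * (a h - k : ℤ) / M) := by
    intro j hj
    rw [tabulate_val, if_pos (Finset.mem_range.1 hj), evalAt_val, hp j (Finset.mem_range.1 hj),
      Finset.sum_mul]
    refine Finset.sum_congr rfl fun h _ => ?_
    rw [mul_assoc, ← unity_add]
    congr 2
    push_cast; ring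
  rw [Finset.sum_congr rfl h1, Finset.sum_comm, Finset.mul_sum, Finset.sum_filter]
  refine Finset.sum_congr rfl fun h _ => ?_
  rw [← Finset.mul_sum, sum_unity hM]
  split_ifs
  · field_simp
  · ring

section Exact
variable {κ X ι : Type} [Zero κ]

lemma nodeCoeff_modes {M : ℕ} (hM : 0 < M) (p : X → ℂ) (cand : List κ) (key : κ → Counted ℕ)
    (res : κ → ℤ) (hkey : ∀ k, (key k).val = (res k % (M : ℤ)).toNat) (x : ℕ → X) (S : Finset ι)
    (a : ι → ℤ) (w : ι → ℂ) (hp : ∀ j < M, p (x j) = ∑ h ∈ S, w h * unity (j * a h / M))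
    {j : ℕ} {k : κ} (hj : cand[j]? = some k) :
    nodeCoeff p M cand key x j = ∑ h ∈ S with (M : ℤ) ∣ a h - res k, w h := by
  obtain ⟨hj1, rfl⟩ := List.getElem?_eq_some_iff.1 hj
  have hM' : (M : ℤ) ≠ 0 := by exact_mod_cast hM.ne'
  have h1 := Int.emod_nonneg (res cand[j]) hM'
  have h2 := Int.emod_lt_of_pos (res cand[j]) (by exact_mod_cast hM : (0 : ℤ) < M)
  rw [nodeCoeff, tabulate_val, if_pos hj1, List.getD_eq_getElem _ _ hj1, hkey,
    dft_modes p x S a w hp (by omega)]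
  refine Finset.sum_congr (Finset.filter_congr fun h _ => ?_) fun _ _ => rfl
  rw [Int.toNat_of_nonneg h1]
  have h3 := Int.dvd_sub_self_of_emod_eq (rfl : res cand[j] % (M : ℤ) = _)
  constructor
  · intro h4
    have := dvd_add h4 h3
    rw [show a h - res cand[j] % (M : ℤ) + (res cand[j] % (M : ℤ) - res cand[j]) =
      a h - res cand[j] by ring] at this
    exact this
  · intro h4
    have := dvd_sub h4 h3
    rw [show a h - res cand[j] - (res cand[j] % (M : ℤ) - res cand[j]) =
      a h - res cand[j] % (M : ℤ) by ring] at this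
    exact this

/-- If the computed coefficients are the sums over the fibers of the projection `P`, then only the
projections of the `h ∈ S` have nonzero coefficients. -/
lemma large_card_le_of_fiber {δ : ℝ} (hδ : 0 < δ) {cand : List κ} (hc : cand.Nodup) {c : ℕ → ℂ}
    {S : Finset ι} {P : ι → κ} [DecidableEq κ] {w : ι → ℂ}
    (h : ∀ j k, cand[j]? = some k → c j = ∑ h ∈ S with P h = k, w h) :
    (large δ cand.length c).card ≤ S.card := by
  refine le_trans ?_ (Finset.card_image_le (s := S) (f := P))
  refine Finset.card_le_card_of_injOn (fun j => cand.getD j 0) ?_ ?_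
  · intro j hj
    obtain ⟨h1, h2⟩ := mem_large.1 hj
    rw [Finset.mem_coe, Finset.mem_image]
    by_contra hne
    push Not at hne
    rw [h j _ (List.getElem?_eq_getElem h1), Finset.sum_eq_zero, norm_zero] at h2
    · linarith
    · intro g hg
      rw [Finset.mem_filter] at hg
      refine absurd hg.2 ?_
      have := hne g hg.1
      rwa [List.getD_eq_getElem _ _ h1] at this
  · intro i hi j hj hij
    have h1 := (mem_large.1 hi).1
    have h2 := (mem_large.1 hj).1
    simp only [List.getD_eq_getElem _ _ h1, List.getD_eq_getElem _ _ h2] at hij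
    exact (List.Nodup.getElem_inj_iff hc).1 hij

/-- If the computed coefficients are exact and each projection is seen in some iteration, then
exactly the projections of the `h ∈ S` are detected. -/
lemma detectionLoop_exact {p : X → ℂ} {δ : ℝ} (hδ : 0 < δ) {s M : ℕ} {nodes : List (ℕ → X)}
    {cand : List κ} (hc : cand.Nodup) {key : κ → Counted ℕ} {S : Finset ι} (hS : S.card ≤ s)
    {P : ι → κ} [DecidableEq κ] {w : (ℕ → X) → ι → ℂ}
    (h : ∀ x ∈ nodes, ∀ j k, cand[j]? = some k →
      nodeCoeff p M cand key x j = ∑ h ∈ S with P h = k, w x h)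
    (hcov : ∀ h ∈ S, P h ∈ cand)
    (hseen : ∀ h ∈ S, ∃ x ∈ nodes, δ ≤ ‖∑ h' ∈ S with P h' = P h, w x h'‖) :
    ((detectionLoop p δ s M nodes cand key).val.map Prod.fst).Nodup ∧
    ∀ k, k ∈ (detectionLoop p δ s M nodes cand key).val.map Prod.fst ↔ ∃ h ∈ S, P h = k := by
  refine ⟨(detectionLoop_sublist p δ s M nodes cand key).nodup hc, fun k => ?_⟩
  rw [mem_detectionLoop p δ s M nodes cand key
    fun x hx => (large_card_le_of_fiber hδ hc (h x hx)).trans hS]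
  constructor
  · rintro ⟨j, hj, x, hx, hl⟩
    by_contra hne
    push Not at hne
    rw [h x hx j k hj, Finset.filter_false_of_mem hne, Finset.sum_empty, norm_zero] at hl
    linarith
  · rintro ⟨g, hg, rfl⟩
    obtain ⟨j, hj⟩ := List.mem_iff_getElem?.1 (hcov g hg)
    obtain ⟨x, hx, hl⟩ := hseen g hg
    exact ⟨j, hj, x, hx, by rwa [h x hx j _ hj]⟩

end Exact

/-! ### Projections of trigonometric polynomials -/

section Projections
variable {d : ℕ}

open UnitAddTorus

/-- The Fourier coefficient with index `k` of `p` with respect to the variables seen by the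
projection `P`, as a function of the remaining variables: `R h` is the part of `h` not seen
by `P`. -/
def fiberSum {κ : Type} [DecidableEq κ] (phat : (Fin d → ℤ) →₀ ℂ) (P : (Fin d → ℤ) → κ)
    (R : (Fin d → ℤ) → Fin d → ℤ) (k : κ) (x : Fin d → UnitAddCircle) : ℂ :=
  ∑ h ∈ phat.support with P h = k, phat h * mFourier (R h) x

lemma fourier_eq_unity (n : ℤ) (a : ℝ) : fourier n (a : UnitAddCircle) = unity (n * a) := by
  rw [fourier_coe_apply, unity]
  congr 1
  push_cast; ring

lemma mFourier_update (h : Fin d → ℤ) (x : Fin d → UnitAddCircle) (t : Fin d) (a : ℝ) :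
    mFourier h (Function.update x t (a : UnitAddCircle)) =
      mFourier (Function.update h t 0) x * unity (h t * a) := by
  simp only [mFourier, ContinuousMap.coe_mk]
  rw [← Finset.mul_prod_erase _ _ (Finset.mem_univ t), ← Finset.mul_prod_erase
    (f := fun i => fourier (Function.update h t 0 i) (x i)) _ (Finset.mem_univ t)]
  rw [Function.update_self, Function.update_self, fourier_eq_unity, fourier_zero, one_mul, mul_comm]
  congr 1
  refine Finset.prod_congr rfl fun i hi => ?_
  rw [Function.update_of_ne (Finset.ne_of_mem_erase hi),
    Function.update_of_ne (Finset.ne_of_mem_erase hi)]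

lemma unity_sum {ι : Type} (s : Finset ι) (f : ι → ℝ) :
    unity (∑ i ∈ s, f i) = ∏ i ∈ s, unity (f i) := by
  classical
  induction s using Finset.induction_on with
  | empty => simp
  | insert a s ha ih => rw [Finset.sum_insert ha, Finset.prod_insert ha, unity_add, ih]

/-- The components of `h` after component `t`. -/
def tail (t : Fin d) (h : Fin d → ℤ) : Fin d → ℤ := fun i => if i ≤ t then 0 else h i

lemma mFourier_split (h : Fin d → ℤ) (x : Fin d → UnitAddCircle) (t : Fin d) (y : Fin d → ℝ) :
    mFourier h (fun l => if l ≤ t then (y l : UnitAddCircle) else x l) =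
      mFourier (tail t h) x * unity (∑ l with l ≤ t, h l * y l) := by
  rw [unity_sum, Finset.prod_filter]
  simp only [mFourier, ContinuousMap.coe_mk, ← Finset.prod_mul_distrib]
  refine Finset.prod_congr rfl fun l _ => ?_
  simp only [tail]
  split_ifs
  · rw [fourier_eq_unity, fourier_zero, one_mul]
  · rw [mul_one]

/-- The components of `h` with index less than `t`. -/
def head (t : ℕ) (h : Fin d → ℤ) : Fin d → ℤ := fun i => if i.val < t then h i else 0

lemma trunc_eq_head (t : Fin d) (h : Fin d → ℤ) : trunc t h = head (t.val + 1) h := by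
  funext i
  simp only [trunc, head, Fin.le_def, Nat.lt_succ_iff]

lemma update_head (t : Fin d) (h : Fin d → ℤ) :
    Function.update (head t.val h) t (h t) = trunc t h := by
  funext i
  by_cases hi : i = t
  · subst hi; simp [trunc]
  · rw [Function.update_of_ne hi]
    have : i.val ≠ t.val := fun e => hi (Fin.ext e)
    simp only [trunc, head, Fin.le_def]
    split_ifs <;> first | rfl | omega

variable {Γ : Finset (Fin d → ℤ)}

lemma mem_proj {k : Fin d → ℤ} (hk : k ∈ Γ) (t : Fin d) : k t ∈ proj Γ t :=
  Finset.mem_image_of_mem _ hk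

lemma extent_pos (Γ : Finset (Fin d → ℤ)) (t : Fin d) : 0 < extent Γ t := by
  unfold extent
  split_ifs with h
  · have := (proj Γ t).min'_le _ ((proj Γ t).max'_mem h)
    omega
  · exact one_pos

lemma abs_sub_lt_extent {t : Fin d} {a b : ℤ} (ha : a ∈ proj Γ t) (hb : b ∈ proj Γ t) :
    |a - b| < extent Γ t := by
  have h : (proj Γ t).Nonempty := ⟨a, ha⟩
  have h1 := (proj Γ t).min'_le _ ha
  have h2 := (proj Γ t).min'_le _ hb
  have h3 := (proj Γ t).le_max' _ ha
  have h4 := (proj Γ t).le_max' _ hb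
  rw [extent, dif_pos h, abs_lt]
  omega

lemma eq_of_extent_dvd {t : Fin d} {a b : ℤ} (ha : a ∈ proj Γ t) (hb : b ∈ proj Γ t) {K : ℤ}
    (hK : extent Γ t ≤ K) (h : K ∣ a - b) : a = b :=
  sub_eq_zero.1 (Int.eq_zero_of_abs_lt_dvd h ((abs_sub_lt_extent ha hb).trans_le hK))

lemma extent_le {N : ℕ} (h : ∀ k ∈ Γ, ∀ i, |k i| ≤ (N : ℤ)) (t : Fin d) :
    extent Γ t ≤ 2 * N + 1 := by
  unfold extent
  split_ifs with hne
  · obtain ⟨k, hk, hk'⟩ := Finset.mem_image.1 ((proj Γ t).max'_mem hne)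
    obtain ⟨l, hl, hl'⟩ := Finset.mem_image.1 ((proj Γ t).min'_mem hne)
    have h1 := abs_le.1 (h k hk t)
    have h2 := abs_le.1 (h l hl t)
    omega
  · omega

lemma proj_card_le (Γ : Finset (Fin d → ℤ)) (t : Fin d) : (proj Γ t).card ≤ extent Γ t := by
  unfold extent
  split_ifs with hne
  · have : proj Γ t ⊆ Finset.Icc ((proj Γ t).min' hne) ((proj Γ t).max' hne) := fun a ha =>
      Finset.mem_Icc.2 ⟨(proj Γ t).min'_le _ ha, (proj Γ t).le_max' _ ha⟩
    refine (Finset.card_le_card this).trans ?_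
    rw [Int.card_Icc]
    omega
  · rw [Finset.not_nonempty_iff_eq_empty.1 hne]; simp

end Projections

section Component
variable {d : ℕ} {Γ : Finset (Fin d → ℤ)} {phat : (Fin d → ℤ) →₀ ℂ} {δ : ℝ} {s r : ℕ}
  {ω : Randomness d r}

open UnitAddTorus

/-- The sampling nodes of the detection of the components number `t`. -/
def componentNodes (Γ : Finset (Fin d → ℤ)) (ω : Randomness d r) (t : Fin d) :
    List (ℕ → Fin d → UnitAddCircle) :=
  (List.finRange r).map fun i j =>
    Function.update (ω.1 t i) t (((j : ℝ) / extent Γ t : ℝ) : UnitAddCircle)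

/-- The residue of a component modulo `K`, as position in the array of coefficients. -/
def componentKey (K : ℕ) (k : ℤ) : Counted ℕ := do
  let m ← arith (k % K)
  pure m.toNat

lemma detectComponent_eq (p : (Fin d → UnitAddCircle) → ℂ) (t : Fin d) :
    detectComponent Γ p δ s ω t = detectionLoop p δ s (extent Γ t) (componentNodes Γ ω t)
      ((proj Γ t).sort (· ≤ ·)) (componentKey (extent Γ t)) := rfl

lemma nodeCoeff_component (hΓ : phat.support ⊆ Γ) (t : Fin d) (i : Fin r) {j : ℕ} {k : ℤ}
    (hj : ((proj Γ t).sort (· ≤ ·))[j]? = some k) :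
    nodeCoeff (trigPoly phat) (extent Γ t) ((proj Γ t).sort (· ≤ ·)) (componentKey (extent Γ t))
      (fun j => Function.update (ω.1 t i) t (((j : ℝ) / extent Γ t : ℝ) : UnitAddCircle)) j =
    fiberSum phat (fun h => h t) (fun h => Function.update h t 0) k (ω.1 t i) := by
  rw [nodeCoeff_modes (extent_pos Γ t) (trigPoly phat) _ _ (fun k => k) (fun k => rfl) _
    phat.support (fun h => h t) (fun h => phat h * mFourier (Function.update h t 0) (ω.1 t i))
    ?_ hj, fiberSum]
  · refine Finset.sum_congr (Finset.filter_congr fun h hh => ?_) fun _ _ => rfl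
    have hk : k ∈ proj Γ t := (Finset.mem_sort _).1 (List.mem_iff_getElem?.2 ⟨j, hj⟩)
    constructor
    · exact eq_of_extent_dvd (mem_proj (hΓ hh) t) hk le_rfl
    · rintro rfl; simp
  · intro j _
    refine Finset.sum_congr rfl fun h _ => ?_
    beta_reduce
    rw [mFourier_update, ← mul_assoc]
    congr 2; ring

lemma large_component (hΓ : phat.support ⊆ Γ) (hδ : 0 < δ) (t : Fin d) :
    ∀ x ∈ componentNodes Γ ω t, (large δ ((proj Γ t).sort (· ≤ ·)).length
      (nodeCoeff (trigPoly phat) (extent Γ t) ((proj Γ t).sort (· ≤ ·))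
        (componentKey (extent Γ t)) x)).card ≤ phat.support.card := by
  intro x hx
  obtain ⟨i, -, rfl⟩ := List.mem_map.1 hx
  exact large_card_le_of_fiber hδ (Finset.sort_nodup _ _)
    fun j k hj => nodeCoeff_component hΓ t i hj

lemma detectComponent_exact (hΓ : phat.support ⊆ Γ) (hδ : 0 < δ) (hs : phat.support.card ≤ s)
    (t : Fin d) (hseen : ∀ h ∈ phat.support, ∃ i, δ ≤
      ‖fiberSum phat (fun h => h t) (fun h => Function.update h t 0) (h t) (ω.1 t i)‖) :
    ((detectComponent Γ (trigPoly phat) δ s ω t).val.map Prod.fst).Nodup ∧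
    ∀ k, k ∈ (detectComponent Γ (trigPoly phat) δ s ω t).val.map Prod.fst ↔
      ∃ h ∈ phat.support, h t = k := by
  rw [detectComponent_eq]
  -- the weights depend on the node only through its components other than `t`, which are the same
  -- for all nodes `x j` of one iteration
  refine detectionLoop_exact hδ (Finset.sort_nodup _ _) hs (P := fun h => h t)
    (w := fun x h => phat h * mFourier (Function.update h t 0) (x 0)) ?_ ?_ ?_
  · intro x hx j k hj
    obtain ⟨i, -, rfl⟩ := List.mem_map.1 hx
    rw [nodeCoeff_component hΓ t i hj, fiberSum]
    refine Finset.sum_congr rfl fun h _ => ?_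
    rw [mFourier_update, Function.update_idem, Function.update_self]
    simp
  · exact fun h hh => (Finset.mem_sort _).2 (mem_proj (hΓ hh) t)
  · intro h hh
    obtain ⟨i, hi⟩ := hseen h hh
    refine ⟨_, List.mem_map.2 ⟨i, List.mem_finRange i, rfl⟩, hi.trans_eq ?_⟩
    rw [fiberSum]
    congr 1
    refine Finset.sum_congr rfl fun h _ => ?_
    rw [mFourier_update, Function.update_idem, Function.update_self]
    simp

end Component

/-! ### The dimension increment -/

section Step
variable {d : ℕ} {Γ : Finset (Fin d → ℤ)} {phat : (Fin d → ℤ) →₀ ℂ} {δ : ℝ} {s r : ℕ}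
  {ω : Randomness d r}

open UnitAddTorus

/-- The candidates of a dimension increment. -/
def candidates (Γ : Finset (Fin d → ℤ)) (t : Fin d) (I : List (Fin d → ℤ)) (A : List ℤ) :
    Counted (List (Fin d → ℤ)) :=
  (I ×ˢ A).foldlM (fun (J : List (Fin d → ℤ)) ka => do
    let b ← memTest Γ t (Function.update ka.1 t ka.2)
    pure (if b then Function.update ka.1 t ka.2 :: J else J)) []

/-- The lower bound for the lattice size in the dimension increment. -/
def sizeBound (Γ : Finset (Fin d → ℤ)) (t : Fin d) (I : List (Fin d → ℤ)) : ℕ :=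
  max (max (I.length ^ 2) 2) ((Finset.univ.filter (· < t)).sup (extent Γ))

/-- The prime lattice size for the components before `t`. -/
def primeSize (Γ : Finset (Fin d → ℤ)) (t : Fin d) (I : List (Fin d → ℤ)) : Counted ℕ :=
  firstPrime (sizeBound Γ t I) (sizeBound Γ t I)

/-- The generating vector of the lattice for the candidates. -/
def stepVector (Γ : Finset (Fin d → ℤ)) (t : Fin d) (I : List (Fin d → ℤ)) : Fin d → ℤ :=
  Function.update (generatingVector (primeSize Γ t I).val t.val I).val t ((primeSize Γ t I).val : ℤ)

/-- The size of the lattice for the candidates. -/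
def stepSize (Γ : Finset (Fin d → ℤ)) (t : Fin d) (I : List (Fin d → ℤ)) : ℕ :=
  (primeSize Γ t I).val * extent Γ t

/-- The sampling nodes of one iteration: the rank-1 lattice with size `M` and generating vector `z`
in the components up to `t`, and the components of `x` after `t`. -/
def latticeNodes (t : Fin d) (z : Fin d → ℤ) (M : ℕ) (x : Fin d → UnitAddCircle) (j : ℕ) :
    Fin d → UnitAddCircle :=
  fun l => if l ≤ t then (((j : ℝ) * (z l : ℝ) / M : ℝ) : UnitAddCircle) else x l

/-- The sampling nodes of a dimension increment. -/
def stepNodes (Γ : Finset (Fin d → ℤ)) (ω : Randomness d r) (t : Fin d) (I : List (Fin d → ℤ)) :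
    List (ℕ → Fin d → UnitAddCircle) :=
  ((List.finRange r).take (if t.val + 1 < d then r else 1)).map fun i =>
    latticeNodes t (stepVector Γ t I) (stepSize Γ t I) (ω.2 t i)

/-- The residue modulo `M` of the product of `k` with the generating vector `z`, as position in the
array of coefficients. -/
def latticeKey (t : Fin d) (z : Fin d → ℤ) (M : ℕ) (k : Fin d → ℤ) : Counted ℕ := do
  let v ← ((List.finRange d).filter (· ≤ t)).foldlM (fun (v : ℤ) l => do
    let w ← arith (k l * z l)
    arith (v + w)) 0
  let v ← arith (v % M)
  pure v.toNat

lemma dimensionStep_eq (p : (Fin d → UnitAddCircle) → ℂ) (t : Fin d) (I : List (Fin d → ℤ)) :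
    dimensionStep Γ p δ s s ω t I = (do
      let It ← detectComponent Γ p δ s ω t
      let J ← candidates Γ t I (It.map Prod.fst)
      let _ ← primeSize Γ t I
      let _ ← generatingVector (primeSize Γ t I).val t.val I
      let _ ← arith (stepSize Γ t I)
      detectionLoop p δ s (stepSize Γ t I) (stepNodes Γ ω t I) J
        (latticeKey t (stepVector Γ t I) (stepSize Γ t I))) := by
  simp only [dimensionStep, ite_self]
  rfl

lemma candidates_val (t : Fin d) (I : List (Fin d → ℤ)) (A : List ℤ) :
    (candidates Γ t I A).val = (((I ×ˢ A).map fun ka => Function.update ka.1 t ka.2).filter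
      (fun k => decide (k ∈ projUpTo Γ t))).reverse := by
  have key : ∀ (l : List ((Fin d → ℤ) × ℤ)) (J : List (Fin d → ℤ)),
      (l.foldlM (fun (J : List (Fin d → ℤ)) ka => (do
        let b ← memTest Γ t (Function.update ka.1 t ka.2)
        pure (if b then Function.update ka.1 t ka.2 :: J else J) : Counted _)) J).val =
      ((l.map fun ka => Function.update ka.1 t ka.2).filter
        (fun k => decide (k ∈ projUpTo Γ t))).reverse ++ J := by
    intro l
    induction l with
    | nil => simp
    | cons ka l ih =>
      intro J
      rw [List.foldlM_cons, bind_val, ih, List.map_cons, List.filter_cons]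
      by_cases h : Function.update ka.1 t ka.2 ∈ projUpTo Γ t
      · simp only [bind_val, memTest, h, decide_true, if_true, pure_val, List.reverse_cons,
          List.append_assoc, List.singleton_append]
      · simp only [bind_val, memTest, h, decide_false, if_false, Bool.false_eq_true, pure_val]
  rw [candidates, key, List.append_nil]

lemma mem_candidates {t : Fin d} {I : List (Fin d → ℤ)} {A : List ℤ} {k : Fin d → ℤ} :
    k ∈ (candidates Γ t I A).val ↔
      (∃ k' ∈ I, ∃ a ∈ A, Function.update k' t a = k) ∧ k ∈ projUpTo Γ t := by
  rw [candidates_val, List.mem_reverse, List.mem_filter, List.mem_map, decide_eq_true_iff]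
  refine and_congr_left' ⟨?_, ?_⟩
  · rintro ⟨⟨k', a⟩, h, e⟩
    exact ⟨k', (List.mem_product.1 h).1, a, (List.mem_product.1 h).2, e⟩
  · rintro ⟨k', h, a, h', e⟩
    exact ⟨(k', a), List.mem_product.2 ⟨h, h'⟩, e⟩

lemma candidates_nodup {t : Fin d} {I : List (Fin d → ℤ)} {A : List ℤ} (hI : I.Nodup)
    (hA : A.Nodup) (h0 : ∀ k ∈ I, k t = 0) : (candidates Γ t I A).val.Nodup := by
  rw [candidates_val, List.nodup_reverse]
  refine List.Nodup.filter _ (List.Nodup.map_on ?_ (hI.product hA))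
  rintro ⟨k, a⟩ h ⟨k', a'⟩ h' e
  have h1 := congrFun e t
  simp only [Function.update_self] at h1
  rw [Prod.mk.injEq, and_iff_left h1]
  funext i
  by_cases hi : i = t
  · rw [hi, h0 k (List.mem_product.1 h).1, h0 k' (List.mem_product.1 h').1]
  · simpa [Function.update_of_ne hi] using congrFun e i

lemma candidates_length (t : Fin d) (I : List (Fin d → ℤ)) (A : List ℤ) :
    (candidates Γ t I A).val.length ≤ I.length * A.length := by
  rw [candidates_val, List.length_reverse]
  refine (List.length_filter_le _ _).trans ?_
  rw [List.length_map, List.length_product]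

lemma candidates_cost (t : Fin d) (I : List (Fin d → ℤ)) (A : List ℤ) :
    (candidates Γ t I A).samples = 0 ∧
      (candidates Γ t I A).ops ≤ I.length * A.length * d := by
  rw [← List.length_product]
  refine foldlM_cost d (fun J ka _ => ⟨rfl, ?_⟩) []
  simp only [bind_ops, memTest, pure_ops, add_zero]
  exact t.isLt

lemma latticeKey_cost (t : Fin d) (z : Fin d → ℤ) (M : ℕ) (k : Fin d → ℤ) :
    (latticeKey t z M k).samples = 0 ∧ (latticeKey t z M k).ops ≤ 2 * d + 1 := by
  have h1 := foldlM_cost (f := fun (v : ℤ) l => (do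
    let w ← arith (k l * z l)
    arith (v + w) : Counted ℤ)) (l := (List.finRange d).filter (· ≤ t)) 2
    (fun v l _ => ⟨rfl, le_rfl⟩) 0
  have h2 : ((List.finRange d).filter (· ≤ t)).length ≤ d := by
    simpa using List.length_filter_le (fun i => decide (i ≤ t)) (List.finRange d)
  simp only [latticeKey, bind_samples, bind_ops, arith_samples, arith_ops, pure_samples, pure_ops]
  omega

lemma latticeKey_val (t : Fin d) (z : Fin d → ℤ) (M : ℕ) (k : Fin d → ℤ) :
    (latticeKey t z M k).val = ((∑ l with l ≤ t, k l * z l) % (M : ℤ)).toNat := by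
  have h1 : ∀ (l : List (Fin d)) (v : ℤ), (l.foldlM (fun (v : ℤ) l => (do
      let w ← arith (k l * z l)
      arith (v + w) : Counted ℤ)) v).val = v + (l.map fun l => k l * z l).sum := by
    intro l
    induction l with
    | nil => simp
    | cons a l ih =>
      intro v
      rw [List.foldlM_cons, bind_val, ih, List.map_cons, List.sum_cons, ← add_assoc]
      rfl
  rw [← sum_map_finRange_filter, ← zero_add (List.sum _), ← h1]
  rfl

lemma two_le_sizeBound (t : Fin d) (I : List (Fin d → ℤ)) : 2 ≤ sizeBound Γ t I := by
  unfold sizeBound; omega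

lemma sizeBound_le_primeSize (t : Fin d) (I : List (Fin d → ℤ)) :
    sizeBound Γ t I ≤ (primeSize Γ t I).val := (firstPrime_bounds _ _).1

lemma stepSize_pos (t : Fin d) (I : List (Fin d → ℤ)) : 0 < stepSize Γ t I :=
  Nat.mul_pos (by
    have := two_le_sizeBound (Γ := Γ) t I
    have := sizeBound_le_primeSize (Γ := Γ) t I
    omega) (extent_pos Γ t)

lemma sum_le_eq_sum_lt_add (t : Fin d) (f : Fin d → ℤ) :
    ∑ l with l ≤ t, f l = ∑ l with l.val < t.val, f l + f t := by
  have : (Finset.univ.filter fun l : Fin d => l ≤ t) =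
      insert t (Finset.univ.filter fun l : Fin d => l.val < t.val) := by
    ext l
    simp only [Finset.mem_filter, Finset.mem_univ, true_and, Finset.mem_insert, Fin.ext_iff,
      Fin.le_def]
    omega
  rw [this, Finset.sum_insert (by simp), add_comm]

/-- The constructed lattice is reconstructing: frequencies in the search space whose first
components belong to `I` and that have the same residue have the same projection. -/
lemma stepVector_reconstructing {t : Fin d} {I : List (Fin d → ℤ)} {h k : Fin d → ℤ}
    (hΓ : h ∈ Γ) (kΓ : k ∈ Γ) (hI : head t.val h ∈ I) (kI : head t.val k ∈ I)
    (hd : (stepSize Γ t I : ℤ) ∣ ∑ l with l ≤ t, h l * stepVector Γ t I l -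
      ∑ l with l ≤ t, k l * stepVector Γ t I l) : trunc t h = trunc t k := by
  have hq := sizeBound_le_primeSize (Γ := Γ) t I
  have hM : (primeSize Γ t I).val.Prime := firstPrime_self_prime (two_le_sizeBound t I)
  set M' := (primeSize Γ t I).val with hM'
  set z' := (generatingVector M' t.val I).val with hz'
  have hz : stepVector Γ t I = Function.update z' t (M' : ℤ) := rfl
  have hsum : ∀ g : Fin d → ℤ, ∑ l with l ≤ t, g l * stepVector Γ t I l =
      ∑ l with l.val < t.val, g l * z' l + g t * M' := by
    intro g
    rw [sum_le_eq_sum_lt_add, hz, Function.update_self]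
    congr 1
    refine Finset.sum_congr rfl fun l hl => ?_
    rw [Function.update_of_ne]
    rintro rfl
    simp at hl
  have hhead : ∀ g : Fin d → ℤ, ∑ l with l.val < t.val, head t.val g l * z' l =
      ∑ l with l.val < t.val, g l * z' l := by
    intro g
    refine Finset.sum_congr rfl fun l hl => ?_
    rw [head, if_pos (Finset.mem_filter.1 hl).2]
  have hS : (stepSize Γ t I : ℤ) = M' * extent Γ t := by rw [stepSize]; push_cast; rfl
  rw [hsum, hsum, hS] at hd
  -- first modulo `M'`, which determines the components before `t`
  have h1 : ∀ l : Fin d, l.val < t.val → h l = k l := by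
    intro l hl
    have h2 := generatingVector_val hM (le_trans (by unfold sizeBound; omega) hq) hI kI (by
      rw [hhead, hhead]
      have := (dvd_mul_right (M' : ℤ) (extent Γ t : ℤ)).trans hd
      have h3 := dvd_sub this (dvd_mul_left (M' : ℤ) (h t - k t))
      rwa [show ∀ a b c e f : ℤ, a + b * f - (c + e * f) - (b - e) * f = a - c by intros; ring]
        at h3) l hl
    rw [head, head, if_pos hl, if_pos hl] at h2
    refine eq_of_extent_dvd (mem_proj hΓ l) (mem_proj kΓ l) ?_ h2
    have h4 : extent Γ l ≤ (Finset.univ.filter (· < t)).sup (extent Γ) :=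
      Finset.le_sup (f := extent Γ) (Finset.mem_filter.2 ⟨Finset.mem_univ l, hl⟩)
    have : extent Γ l ≤ sizeBound Γ t I := by unfold sizeBound; omega
    exact_mod_cast this.trans hq
  -- then modulo the full lattice size, which determines component `t`
  have h5 : h t = k t := by
    have h6 : ∑ l with l.val < t.val, h l * z' l = ∑ l with l.val < t.val, k l * z' l :=
      Finset.sum_congr rfl fun l hl => by rw [h1 l (Finset.mem_filter.1 hl).2]
    rw [h6, add_sub_add_left_eq_sub, ← sub_mul, mul_comm] at hd
    exact eq_of_extent_dvd (mem_proj hΓ t) (mem_proj kΓ t) le_rfl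
      (Int.dvd_of_mul_dvd_mul_right (a := (M' : ℤ)) (by exact_mod_cast hM.ne_zero)
        (by rwa [mul_comm] at hd ⊢))
  funext l
  simp only [trunc]
  split_ifs with hl
  · rcases hl.lt_or_eq with hl | rfl
    · exact h1 l hl
    · exact h5
  · rfl

/-- The list `I` consists of the projections of the support to the components before `t`. -/
def IsExact (phat : (Fin d → ℤ) →₀ ℂ) (t : ℕ) (I : List (Fin d → ℤ)) : Prop :=
  I.Nodup ∧ ∀ k, k ∈ I ↔ ∃ h ∈ phat.support, head t h = k

lemma IsExact.length_le {t : ℕ} {I : List (Fin d → ℤ)} (hI : IsExact phat t I) :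
    I.length ≤ phat.support.card := by
  rw [← List.toFinset_card_of_nodup hI.1]
  refine (Finset.card_le_card (t := phat.support.image (head t)) fun k hk => ?_).trans
    Finset.card_image_le
  rw [List.mem_toFinset, hI.2] at hk
  exact Finset.mem_image.2 hk

lemma nodeCoeff_step (hΓ : phat.support ⊆ Γ) {t : Fin d} {I : List (Fin d → ℤ)}
    (hI : IsExact phat t.val I) (A : List ℤ) (x : Fin d → UnitAddCircle) {j : ℕ} {k : Fin d → ℤ}
    (hj : (candidates Γ t I A).val[j]? = some k) :
    nodeCoeff (trigPoly phat) (stepSize Γ t I) (candidates Γ t I A).val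
      (latticeKey t (stepVector Γ t I) (stepSize Γ t I))
      (latticeNodes t (stepVector Γ t I) (stepSize Γ t I) x) j =
    fiberSum phat (trunc t) (tail t) k x := by
  rw [nodeCoeff_modes (stepSize_pos t I) (trigPoly phat) _ _ _ (latticeKey_val _ _ _) _
    phat.support (fun h => ∑ l with l ≤ t, h l * stepVector Γ t I l)
    (fun h => phat h * mFourier (tail t h) x) ?_ hj, fiberSum]
  · refine Finset.sum_congr (Finset.filter_congr fun h hh => ?_) fun _ _ => rfl
    obtain ⟨⟨k', hk', a, -, rfl⟩, hk⟩ := mem_candidates.1 (List.mem_iff_getElem?.2 ⟨j, hj⟩)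
    obtain ⟨g, hg, hgk⟩ := Finset.mem_image.1 hk
    have htr : ∀ g : Fin d → ℤ, ∑ l with l ≤ t, trunc t g l * stepVector Γ t I l =
        ∑ l with l ≤ t, g l * stepVector Γ t I l := by
      intro g
      refine Finset.sum_congr rfl fun l hl => ?_
      rw [trunc, if_pos (Finset.mem_filter.1 hl).2]
    rw [← hgk, htr]
    constructor
    · refine stepVector_reconstructing (hΓ hh) hg ((hI.2 _).2 ⟨h, hh, rfl⟩) ?_
      have : head t.val g = k' := by
        obtain ⟨h0, -, rfl⟩ := (hI.2 _).1 hk'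
        funext l
        have := congrFun hgk l
        simp only [trunc, head] at this ⊢
        split_ifs with hl
        · have hlt : l ≠ t := by rintro rfl; exact lt_irrefl _ hl
          rw [if_pos (Fin.le_def.2 hl.le), Function.update_of_ne hlt] at this
          rw [this, head, if_pos hl]
        · rfl
      rwa [this]
    · intro e
      rw [← htr h, ← htr g, e, sub_self]
      exact dvd_zero _
  · intro j _
    refine Finset.sum_congr rfl fun h _ => ?_
    beta_reduce
    unfold latticeNodes
    rw [mFourier_split h x t fun l => (j : ℝ) * (stepVector Γ t I l : ℝ) / stepSize Γ t I,
      ← mul_assoc]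
    congr 2
    push_cast
    rw [Finset.mul_sum, Finset.sum_div]
    exact Finset.sum_congr rfl fun l _ => by ring

lemma head_self_eq_zero (t : Fin d) (h : Fin d → ℤ) : head t.val h t = 0 := by
  rw [head, if_neg (lt_irrefl _)]

lemma large_step (hΓ : phat.support ⊆ Γ) (hδ : 0 < δ) {t : Fin d} {I : List (Fin d → ℤ)}
    (hI : IsExact phat t.val I) {A : List ℤ} (hA : A.Nodup) :
    ∀ x ∈ stepNodes Γ ω t I, (large δ (candidates Γ t I A).val.length
      (nodeCoeff (trigPoly phat) (stepSize Γ t I) (candidates Γ t I A).val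
        (latticeKey t (stepVector Γ t I) (stepSize Γ t I)) x)).card ≤ phat.support.card := by
  intro x hx
  obtain ⟨i, -, rfl⟩ := List.mem_map.1 hx
  refine large_card_le_of_fiber hδ (candidates_nodup hI.1 hA fun k hk => ?_) (P := trunc t)
    (w := fun h => phat h * mFourier (tail t h) (ω.2 t i))
    fun j k hj => (nodeCoeff_step hΓ hI A _ hj).trans (by rw [fiberSum])
  obtain ⟨h, -, rfl⟩ := (hI.2 k).1 hk
  exact head_self_eq_zero t h

lemma trunc_eq_self_of_last {t : Fin d} (ht : ¬ t.val + 1 < d) (h : Fin d → ℤ) : trunc t h = h := by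
  funext i
  rw [trunc, if_pos (by rw [Fin.le_def]; omega)]

/-- In the last dimension increment the coefficients are the Fourier coefficients themselves. -/
lemma fiberSum_last {t : Fin d} (ht : ¬ t.val + 1 < d) {h : Fin d → ℤ} (hh : h ∈ phat.support)
    (x : Fin d → UnitAddCircle) : fiberSum phat (trunc t) (tail t) (trunc t h) x = phat h := by
  have : tail t h = 0 := by
    funext i
    rw [tail, if_pos (by rw [Fin.le_def]; omega)]; rfl
  rw [fiberSum, Finset.sum_eq_single h]
  · rw [this, mFourier_zero, ContinuousMap.one_apply, mul_one]
  · intro g hg hne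
    rw [Finset.mem_filter, trunc_eq_self_of_last ht, trunc_eq_self_of_last ht] at hg
    exact absurd hg.2 hne
  · intro hn
    simp [hh] at hn

lemma dimensionStep_exact (hΓ : phat.support ⊆ Γ) (hδ : 0 < δ) (hs : phat.support.card ≤ s)
    (hr : 0 < r) (hmin : ∀ h ∈ phat.support, δ ≤ ‖phat h‖)
    {t : Fin d} {I : List (Fin d → ℤ)} (hI : IsExact phat t.val I)
    (hseen1 : ∀ h ∈ phat.support, ∃ i, δ ≤
      ‖fiberSum phat (fun h => h t) (fun h => Function.update h t 0) (h t) (ω.1 t i)‖)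
    (hseen2 : t.val + 1 < d → ∀ h ∈ phat.support, ∃ i, δ ≤
      ‖fiberSum phat (trunc t) (tail t) (trunc t h) (ω.2 t i)‖) :
    IsExact phat (t.val + 1)
      ((dimensionStep Γ (trigPoly phat) δ s s ω t I).val.map Prod.fst) := by
  obtain ⟨hA, hA'⟩ := detectComponent_exact (s := s) hΓ hδ hs t hseen1
  set A := (detectComponent Γ (trigPoly phat) δ s ω t).val.map Prod.fst with hAdef
  have hval : (dimensionStep Γ (trigPoly phat) δ s s ω t I).val =
      (detectionLoop (trigPoly phat) δ s (stepSize Γ t I) (stepNodes Γ ω t I)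
        (candidates Γ t I A).val (latticeKey t (stepVector Γ t I) (stepSize Γ t I))).val := by
    simp only [dimensionStep_eq, bind_val, hAdef]
  have hnd : (candidates Γ t I A).val.Nodup := candidates_nodup hI.1 hA fun k hk => by
    obtain ⟨h, -, rfl⟩ := (hI.2 k).1 hk
    exact head_self_eq_zero t h
  have hw : ∀ (i : Fin r) (k : Fin d → ℤ), fiberSum phat (trunc t) (tail t) k (ω.2 t i) =
      ∑ h ∈ phat.support with trunc t h = k, phat h * mFourier (tail t h)
        (latticeNodes t (stepVector Γ t I) (stepSize Γ t I) (ω.2 t i) 0) := by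
    intro i k
    rw [fiberSum]
    refine Finset.sum_congr rfl fun h _ => ?_
    unfold latticeNodes
    rw [mFourier_split _ _ t fun l => ((0 : ℕ) : ℝ) * (stepVector Γ t I l : ℝ) / stepSize Γ t I]
    have : tail t (tail t h) = tail t h := by
      funext l; simp only [tail]; split_ifs <;> rfl
    rw [this]
    simp
  have := detectionLoop_exact (p := trigPoly phat) (nodes := stepNodes Γ ω t I)
    (key := latticeKey t (stepVector Γ t I) (stepSize Γ t I)) (M := stepSize Γ t I)
    hδ hnd hs (P := trunc t)
    (w := fun x h => phat h * mFourier (tail t h) (x 0)) (by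
      intro x hx j k hj
      obtain ⟨i, -, rfl⟩ := List.mem_map.1 hx
      rw [nodeCoeff_step hΓ hI A _ hj, hw]) (by
      intro h hh
      refine mem_candidates.2 ⟨⟨head t.val h, (hI.2 _).2 ⟨h, hh, rfl⟩, h t, (hA' _).2 ⟨h, hh, rfl⟩,
        update_head t h⟩, Finset.mem_image_of_mem _ (hΓ hh)⟩) (by
      intro h hh
      by_cases ht : t.val + 1 < d
      · obtain ⟨i, hi⟩ := hseen2 ht h hh
        refine ⟨_, List.mem_map.2 ⟨i, ?_, rfl⟩, ?_⟩
        · rw [if_pos ht, List.take_of_length_le (by simp)]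
          exact List.mem_finRange i
        · rwa [← hw]
      · refine ⟨_, List.mem_map.2 ⟨⟨0, hr⟩, ?_, rfl⟩, ?_⟩
        · rw [if_neg ht]
          obtain ⟨r, rfl⟩ : ∃ r', r = r' + 1 := ⟨r - 1, by omega⟩
          simp [List.finRange_succ]
        · rw [← hw, fiberSum_last ht hh]
          exact hmin h hh)
  rw [hval]
  refine ⟨this.1, fun k => ?_⟩
  rw [this.2]
  simp only [trunc_eq_head]

/-- Every projection of the support is seen in some detection iteration. -/
def AllSeen (phat : (Fin d → ℤ) →₀ ℂ) (δ : ℝ) (ω : Randomness d r) : Prop :=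
  (∀ t, ∀ h ∈ phat.support, ∃ i, δ ≤
    ‖fiberSum phat (fun h => h t) (fun h => Function.update h t 0) (h t) (ω.1 t i)‖) ∧
  ∀ t : Fin d, t.val + 1 < d → ∀ h ∈ phat.support, ∃ i, δ ≤
    ‖fiberSum phat (trunc t) (tail t) (trunc t h) (ω.2 t i)‖

lemma stage_one (p : (Fin d → UnitAddCircle) → ℂ) (h0 : 0 < d) :
    stage Γ p δ s s ω 1 = (do
      let I ← detectComponent Γ p δ s ω ⟨0, h0⟩
      pure (I.map fun kc => (Pi.single ⟨0, h0⟩ kc.1, kc.2))) := by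
  simp only [stage, dif_pos h0, if_true]

lemma stage_succ (p : (Fin d → UnitAddCircle) → ℂ) {t : ℕ} (ht : t < d) (h0 : t ≠ 0) :
    stage Γ p δ s s ω (t + 1) = (do
      let I ← stage Γ p δ s s ω t
      dimensionStep Γ p δ s s ω ⟨t, ht⟩ (I.map Prod.fst)) := by
  rw [stage, dif_pos ht, if_neg h0]

lemma stage_exact (hΓ : phat.support ⊆ Γ) (hδ : 0 < δ) (hs : phat.support.card ≤ s)
    (hr : 0 < r) (hmin : ∀ h ∈ phat.support, δ ≤ ‖phat h‖) (hω : AllSeen phat δ ω) {t : ℕ}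
    (ht : t + 1 ≤ d) :
    IsExact phat (t + 1) ((stage Γ (trigPoly phat) δ s s ω (t + 1)).val.map Prod.fst) := by
  induction t with
  | zero =>
    have h0 : 0 < d := ht
    obtain ⟨h1, h2⟩ := detectComponent_exact (s := s) hΓ hδ hs ⟨0, h0⟩ (hω.1 _)
    have hmap : (stage Γ (trigPoly phat) δ s s ω (0 + 1)).val.map Prod.fst =
        ((detectComponent Γ (trigPoly phat) δ s ω ⟨0, h0⟩).val.map Prod.fst).map
          (Pi.single ⟨0, h0⟩) := by
      rw [zero_add, stage_one _ h0]
      simp only [bind_val, pure_val, List.map_map]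
      rfl
    have hsingle : ∀ h : Fin d → ℤ, Pi.single ⟨0, h0⟩ (h ⟨0, h0⟩) = head (0 + 1) h := by
      intro h
      funext i
      by_cases hi : i = ⟨0, h0⟩
      · subst hi; simp [head]
      · rw [Pi.single_eq_of_ne hi, head, if_neg]
        intro h'
        exact hi (Fin.ext (by simpa using h'))
    rw [hmap]
    refine ⟨h1.map (Pi.single_injective _), fun k => ?_⟩
    rw [List.mem_map]
    constructor
    · rintro ⟨a, ha, rfl⟩
      obtain ⟨h, hh, rfl⟩ := (h2 a).1 ha
      exact ⟨h, hh, (hsingle h).symm⟩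
    · rintro ⟨h, hh, rfl⟩
      exact ⟨_, (h2 _).2 ⟨h, hh, rfl⟩, hsingle h⟩
  | succ t ih =>
    rw [stage_succ _ (by omega : t + 1 < d) (by omega), bind_val]
    exact dimensionStep_exact (t := ⟨t + 1, by omega⟩) hΓ hδ hs hr hmin (ih (by omega)) (hω.1 _)
      (hω.2 _)

lemma indexSet_eq (hd : 1 ≤ d) (hΓ : phat.support ⊆ Γ) (hδ : 0 < δ) (hs : phat.support.card ≤ s)
    (hr : 0 < r) (hmin : ∀ h ∈ phat.support, δ ≤ ‖phat h‖) (hω : AllSeen phat δ ω) :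
    indexSet (singleLatticeSFFT Γ (trigPoly phat) δ s s ω).val = phat.support := by
  have h1 := stage_exact (t := d - 1) hΓ hδ hs hr hmin hω (by omega)
  rw [Nat.sub_add_cancel hd] at h1
  ext k
  rw [indexSet, List.mem_toFinset, singleLatticeSFFT, h1.2]
  have : ∀ h : Fin d → ℤ, head d h = h := fun h => funext fun i => if_pos i.isLt
  simp only [this, exists_eq_right]

end Step

/-! ### Probability of the detection -/

section Probability
open MeasureTheory UnitAddTorus
variable {d : ℕ}

/-- The law of the random components of one node. -/
def nodeLaw (d : ℕ) : Measure (Fin d → UnitAddCircle) := .pi fun _ => AddCircle.haarAddCircle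

instance : IsProbabilityMeasure (nodeLaw d) := by unfold nodeLaw; infer_instance

lemma integral_fourier_eq (n : ℤ) :
    ∫ x : UnitAddCircle, fourier n x ∂AddCircle.haarAddCircle = if n = 0 then (1 : ℂ) else 0 := by
  split_ifs with h
  · simp [h]
  · exact integral_eq_zero_of_add_right_eq_neg (fourier_add_half_inv_index h one_pos)

lemma integral_mFourier (k : Fin d → ℤ) :
    ∫ x, mFourier k x ∂nodeLaw d = if k = 0 then (1 : ℂ) else 0 := by
  have h1 : ∫ x, mFourier k x ∂nodeLaw d =
      ∏ i, ∫ x : UnitAddCircle, fourier (k i) x ∂AddCircle.haarAddCircle :=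
    integral_fintype_prod_eq_prod (fun i x => fourier (k i) x)
  rw [h1]
  simp_rw [integral_fourier_eq]
  split_ifs with h
  · simp [h]
  · obtain ⟨i, hi⟩ := Function.ne_iff.1 h
    exact Finset.prod_eq_zero (Finset.mem_univ i) (if_neg hi)

lemma norm_mFourier_apply (k : Fin d → ℤ) (x : Fin d → UnitAddCircle) : ‖mFourier k x‖ = 1 := by
  simp only [mFourier, ContinuousMap.coe_mk, norm_prod, fourier_apply, Circle.norm_coe,
    Finset.prod_const_one]

lemma integrable_of_continuous {f : (Fin d → UnitAddCircle) → ℂ} (hf : Continuous f) :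
    Integrable f (nodeLaw d) := by
  obtain ⟨C, hC⟩ := isCompact_univ.exists_bound_of_continuousOn hf.continuousOn
  exact Integrable.of_bound hf.aestronglyMeasurable C
    (Filter.Eventually.of_forall fun x => hC x trivial)

/-- A random value of a trigonometric polynomial with at most `n` terms is with probability at
least `2 / (3 n)` not smaller than a third of the smallest coefficient: the mean of its absolute
value is at least the largest coefficient `m`, and its maximum is at most `n * m`. -/
lemma prob_small_le {ι : Type} {S : Finset ι} (hS : S.Nonempty) {R : ι → Fin d → ℤ}
    (hR : Set.InjOn R S) {a : ι → ℂ} {δ : ℝ} (hδ : 0 < δ) (ha : ∀ h ∈ S, δ ≤ ‖a h‖ / 3) {n : ℕ}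
    (hn : S.card ≤ n) :
    (nodeLaw d).real {x | ‖∑ h ∈ S, a h * mFourier (R h) x‖ < δ} ≤ 1 - 2 / (3 * n) := by
  set g : (Fin d → UnitAddCircle) → ℂ := fun x => ∑ h ∈ S, a h * mFourier (R h) x with hg
  have hgc : Continuous g := by fun_prop
  obtain ⟨h0, hh0, hmax⟩ := S.exists_max_image (fun h => ‖a h‖) hS
  set m := ‖a h0‖ with hm
  have hm3 := ha h0 hh0
  have hcoef : ∫ x, g x * mFourier (-R h0) x ∂nodeLaw d = a h0 := by
    have h1 : ∀ x, g x * mFourier (-R h0) x = ∑ h ∈ S, a h * mFourier (R h + -R h0) x := by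
      intro x
      rw [hg, Finset.sum_mul]
      exact Finset.sum_congr rfl fun h _ => by rw [mFourier_add]; ring
    simp_rw [h1]
    rw [integral_finsetSum _ fun h _ => integrable_of_continuous (by fun_prop)]
    simp_rw [integral_const_mul, integral_mFourier]
    rw [Finset.sum_eq_single h0]
    · simp
    · intro h hh hne
      rw [if_neg, mul_zero]
      intro h2
      exact hne (hR hh hh0 (by rwa [← sub_eq_add_neg, sub_eq_zero] at h2))
    · exact fun h => absurd hh0 h
  have hsup : ∀ x, ‖g x‖ ≤ n * m := by
    intro x
    refine (norm_sum_le _ _).trans ((Finset.sum_le_card_nsmul S _ m fun h hh => ?_).trans ?_)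
    · rw [norm_mul, norm_mFourier_apply, mul_one]
      exact hmax h hh
    · rw [nsmul_eq_mul]
      have : (S.card : ℝ) ≤ n := by exact_mod_cast hn
      gcongr
  set B : Set (Fin d → UnitAddCircle) := {x | δ ≤ ‖g x‖} with hB
  have hBm : MeasurableSet B := measurableSet_le measurable_const hgc.norm.measurable
  have hcompl : {x | ‖g x‖ < δ} = Bᶜ := by ext x; simp [hB]
  have hmean : m ≤ δ + n * m * (nodeLaw d).real B := by
    calc m = ‖∫ x, g x * mFourier (-R h0) x ∂nodeLaw d‖ := by rw [hcoef]
      _ ≤ ∫ x, ‖g x * mFourier (-R h0) x‖ ∂nodeLaw d := norm_integral_le_integral_norm _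
      _ = ∫ x, ‖g x‖ ∂nodeLaw d := by simp_rw [norm_mul, norm_mFourier_apply, mul_one]
      _ ≤ ∫ x, (δ + B.indicator (fun _ => n * m) x) ∂nodeLaw d := by
        refine integral_mono (integrable_of_continuous hgc).norm
          ((integrable_const _).add ((integrable_const _).indicator hBm)) fun x => ?_
        by_cases hx : x ∈ B
        · simp only [Set.indicator_of_mem hx]
          linarith [hsup x]
        · simp only [Set.indicator_of_notMem hx, add_zero]
          exact (not_le.1 hx).le
      _ = δ + n * m * (nodeLaw d).real B := by
        rw [integral_add (integrable_const _) ((integrable_const _).indicator hBm),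
          integral_indicator_const _ hBm]
        simp [mul_comm]
  rw [hcompl, probReal_compl_eq_one_sub hBm]
  have hn0 : (0 : ℝ) < n := by exact_mod_cast (Finset.card_pos.2 hS).trans_le hn
  have hm0 : 0 < m := by linarith
  have : 2 / (3 * n) ≤ (nodeLaw d).real B := by
    rw [div_le_iff₀ (by positivity)]
    have : 2 / 3 * m ≤ n * (nodeLaw d).real B * m := by nlinarith
    have := le_of_mul_le_mul_right this hm0
    linarith
  linarith

/-- The law of the `r` detection iterations for each component. -/
def iterationLaw (d r : ℕ) : Measure (Fin d → Fin r → Fin d → UnitAddCircle) :=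
  .pi fun _ => .pi fun _ => nodeLaw d

instance (r : ℕ) : IsProbabilityMeasure (iterationLaw d r) := by unfold iterationLaw; infer_instance

lemma uniformLaw_eq (d r : ℕ) : uniformLaw d r = (iterationLaw d r).prod (iterationLaw d r) := rfl

instance (r : ℕ) : IsProbabilityMeasure (uniformLaw d r) := by rw [uniformLaw_eq]; infer_instance

lemma iterationLaw_all (r : ℕ) (t : Fin d) {A : Set (Fin d → UnitAddCircle)}
    (hA : MeasurableSet A) :
    (iterationLaw d r).real {ω | ∀ i, ω t i ∈ A} = (nodeLaw d).real A ^ r := by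
  have h1 : {ω : Fin d → Fin r → Fin d → UnitAddCircle | ∀ i, ω t i ∈ A} =
      Function.eval t ⁻¹' (Set.univ.pi fun _ => A) := by ext; simp
  have h2 : MeasurePreserving (Function.eval t) (iterationLaw d r) (.pi fun _ => nodeLaw d) :=
    measurePreserving_eval _ t
  rw [h1, measureReal_def,
    h2.measure_preimage (MeasurableSet.univ_pi fun _ => hA).nullMeasurableSet,
    Measure.pi_pi, Finset.prod_const, Finset.card_univ, Fintype.card_fin, ENNReal.toReal_pow]
  rfl

lemma uniformLaw_fst (r : ℕ) {A : Set (Fin d → Fin r → Fin d → UnitAddCircle)}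
    (hA : MeasurableSet A) : (uniformLaw d r).real {ω | ω.1 ∈ A} = (iterationLaw d r).real A := by
  rw [measureReal_def, measureReal_def]
  congr 1
  exact measurePreserving_fst.measure_preimage hA.nullMeasurableSet

lemma uniformLaw_snd (r : ℕ) {A : Set (Fin d → Fin r → Fin d → UnitAddCircle)}
    (hA : MeasurableSet A) : (uniformLaw d r).real {ω | ω.2 ∈ A} = (iterationLaw d r).real A := by
  rw [measureReal_def, measureReal_def]
  congr 1
  exact measurePreserving_snd.measure_preimage hA.nullMeasurableSet

variable {phat : (Fin d → ℤ) →₀ ℂ} {δ : ℝ}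

lemma continuous_fiberSum {κ : Type} [DecidableEq κ] (P : (Fin d → ℤ) → κ)
    (R : (Fin d → ℤ) → Fin d → ℤ) (k : κ) : Continuous (fiberSum phat P R k) := by
  unfold fiberSum
  fun_prop

lemma measurableSet_unseen {κ : Type} [DecidableEq κ] (P : (Fin d → ℤ) → κ)
    (R : (Fin d → ℤ) → Fin d → ℤ) (k : κ) :
    MeasurableSet {x | ‖fiberSum phat P R k x‖ < δ} :=
  measurableSet_lt (continuous_fiberSum P R k).norm.measurable measurable_const

/-- The probability that a projection of the support is not seen in any of `r` iterations. -/
lemma prob_unseen_le {κ : Type} [DecidableEq κ] {P : (Fin d → ℤ) → κ}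
    {R : (Fin d → ℤ) → Fin d → ℤ} (hPR : ∀ h h', P h = P h' → R h = R h' → h = h')
    (hδ : 0 < δ) (ha : ∀ h ∈ phat.support, δ ≤ ‖phat h‖ / 3) (r : ℕ) (t : Fin d)
    {h : Fin d → ℤ} (hh : h ∈ phat.support) :
    (iterationLaw d r).real {ω | ∀ i, ω t i ∈ {x | ‖fiberSum phat P R (P h) x‖ < δ}} ≤
      (1 - 2 / (3 * phat.support.card)) ^ r := by
  rw [iterationLaw_all r t (measurableSet_unseen _ _ _)]
  refine pow_le_pow_left₀ measureReal_nonneg ?_ r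
  refine prob_small_le (S := phat.support.filter fun g => P g = P h) (R := R) (a := phat)
    ⟨h, by simp [hh]⟩ ?_ hδ ?_ (Finset.card_filter_le _ _)
  · intro g hg g' hg' e
    rw [Finset.mem_coe, Finset.mem_filter] at hg hg'
    exact hPR g g' (hg.2.trans hg'.2.symm) e
  · exact fun g hg => ha g (Finset.mem_filter.1 hg).1

lemma measurableSet_allUnseen {κ : Type} [DecidableEq κ] (P : (Fin d → ℤ) → κ)
    (R : (Fin d → ℤ) → Fin d → ℤ) (k : κ) (r : ℕ) (t : Fin d) :
    MeasurableSet {ω : Fin d → Fin r → Fin d → UnitAddCircle |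
      ∀ i, ω t i ∈ {x | ‖fiberSum phat P R k x‖ < δ}} := by
  rw [Set.ofPred_forall]
  refine MeasurableSet.iInter fun i => ?_
  exact ((measurable_pi_apply i).comp (measurable_pi_apply t)) (measurableSet_unseen P R k)

/-- Not every projection is seen: the complement of `AllSeen` is a union of events. -/
lemma allSeen_compl (phat : (Fin d → ℤ) →₀ ℂ) (δ : ℝ) (r : ℕ) :
    {ω : Randomness d r | AllSeen phat δ ω}ᶜ =
      (⋃ th ∈ (Finset.univ : Finset (Fin d)) ×ˢ phat.support, {ω : Randomness d r | ω.1 ∈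
        {ω | ∀ i, ω th.1 i ∈ {x | ‖fiberSum phat (fun h => h th.1)
          (fun h => Function.update h th.1 0) (th.2 th.1) x‖ < δ}}}) ∪
      ⋃ th ∈ ((Finset.univ : Finset (Fin d)).filter (fun t => t.val + 1 < d)) ×ˢ phat.support,
        {ω : Randomness d r | ω.2 ∈ {ω | ∀ i, ω th.1 i ∈
          {x | ‖fiberSum phat (trunc th.1) (tail th.1) (trunc th.1 th.2) x‖ < δ}}} := by
  ext ω
  simp only [Set.mem_compl_iff, Set.mem_ofPred_eq, AllSeen, not_and_or, Set.mem_union,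
    Set.mem_iUnion, Finset.mem_product, Finset.mem_univ, true_and, Finset.mem_filter, not_forall,
    not_exists, not_le, exists_prop, Prod.exists, and_assoc, exists_and_left]

lemma measurableSet_allSeen (phat : (Fin d → ℤ) →₀ ℂ) (δ : ℝ) (r : ℕ) :
    MeasurableSet {ω : Randomness d r | AllSeen phat δ ω} := by
  rw [← MeasurableSet.compl_iff, allSeen_compl]
  refine MeasurableSet.union ?_ ?_
  · exact Finset.measurableSet_biUnion _ fun th _ =>
      measurable_fst (measurableSet_allUnseen _ _ _ r th.1)
  · exact Finset.measurableSet_biUnion _ fun th _ =>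
      measurable_snd (measurableSet_allUnseen _ _ _ r th.1)

lemma iterations_bound {n d : ℕ} (hn : 1 ≤ n) (hd : 1 ≤ d) {ε : ℝ} (hε : 0 < ε) (hε1 : ε < 1)
    {r : ℕ} (hr : 2 * (n : ℝ) * (Real.log 2 + Real.log d + Real.log n - Real.log ε) ≤ r) :
    2 * (d * n) * (1 - 2 / (3 * n : ℝ)) ^ r ≤ ε := by
  have hn' : (1 : ℝ) ≤ n := by exact_mod_cast hn
  have hd' : (1 : ℝ) ≤ d := by exact_mod_cast hd
  set L := Real.log 2 + Real.log d + Real.log n - Real.log ε with hL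
  have hL0 : 0 ≤ L := by
    have h1 := Real.log_nonneg hn'
    have h2 := Real.log_nonneg hd'
    have h3 := Real.log_nonneg (one_le_two : (1 : ℝ) ≤ 2)
    have h4 := Real.log_nonpos hε.le hε1.le
    linarith
  have hexp : Real.exp (-L) = ε / (2 * (d * n)) := by
    rw [hL, show -(Real.log 2 + Real.log d + Real.log n - Real.log ε) =
      Real.log ε - (Real.log 2 + (Real.log d + Real.log n)) by ring,
      ← Real.log_mul (by positivity) (by positivity),
      ← Real.log_mul (by positivity) (by positivity),
      ← Real.log_div (by positivity) (by positivity), Real.exp_log (by positivity)]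
  have h0 : 0 ≤ 1 - 2 / (3 * n : ℝ) := by
    rw [sub_nonneg, div_le_one (by positivity)]; linarith
  have h1 : (1 - 2 / (3 * n : ℝ)) ^ r ≤ Real.exp (-L) := by
    calc (1 - 2 / (3 * n : ℝ)) ^ r ≤ Real.exp (-(2 / (3 * n : ℝ))) ^ r :=
          pow_le_pow_left₀ h0 (Real.one_sub_le_exp_neg _) r
      _ = Real.exp (-(r * (2 / (3 * n : ℝ)))) := by rw [← Real.exp_nat_mul]; congr 1; ring
      _ ≤ Real.exp (-L) := by
        rw [Real.exp_le_exp, neg_le_neg_iff]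
        calc L ≤ 2 * n * L * (2 / (3 * n : ℝ)) := by
              rw [show 2 * n * L * (2 / (3 * n : ℝ)) = 4 / 3 * L by field_simp; ring]
              linarith
          _ ≤ r * (2 / (3 * n : ℝ)) := by gcongr
  calc 2 * (d * n) * (1 - 2 / (3 * n : ℝ)) ^ r ≤ 2 * (d * n) * (ε / (2 * (d * n))) := by
        rw [← hexp]; gcongr
    _ = ε := by field_simp

/-- With probability at least `1 - ε` every projection of the support is seen. -/
lemma prob_allSeen (hne : phat.support.Nonempty) (hd : 1 ≤ d) {ε : ℝ} (hε : 0 < ε) (hε1 : ε < 1)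
    (hδ : 0 < δ) (ha : ∀ h ∈ phat.support, δ ≤ ‖phat h‖ / 3) :
    ENNReal.ofReal (1 - ε) ≤
      uniformLaw d (iterations phat ε) {ω | AllSeen phat δ ω} := by
  set r := iterations phat ε with hr
  set n := phat.support.card with hn
  have hnpos : 1 ≤ n := hne.card_pos
  set β : ℝ := (1 - 2 / (3 * n : ℝ)) ^ r with hβ
  have hβ0 : 0 ≤ β := pow_nonneg (by
    have : (1 : ℝ) ≤ n := by exact_mod_cast hnpos
    rw [sub_nonneg, div_le_one (by positivity)]; linarith) r
  have h1 : (uniformLaw d r).real {ω | AllSeen phat δ ω}ᶜ ≤ ε := by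
    rw [allSeen_compl]
    refine (measureReal_union_le _ _).trans ?_
    have hA := (measureReal_biUnion_finset_le (μ := uniformLaw d r)
      ((Finset.univ : Finset (Fin d)) ×ˢ phat.support) fun th => {ω : Randomness d r | ω.1 ∈
        {ω | ∀ i, ω th.1 i ∈ {x | ‖fiberSum phat (fun h => h th.1)
          (fun h => Function.update h th.1 0) (th.2 th.1) x‖ < δ}}}).trans
      (Finset.sum_le_card_nsmul _ _ β fun th hth => by
        rw [uniformLaw_fst r (measurableSet_allUnseen _ _ _ r th.1)]
        refine prob_unseen_le (P := fun h => h th.1) (fun h h' e e' => ?_) hδ ha r th.1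
          (Finset.mem_product.1 hth).2
        funext i
        by_cases hi : i = th.1
        · rw [hi]; exact e
        · simpa [Function.update_of_ne hi] using congrFun e' i)
    have hB := (measureReal_biUnion_finset_le (μ := uniformLaw d r)
      (((Finset.univ : Finset (Fin d)).filter (fun t => t.val + 1 < d)) ×ˢ phat.support) fun th =>
        {ω : Randomness d r | ω.2 ∈ {ω | ∀ i, ω th.1 i ∈
          {x | ‖fiberSum phat (trunc th.1) (tail th.1) (trunc th.1 th.2) x‖ < δ}}}).trans
      (Finset.sum_le_card_nsmul _ _ β fun th hth => by
        rw [uniformLaw_snd r (measurableSet_allUnseen _ _ _ r th.1)]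
        refine prob_unseen_le (P := trunc th.1) (fun h h' e e' => ?_) hδ ha r th.1
          (Finset.mem_product.1 hth).2
        funext i
        by_cases hi : i ≤ th.1
        · simpa [trunc, hi] using congrFun e i
        · simpa [tail, hi] using congrFun e' i)
    rw [nsmul_eq_mul, Finset.card_product, Finset.card_univ, Fintype.card_fin] at hA
    rw [nsmul_eq_mul, Finset.card_product] at hB
    have hcard :
        (((Finset.univ : Finset (Fin d)).filter (fun t => t.val + 1 < d)).card : ℝ) ≤ d := by
      have := Finset.card_filter_le (Finset.univ : Finset (Fin d)) (fun t => t.val + 1 < d)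
      rw [Finset.card_univ, Fintype.card_fin] at this
      exact_mod_cast this
    have hB' := hB.trans (show _ ≤ (d : ℝ) * n * β by push_cast; gcongr)
    have hb : 2 * (d * n) * β ≤ ε := iterations_bound hnpos hd hε hε1 (Nat.le_ceil _)
    push_cast at hA
    linarith
  have h2 := probReal_compl_eq_one_sub (μ := uniformLaw d r) (measurableSet_allSeen phat δ r)
  refine ENNReal.ofReal_le_of_le_toReal ?_
  have : (uniformLaw d r).real {ω | AllSeen phat δ ω} =
    (uniformLaw d r {ω | AllSeen phat δ ω}).toReal := rfl
  linarith

lemma iterations_pos (hne : phat.support.Nonempty) (hd : 1 ≤ d) {ε : ℝ} (hε : 0 < ε)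
    (hε1 : ε < 1) : 0 < iterations phat ε := by
  have hn : (1 : ℝ) ≤ phat.support.card := by exact_mod_cast hne.card_pos
  have hd' : (1 : ℝ) ≤ d := by exact_mod_cast hd
  have h1 := Real.log_nonneg hn
  have h2 := Real.log_nonneg hd'
  have h3 := Real.log_pos (one_lt_two : (1 : ℝ) < 2)
  have h4 := Real.log_nonpos hε.le hε1.le
  exact Nat.ceil_pos.2 (mul_pos (by positivity) (by linarith))

end Probability

/-! ### Cost of the algorithm -/

section Cost
variable {d : ℕ} {Γ : Finset (Fin d → ℤ)} {p : (Fin d → UnitAddCircle) → ℂ} {δ : ℝ} {s r : ℕ}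
  {ω : Randomness d r}

lemma componentNodes_length (ω : Randomness d r) (t : Fin d) :
    (componentNodes Γ ω t).length = r := by
  simp [componentNodes]

lemma stepNodes_length_le (ω : Randomness d r) (t : Fin d) (I : List (Fin d → ℤ)) :
    (stepNodes Γ ω t I).length ≤ r := by
  simp only [stepNodes, List.length_map]
  exact (List.length_take_le' _ _).trans (by simp)

lemma proj_sort_length_le (Γ : Finset (Fin d → ℤ)) (t : Fin d) :
    ((proj Γ t).sort (· ≤ ·)).length ≤ extent Γ t := by
  rw [Finset.length_sort]
  exact proj_card_le Γ t

lemma detectComponent_length_le_extent (t : Fin d) :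
    (detectComponent Γ p δ s ω t).val.length ≤ extent Γ t := by
  have h := (detectionLoop_sublist p δ s (extent Γ t) (componentNodes Γ ω t)
    ((proj Γ t).sort (· ≤ ·)) (componentKey (extent Γ t))).length_le
  rw [List.length_map] at h
  exact h.trans (proj_sort_length_le Γ t)

lemma detectComponent_length_le (t : Fin d) :
    (detectComponent Γ p δ s ω t).val.length ≤ r * s := by
  have h := detectionLoop_length p δ s (extent Γ t) (componentNodes Γ ω t)
    ((proj Γ t).sort (· ≤ ·)) (componentKey (extent Γ t))
  rwa [componentNodes_length] at h

lemma dimensionStep_length_le (t : Fin d) (I : List (Fin d → ℤ)) :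
    (dimensionStep Γ p δ s s ω t I).val.length ≤ r * s := by
  simp only [dimensionStep_eq, bind_val]
  exact (detectionLoop_length _ _ _ _ _ _ _).trans
    (Nat.mul_le_mul_right _ (stepNodes_length_le ω t I))

lemma stage_length_le {t : ℕ} (ht : t ≤ d) : (stage Γ p δ s s ω t).val.length ≤ r * s := by
  induction t with
  | zero => simp [stage]
  | succ t ih =>
    rcases Nat.eq_zero_or_pos t with rfl | h0
    · rw [zero_add, stage_one p ht, bind_val, pure_val, List.length_map]
      exact detectComponent_length_le _
    · rw [stage_succ p ht h0.ne', bind_val]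
      exact dimensionStep_length_le _ _

/-- The number `W` of large coefficients is such that the cost `(W + 1) * min s W` of their sorted
insertion is at most `U`, in all iterations of the detection of the components number `t`. -/
def ComponentInsertions (Γ : Finset (Fin d → ℤ)) (p : (Fin d → UnitAddCircle) → ℂ) (δ : ℝ) (s : ℕ)
    (ω : Randomness d r) (U : ℕ) (t : Fin d) : Prop :=
  ∃ W, (W + 1) * min s W ≤ U ∧ ∀ x ∈ componentNodes Γ ω t,
    (large δ ((proj Γ t).sort (· ≤ ·)).length (nodeCoeff p (extent Γ t) ((proj Γ t).sort (· ≤ ·))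
      (componentKey (extent Γ t)) x)).card ≤ W

/-- The analogue of `ComponentInsertions` for the dimension increment with the set `I`. -/
def StepInsertions (Γ : Finset (Fin d → ℤ)) (p : (Fin d → UnitAddCircle) → ℂ) (δ : ℝ) (s : ℕ)
    (ω : Randomness d r) (U : ℕ) (t : Fin d) (I : List (Fin d → ℤ)) : Prop :=
  ∃ W, (W + 1) * min s W ≤ U ∧ ∀ x ∈ stepNodes Γ ω t I,
    (large δ (candidates Γ t I ((detectComponent Γ p δ s ω t).val.map Prod.fst)).val.length
      (nodeCoeff p (stepSize Γ t I)
        (candidates Γ t I ((detectComponent Γ p δ s ω t).val.map Prod.fst)).val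
        (latticeKey t (stepVector Γ t I) (stepSize Γ t I)) x)).card ≤ W

lemma detectComponent_cost {t : Fin d} {T U : ℕ} (hT : extent Γ t ≤ T)
    (hU : ComponentInsertions Γ p δ s ω U t) :
    (detectComponent Γ p δ s ω t).samples ≤ r * T ∧
    (detectComponent Γ p δ s ω t).ops ≤ 2 * T + r * (dftCost T + 2 * T + U) := by
  obtain ⟨W, hW, hW'⟩ := hU
  have hlen := (proj_sort_length_le Γ t).trans hT
  obtain ⟨h1, h2⟩ := detectionLoop_cost p δ s (extent Γ t) (componentNodes Γ ω t)
    ((proj Γ t).sort (· ≤ ·)) (componentKey (extent Γ t)) (extent_pos Γ t) hW'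
    (b := 1) (fun k => ⟨rfl, le_rfl⟩)
  rw [componentNodes_length] at h1 h2
  rw [detectComponent_eq]
  refine ⟨h1.trans_le (Nat.mul_le_mul_left r hT), h2.trans ?_⟩
  have h3 := dftCost_mono hT
  rw [show 2 * T + r * (dftCost T + 2 * T + U) =
    T * (1 + 1) + r * (dftCost T + 2 * T + U) by ring]
  gcongr

/-- Bound for the number of operations of one dimension increment, for at most `r` iterations, at
most `A` frequencies found before, component ranges of length at most `T`, a prime lattice size of
at most `2 * Q`, and insertion cost at most `U` in each iteration. -/
def stepCost (d r T Q A U : ℕ) : ℕ :=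
  2 * T + A * T * (3 * d + 2) + Q * Nat.sqrt (2 * Q) +
    d * (A ^ 2 * (6 + 4 * Nat.clog 2 (2 * (2 * Q * T))) + 2 * Q + 3 * A) + 1 +
    2 * (r * dftCost (2 * Q * T)) + r * (2 * T + 2 * (A * T) + 2 * U)

lemma dimensionStep_cost {t : Fin d} {I : List (Fin d → ℤ)} {A T Q U : ℕ}
    (hT : ∀ i, extent Γ i ≤ T) (hA : I.length ≤ A) (hAQ : A ^ 2 ≤ Q) (h2Q : 2 ≤ Q) (hTQ : T ≤ Q)
    (hU : ComponentInsertions Γ p δ s ω U t) (hU' : StepInsertions Γ p δ s ω U t I) :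
    (dimensionStep Γ p δ s s ω t I).samples ≤ 3 * (r * (Q * T)) ∧
    (dimensionStep Γ p δ s s ω t I).ops ≤ stepCost d r T Q A U := by
  have hT1 : 1 ≤ T := (extent_pos Γ t).trans_le (hT t)
  set B := (detectComponent Γ p δ s ω t).val.map Prod.fst with hB
  have hBlen : B.length ≤ T := by
    rw [hB, List.length_map]; exact (detectComponent_length_le_extent t).trans (hT t)
  have hq : sizeBound Γ t I ≤ Q := by
    have h1 : I.length ^ 2 ≤ A ^ 2 := Nat.pow_le_pow_left hA 2
    have h2 : (Finset.univ.filter (· < t)).sup (extent Γ) ≤ T := Finset.sup_le fun i _ => hT i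
    unfold sizeBound; omega
  have hM' : (primeSize Γ t I).val ≤ 2 * Q := by
    have := (firstPrime_bounds (sizeBound Γ t I) (sizeBound Γ t I)).2
    unfold primeSize; omega
  have hM : stepSize Γ t I ≤ 2 * Q * T := Nat.mul_le_mul hM' (hT t)
  have hJ : (candidates Γ t I B).val.length ≤ A * T :=
    (candidates_length t I B).trans (Nat.mul_le_mul hA hBlen)
  obtain ⟨c1, c2⟩ := detectComponent_cost (hT t) hU
  obtain ⟨c3, c4⟩ := candidates_cost (Γ := Γ) t I B
  obtain ⟨c5, c6⟩ : (primeSize Γ t I).samples = 0 ∧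
      (primeSize Γ t I).ops ≤ Q * Nat.sqrt (2 * Q) := by
    have h := firstPrime_cost (sizeBound Γ t I) (sizeBound Γ t I)
    exact ⟨h.1, h.2.trans (Nat.mul_le_mul hq (Nat.sqrt_le_sqrt (by omega)))⟩
  obtain ⟨c7, c8⟩ := generatingVector_cost (primeSize Γ t I).val t.val I
  have hsize : Nat.size ((primeSize Γ t I).val - 2) ≤ Nat.clog 2 (2 * (2 * Q * T)) := by
    rw [Nat.size_le]
    refine lt_of_lt_of_le ?_ (Nat.le_pow_clog (by norm_num) _)
    have : 2 * Q ≤ 2 * Q * T := Nat.le_mul_of_pos_right _ hT1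
    omega
  have c8' : (generatingVector (primeSize Γ t I).val t.val I).ops ≤
      d * (A ^ 2 * (6 + 4 * Nat.clog 2 (2 * (2 * Q * T))) + 2 * Q + 3 * A) := by
    refine c8.trans ?_
    gcongr
  obtain ⟨W, hW, hW'⟩ := hU'
  obtain ⟨c9, c10⟩ := detectionLoop_cost p δ s (stepSize Γ t I) (stepNodes Γ ω t I)
    (candidates Γ t I B).val (latticeKey t (stepVector Γ t I) (stepSize Γ t I)) (stepSize_pos t I)
    hW' (latticeKey_cost _ _ _)
  have hl := stepNodes_length_le (Γ := Γ) ω t I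
  have c9' : (stepNodes Γ ω t I).length * stepSize Γ t I ≤ r * (2 * Q * T) := Nat.mul_le_mul hl hM
  have c10' : (candidates Γ t I B).val.length * (2 * d + 1 + 1) + (stepNodes Γ ω t I).length *
      (dftCost (stepSize Γ t I) + 2 * (candidates Γ t I B).val.length + (W + 1) * min s W) ≤
      A * T * (2 * d + 2) + r * (dftCost (2 * Q * T) + 2 * (A * T) + U) := by
    have := dftCost_mono hM
    gcongr
  have hTT : T ≤ 2 * Q * T := Nat.le_mul_of_pos_left _ (by omega)
  have c2' := c2.trans (show _ ≤ 2 * T + r * (dftCost (2 * Q * T) + 2 * T + U) by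
    have := dftCost_mono hTT
    gcongr)
  have c4' : (candidates Γ t I B).ops ≤ A * T * d := c4.trans (by gcongr)
  simp only [dimensionStep_eq, bind_samples, bind_ops, arith_samples, arith_ops, ← hB]
  constructor
  · have : r * T ≤ r * (Q * T) := by
      have : T ≤ Q * T := Nat.le_mul_of_pos_left _ (by omega)
      gcongr
    rw [c3, c5, c7, c9]
    rw [show r * (2 * Q * T) = 2 * (r * (Q * T)) by ring] at c9'
    omega
  · have e : stepCost d r T Q A U = (2 * T + r * (dftCost (2 * Q * T) + 2 * T + U)) +
        (A * T * d + (Q * Nat.sqrt (2 * Q) +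
        (d * (A ^ 2 * (6 + 4 * Nat.clog 2 (2 * (2 * Q * T))) + 2 * Q + 3 * A) + (1 +
        (A * T * (2 * d + 2) + r * (dftCost (2 * Q * T) + 2 * (A * T) + U)))))) := by
      unfold stepCost; ring
    rw [e]
    exact add_le_add c2' (add_le_add c4' (add_le_add c6 (add_le_add c8' (add_le_add le_rfl
      (c10.trans c10')))))

lemma stage_cost {A T Q U : ℕ} (hT : ∀ i, extent Γ i ≤ T) (hAQ : A ^ 2 ≤ Q) (h2Q : 2 ≤ Q)
    (hTQ : T ≤ Q) (hA : ∀ t, 0 < t → t < d → (stage Γ p δ s s ω t).val.length ≤ A)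
    (hU : ∀ t, ComponentInsertions Γ p δ s ω U t)
    (hU' : ∀ t : Fin d, 0 < t.val → StepInsertions Γ p δ s ω U t
      ((stage Γ p δ s s ω t.val).val.map Prod.fst)) {t : ℕ} (ht : t ≤ d) :
    (stage Γ p δ s s ω t).samples ≤ t * (3 * (r * (Q * T))) ∧
    (stage Γ p δ s s ω t).ops ≤ t * stepCost d r T Q A U := by
  induction t with
  | zero => simp [stage]
  | succ t ih =>
    rcases Nat.eq_zero_or_pos t with rfl | h0
    · have h0 : 0 < d := ht
      have hTT : T ≤ 2 * Q * T := Nat.le_mul_of_pos_left _ (by omega)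
      obtain ⟨h1, h2⟩ := detectComponent_cost (hT ⟨0, h0⟩) (hU ⟨0, h0⟩)
      simp only [zero_add, one_mul, stage_one p h0, bind_samples, bind_ops, pure_samples,
        pure_ops, add_zero]
      constructor
      · have : r * T ≤ r * (Q * T) := by
          have : T ≤ Q * T := Nat.le_mul_of_pos_left _ (by omega)
          gcongr
        omega
      · refine h2.trans ?_
        have h3 : r * dftCost T ≤ r * dftCost (2 * Q * T) := by
          have := dftCost_mono hTT
          gcongr
        unfold stepCost
        have e1 : r * (dftCost T + 2 * T + U) = r * dftCost T + r * (2 * T) + r * U := by ring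
        have e2 : r * (2 * T + 2 * (A * T) + 2 * U) =
          r * (2 * T) + 2 * (r * (A * T)) + 2 * (r * U) := by ring
        omega
    · obtain ⟨h1, h2⟩ := ih (by omega)
      obtain ⟨h3, h4⟩ := dimensionStep_cost (t := ⟨t, ht⟩)
        (I := (stage Γ p δ s s ω t).val.map Prod.fst) hT
        (by rw [List.length_map]; exact hA t h0 ht) hAQ h2Q hTQ (hU _) (hU' ⟨t, ht⟩ h0)
      rw [stage_succ p ht h0.ne', bind_samples, bind_ops, add_mul, add_mul, one_mul, one_mul]
      exact ⟨add_le_add h1 h3, add_le_add h2 h4⟩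

end Cost

/-! ### Estimates for the cost bounds -/

lemma clog_le {x : ℕ} (hx : 1 ≤ x) : (Nat.clog 2 x : ℝ) ≤ 2 * Real.log x + 1 := by
  have hx' : (1 : ℝ) ≤ x := by exact_mod_cast hx
  have h0 := Real.log_nonneg hx'
  rcases hx.eq_or_lt with rfl | hx1
  · simp
  have h1 := Nat.pow_pred_clog_lt_self (b := 2) (by norm_num) hx1
  obtain ⟨m, hm⟩ : ∃ m, Nat.clog 2 x = m + 1 :=
    ⟨_, (Nat.succ_pred_eq_of_pos (Nat.clog_pos (by norm_num) hx1)).symm⟩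
  rw [hm] at h1 ⊢
  rw [Nat.pred_succ] at h1
  have h2 : (m : ℝ) * Real.log 2 ≤ Real.log x := by
    rw [← Real.log_pow]
    exact Real.log_le_log (by positivity) (by exact_mod_cast h1.le)
  have h3 := Real.log_two_gt_d9
  push_cast
  nlinarith [(Nat.cast_nonneg m : (0 : ℝ) ≤ m)]

/-- The cost of a dimension increment in terms of the size `y` of the sets of frequencies, the
number `n * X` of iterations and the logarithm `ℓ` of the lattice size, up to constants. -/
lemma stepCost_le {d r N A U : ℕ} {n X y ℓ α ρ κ k a : ℝ} (hn : 1 ≤ n) (hX : 1 ≤ X) (hy : 1 ≤ y)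
    (hl : 1 ≤ ℓ) (hα : 1 ≤ α) (hρ : 0 ≤ ρ) (hκ : 1 ≤ κ) (hk : 1 ≤ k) (hd1 : 1 ≤ d) (hN1 : 1 ≤ N)
    (hd : (d : ℝ) ≤ k * n) (hN : (N : ℝ) ≤ k * y) (hA : (A : ℝ) ≤ α * y)
    (hr : (r : ℝ) ≤ ρ * (n * X)) (ha : a = α ^ 2 + 3 * k)
    (hm : (Nat.clog 2 (2 * (2 * (A ^ 2 + 3 * N) * (3 * N))) : ℝ) ≤ κ * ℓ) :
    3 * ((r : ℝ) * (((A ^ 2 + 3 * N : ℕ) : ℝ) * ((3 * N : ℕ) : ℝ))) ≤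
      9 * ρ * a * (n * X * y ^ 2 * N) ∧
    (stepCost d r (3 * N) (A ^ 2 + 3 * N) A U : ℝ) ≤
      (7 + 15 * α * k + k * (10 * α ^ 2 * κ + 2 * a + 3 * α) + 672 * ρ * a * κ + 12 * ρ * α) *
        (n * X * y ^ 2 * N * ℓ) + 2 * a ^ 2 * y ^ 3 + 2 * ρ * (n * X * U) := by
  have hN1' : (1 : ℝ) ≤ N := by exact_mod_cast hN1
  have hd1' : (1 : ℝ) ≤ d := by exact_mod_cast hd1
  have ha1 : 1 ≤ a := by nlinarith
  have hy2 : y ≤ y ^ 2 := by nlinarith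
  set Q : ℕ := A ^ 2 + 3 * N with hQdef
  have hQ : (Q : ℝ) ≤ a * y ^ 2 := by
    rw [hQdef, ha]; push_cast
    have h1 : (A : ℝ) ^ 2 ≤ (α * y) ^ 2 := by gcongr
    nlinarith
  have hsqrt : (Nat.sqrt (2 * Q) : ℝ) ≤ 2 * a * y := by
    have h1 : ((Nat.sqrt (2 * Q) : ℝ)) ^ 2 ≤ 2 * Q := by exact_mod_cast Nat.sqrt_le' (2 * Q)
    refine le_of_sq_le_sq (h1.trans ?_) (by positivity)
    calc 2 * (Q : ℝ) ≤ 2 * (a * y ^ 2) := by gcongr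
      _ ≤ (2 * a * y) ^ 2 := by
        have : a ≤ a * a := le_mul_of_one_le_left (by linarith) ha1
        nlinarith [sq_nonneg y]
  set m : ℝ := ((Nat.clog 2 (2 * (2 * Q * (3 * N))) : ℕ) : ℝ) with hmdef
  have hm0 : 0 ≤ m := Nat.cast_nonneg _
  have hκl : 1 ≤ κ * ℓ := one_le_mul_of_one_le_of_one_le hκ hl
  have hT : ((3 * N : ℕ) : ℝ) = 3 * N := by push_cast; ring
  have ex : (stepCost d r (3 * N) Q A U : ℝ) = 6 * N + A * (3 * N) * (3 * d + 2) +
      Q * Nat.sqrt (2 * Q) + d * (A ^ 2 * (6 + 4 * m) + 2 * Q + 3 * A) + 1 +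
      2 * (r * (4 * (2 * Q * (3 * N)) * (9 * m + 5))) +
      r * (6 * N + 2 * (A * (3 * N)) + 2 * U) := by
    rw [hmdef]
    unfold stepCost dftCost
    push_cast
    ring
  -- every term is dominated by `Z` or is one of the last two terms of the bound
  set Z : ℝ := n * X * y ^ 2 * N * ℓ with hZ
  have hy2' : 1 ≤ y ^ 2 := hy.trans hy2
  have z0 : 1 ≤ n * X := one_le_mul_of_one_le_of_one_le hn hX
  have z1 : (N : ℝ) ≤ Z := by
    have : 1 ≤ n * X * y ^ 2 * ℓ :=
      one_le_mul_of_one_le_of_one_le (one_le_mul_of_one_le_of_one_le z0 hy2') hl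
    calc (N : ℝ) ≤ N * (n * X * y ^ 2 * ℓ) := le_mul_of_one_le_right (by linarith) this
      _ = Z := by rw [hZ]; ring
  have z2 : y * N * n ≤ Z := by
    have : 1 ≤ X * y * ℓ := one_le_mul_of_one_le_of_one_le (one_le_mul_of_one_le_of_one_le hX hy) hl
    calc y * N * n ≤ y * N * n * (X * y * ℓ) := le_mul_of_one_le_right (by positivity) this
      _ = Z := by rw [hZ]; ring
  have z3 : n * y ^ 2 * ℓ ≤ Z := by
    have : 1 ≤ X * N := one_le_mul_of_one_le_of_one_le hX hN1'
    calc n * y ^ 2 * ℓ ≤ n * y ^ 2 * ℓ * (X * N) := le_mul_of_one_le_right (by positivity) this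
      _ = Z := by rw [hZ]; ring
  have z4 : n * X * (y * N) ≤ Z := by
    have : 1 ≤ y * ℓ := one_le_mul_of_one_le_of_one_le hy hl
    calc n * X * (y * N) ≤ n * X * (y * N) * (y * ℓ) := le_mul_of_one_le_right (by positivity) this
      _ = Z := by rw [hZ]; ring
  constructor
  · rw [hT]
    calc 3 * ((r : ℝ) * (Q * (3 * N))) ≤ 3 * ((ρ * (n * X)) * ((a * y ^ 2) * (3 * N))) := by gcongr
      _ = 9 * ρ * a * (n * X * y ^ 2 * N) := by ring
  rw [ex]
  have t2 : (A : ℝ) * (3 * N) * (3 * d + 2) ≤ 15 * α * k * Z := by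
    calc (A : ℝ) * (3 * N) * (3 * d + 2) ≤ (α * y) * (3 * N) * (5 * (k * n)) := by
          gcongr; linarith
      _ = 15 * α * k * (y * N * n) := by ring
      _ ≤ 15 * α * k * Z := by gcongr
  have t3 : (Q : ℝ) * Nat.sqrt (2 * Q) ≤ 2 * a ^ 2 * y ^ 3 := by
    calc (Q : ℝ) * Nat.sqrt (2 * Q) ≤ (a * y ^ 2) * (2 * a * y) := by gcongr
      _ = 2 * a ^ 2 * y ^ 3 := by ring
  have t4 : (d : ℝ) * (A ^ 2 * (6 + 4 * m) + 2 * Q + 3 * A) ≤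
      k * (10 * α ^ 2 * κ + 2 * a + 3 * α) * Z := by
    calc (d : ℝ) * (A ^ 2 * (6 + 4 * m) + 2 * Q + 3 * A)
        ≤ (k * n) * ((α * y) ^ 2 * (10 * (κ * ℓ)) + 2 * (a * y ^ 2) * ℓ + 3 * (α * y ^ 2) * ℓ) := by
          have h1 : 2 * (Q : ℝ) ≤ 2 * (a * y ^ 2) * ℓ :=
            (mul_le_mul_of_nonneg_left hQ (by norm_num)).trans
              (le_mul_of_one_le_right (by positivity) hl)
          have h2 : 3 * (A : ℝ) ≤ 3 * (α * y ^ 2) * ℓ :=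
            (mul_le_mul_of_nonneg_left (hA.trans (by gcongr)) (by norm_num)).trans
              (le_mul_of_one_le_right (by positivity) hl)
          gcongr
          linarith
      _ = k * (10 * α ^ 2 * κ + 2 * a + 3 * α) * (n * y ^ 2 * ℓ) := by ring
      _ ≤ k * (10 * α ^ 2 * κ + 2 * a + 3 * α) * Z := by gcongr
  have t5 : 2 * ((r : ℝ) * (4 * (2 * Q * (3 * N)) * (9 * m + 5))) ≤ 672 * ρ * a * κ * Z := by
    calc 2 * ((r : ℝ) * (4 * (2 * Q * (3 * N)) * (9 * m + 5)))
        ≤ 2 * ((ρ * (n * X)) * (4 * (2 * (a * y ^ 2) * (3 * N)) * (14 * (κ * ℓ)))) := by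
          gcongr; linarith
      _ = 672 * ρ * a * κ * Z := by rw [hZ]; ring
  have t6 : (r : ℝ) * (6 * N + 2 * (A * (3 * N)) + 2 * U) ≤
      12 * ρ * α * Z + 2 * ρ * (n * X * U) := by
    calc (r : ℝ) * (6 * N + 2 * (A * (3 * N)) + 2 * U)
        ≤ (ρ * (n * X)) * (6 * (α * y * N) + 2 * ((α * y) * (3 * N)) + 2 * U) := by
          have : (N : ℝ) ≤ α * y * N :=
            le_mul_of_one_le_left (by linarith) (one_le_mul_of_one_le_of_one_le hα hy)
          gcongr
      _ = 12 * ρ * α * (n * X * (y * N)) + 2 * ρ * (n * X * U) := by ring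
      _ ≤ 12 * ρ * α * Z + 2 * ρ * (n * X * U) := by gcongr
  have z5 : 1 ≤ Z := hN1'.trans z1
  linarith

/-! ### The bounds for the chosen parameters -/

section Parameters
variable {c : ℝ} {d N : ℕ} {Γ : Finset (Fin d → ℤ)} {phat : (Fin d → ℤ) →₀ ℂ} {δ ε : ℝ} {s : ℕ}

lemma one_le_logFactor (x : ℝ) : 1 ≤ logFactor x := le_max_left _ _

lemma abs_log_le_logFactor (x : ℝ) : |Real.log x| ≤ logFactor x := le_max_right _ _

lemma log_le_logFactor (x : ℝ) : Real.log x ≤ logFactor x :=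
  (le_abs_self _).trans (abs_log_le_logFactor x)

/-- A constant not less than `1` that can replace `c`. -/
def boundConst (c : ℝ) : ℝ := max c 1

lemma one_le_boundConst (c : ℝ) : 1 ≤ boundConst c := le_max_right _ _

lemma Admissible.one_le_card (h : Admissible c N Γ phat δ s ε) :
    (1 : ℝ) ≤ phat.support.card := by exact_mod_cast h.supp_nonempty.card_pos

lemma Admissible.N_le' (h : Admissible c N Γ phat δ s ε) :
    (N : ℝ) ≤ boundConst c * phat.support.card :=
  h.N_le.trans (mul_le_mul_of_nonneg_right (le_max_left _ _) (Nat.cast_nonneg _))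

lemma Admissible.d_le' (h : Admissible c N Γ phat δ s ε) :
    (d : ℝ) ≤ boundConst c * phat.support.card :=
  h.d_le.trans (mul_le_mul_of_nonneg_right (le_max_left _ _) (Nat.cast_nonneg _))

lemma Admissible.iterations_le (h : Admissible c N Γ phat δ s ε) :
    (iterations phat ε : ℝ) ≤ 11 * boundConst c *
      (phat.support.card * (logFactor phat.support.card * logFactor ε)) := by
  have hk := one_le_boundConst c
  have hn := h.one_le_card
  have hd : (1 : ℝ) ≤ d := by exact_mod_cast h.one_le_d
  have hdk := h.d_le'
  set n : ℝ := ((phat.support.card : ℕ) : ℝ) with hnd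
  set k := boundConst c
  have hl := one_le_logFactor n
  have hm := one_le_logFactor ε
  have h1 : Real.log 2 ≤ 1 := (Real.log_le_sub_one_of_pos two_pos).trans (by norm_num)
  have h2 : Real.log d ≤ k + logFactor n := by
    have e1 : Real.log d ≤ Real.log (k * n) := Real.log_le_log (by linarith) hdk
    rw [Real.log_mul (by positivity) (by positivity)] at e1
    have e2 := Real.log_le_self (zero_le_one.trans hk)
    have e3 := log_le_logFactor n
    linarith
  have h3 := log_le_logFactor n
  have h4 : -Real.log ε ≤ logFactor ε := (neg_le_abs _).trans (abs_log_le_logFactor ε)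
  have h0 : 0 ≤ 2 * n * (Real.log 2 + Real.log d + Real.log n - Real.log ε) := by
    have e1 := Real.log_nonneg hn
    have e2 := Real.log_nonneg hd
    have e3 := Real.log_nonneg (one_le_two : (1 : ℝ) ≤ 2)
    have e4 := Real.log_nonpos h.eps_pos.le h.eps_lt_one.le
    exact mul_nonneg (by positivity) (by linarith)
  have h5 : (iterations phat ε : ℝ) ≤
      2 * n * (Real.log 2 + Real.log d + Real.log n - Real.log ε) + 1 :=
    (Nat.ceil_lt_add_one h0).le
  have hX : 1 ≤ logFactor n * logFactor ε := one_le_mul_of_one_le_of_one_le hl hm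
  have hXl : logFactor n ≤ logFactor n * logFactor ε := le_mul_of_one_le_right (by linarith) hm
  have hXm : logFactor ε ≤ logFactor n * logFactor ε := le_mul_of_one_le_left (by linarith) hl
  set X := logFactor n * logFactor ε
  have h6 : Real.log 2 + Real.log d + Real.log n - Real.log ε ≤ 5 * k * X := by
    have : k ≤ k * X := le_mul_of_one_le_right (by linarith) hX
    have : X ≤ k * X := le_mul_of_one_le_left (by linarith) hk
    linarith
  have h7 : 1 ≤ k * (n * X) := one_le_mul_of_one_le_of_one_le hk
    (one_le_mul_of_one_le_of_one_le hn hX)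
  calc (iterations phat ε : ℝ) ≤ 2 * n * (5 * k * X) + k * (n * X) :=
        h5.trans (add_le_add (mul_le_mul_of_nonneg_left h6 (by positivity)) h7)
    _ = 11 * k * (n * X) := by ring

lemma Admissible.extent_le (h : Admissible c N Γ phat δ s ε) (t : Fin d) : extent Γ t ≤ 3 * N := by
  have := SparseFFT.extent_le h.subset_grid t
  have := h.one_le_N
  omega

lemma Admissible.delta_le_norm (h : Admissible c N Γ phat δ s ε) :
    ∀ k ∈ phat.support, δ ≤ ‖phat k‖ := fun k hk =>
  (h.delta_le k hk).trans (by have := norm_nonneg (phat k); linarith)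

/-- Costs on the event that all projections are seen: all sets of frequencies have at most
`n` elements, and there are at most `n` large coefficients. -/
lemma cost_of_allSeen (h : Admissible c N Γ phat δ s ε) {r : ℕ} (hr : 0 < r) {ω : Randomness d r}
    (hω : AllSeen phat δ ω) :
    (singleLatticeSFFT Γ (trigPoly phat) δ s s ω).samples ≤
      d * (3 * (r * ((phat.support.card ^ 2 + 3 * N) * (3 * N)))) ∧
    (singleLatticeSFFT Γ (trigPoly phat) δ s s ω).ops ≤
      d * stepCost d r (3 * N) (phat.support.card ^ 2 + 3 * N) phat.support.card
        ((phat.support.card + 1) * phat.support.card) := by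
  have hN := h.one_le_N
  have hex : ∀ t, 0 < t → t ≤ d →
      IsExact phat t ((stage Γ (trigPoly phat) δ s s ω t).val.map Prod.fst) := by
    intro t h0 ht
    obtain ⟨t, rfl⟩ : ∃ t', t = t' + 1 := ⟨t - 1, by omega⟩
    exact stage_exact h.supp_subset h.delta_pos h.supp_le_s hr h.delta_le_norm hω ht
  have hW : (phat.support.card + 1) * min s phat.support.card ≤
      (phat.support.card + 1) * phat.support.card := Nat.mul_le_mul_left _ (min_le_right _ _)
  refine stage_cost h.extent_le (Nat.le_add_right _ _) (by omega) (by omega) ?_ ?_ ?_ le_rfl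
  · intro t h0 ht
    have := (hex t h0 ht.le).length_le
    rwa [List.length_map] at this
  · exact fun t => ⟨_, hW, large_component h.supp_subset h.delta_pos t⟩
  · intro t h0
    exact ⟨_, hW, large_step h.supp_subset h.delta_pos (hex t h0 t.isLt.le)
      (detectComponent_exact h.supp_subset h.delta_pos h.supp_le_s t (hω.1 t)).1⟩

/-- Costs for all random choices: each of the `r` iterations detects at most `s` frequencies. -/
lemma cost_of_any (h : Admissible c N Γ phat δ s ε) {r : ℕ} (hr : 0 < r) (ω : Randomness d r) :
    (singleLatticeSFFT Γ (trigPoly phat) δ s s ω).samples ≤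
      d * (3 * (r * (((r * s) ^ 2 + 3 * N) * (3 * N)))) ∧
    (singleLatticeSFFT Γ (trigPoly phat) δ s s ω).ops ≤
      d * stepCost d r (3 * N) ((r * s) ^ 2 + 3 * N) (r * s) ((r * s * (3 * N) + 1) * s) := by
  have hN := h.one_le_N
  have hs : 0 < s := h.supp_nonempty.card_pos.trans_le h.supp_le_s
  refine stage_cost h.extent_le (Nat.le_add_right _ _) (by omega) (by omega) ?_ ?_ ?_ le_rfl
  · exact fun t _ ht => stage_length_le ht.le
  · refine fun t => ⟨_, ?_, fun x _ => large_card_le _ _ _⟩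
    have h1 := (proj_sort_length_le Γ t).trans (h.extent_le t)
    have h2 : 3 * N ≤ r * s * (3 * N) := Nat.le_mul_of_pos_left _ (Nat.mul_pos hr hs)
    exact Nat.mul_le_mul (by omega) (min_le_left _ _)
  · intro t h0
    refine ⟨_, ?_, fun x _ => large_card_le _ _ _⟩
    refine Nat.mul_le_mul (Nat.succ_le_succ ((candidates_length _ _ _).trans
      (Nat.mul_le_mul ?_ ?_))) (min_le_left _ _)
    · rw [List.length_map]; exact stage_length_le t.isLt.le
    · rw [List.length_map]
      exact (detectComponent_length_le_extent t).trans (h.extent_le t)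

/-- The logarithm of the transform lengths, for sets of frequencies with at most `A` elements. -/
lemma clog_size_le {A N : ℕ} {α k y : ℝ} (hα : 1 ≤ α) (hk : 1 ≤ k) (hy : 1 ≤ y) (hN1 : 1 ≤ N)
    (hA : (A : ℝ) ≤ α * y) (hN : (N : ℝ) ≤ k * y) :
    (Nat.clog 2 (2 * (2 * (A ^ 2 + 3 * N) * (3 * N))) : ℝ) ≤
      24 * (α ^ 2 + 3 * k) * k + 6 * Real.log y + 1 := by
  refine (clog_le (Nat.mul_pos two_pos (Nat.mul_pos (by positivity) (by omega)))).trans ?_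
  have hN1' : (1 : ℝ) ≤ N := by exact_mod_cast hN1
  have h1 : ((2 * (2 * (A ^ 2 + 3 * N) * (3 * N)) : ℕ) : ℝ) ≤
      12 * (α ^ 2 + 3 * k) * k * y ^ 3 := by
    push_cast
    have e1 : (A : ℝ) ^ 2 + 3 * N ≤ (α ^ 2 + 3 * k) * y ^ 2 := by
      have : (A : ℝ) ^ 2 ≤ (α * y) ^ 2 := by gcongr
      have : y ≤ y ^ 2 := by nlinarith
      nlinarith
    calc 2 * (2 * ((A : ℝ) ^ 2 + 3 * N) * (3 * N))
        ≤ 2 * (2 * ((α ^ 2 + 3 * k) * y ^ 2) * (3 * (k * y))) := by gcongr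
      _ = 12 * (α ^ 2 + 3 * k) * k * y ^ 3 := by ring
  have h2 := Real.log_le_log (by positivity) h1
  rw [Real.log_mul (by positivity) (by positivity), Real.log_pow] at h2
  have h3 := Real.log_le_self (show 0 ≤ 12 * (α ^ 2 + 3 * k) * k by positivity)
  push_cast at h2 ⊢
  linarith

/-- The constant of the cost bounds, from those for the sizes of the sets of frequencies and for the
logarithm of the lattice size. -/
def costConst (k α κ υ : ℝ) : ℝ :=
  9 * (11 * k) * (α ^ 2 + 3 * k) +
  (7 + 15 * α * k + k * (10 * α ^ 2 * κ + 2 * (α ^ 2 + 3 * k) + 3 * α) +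
    672 * (11 * k) * (α ^ 2 + 3 * k) * κ + 12 * (11 * k) * α) +
  2 * (α ^ 2 + 3 * k) ^ 2 + 2 * (11 * k) * υ

/-- The cost of `d` dimension increments with sets of at most `α * y` frequencies, where
`11 * k * (n * X)` bounds the number of iterations and `κ * ℓ` the logarithm of the transform
lengths. -/
lemma total_cost_le {d r N A U : ℕ} {n X y ℓ α κ k υ : ℝ} (hn : 1 ≤ n) (hX : 1 ≤ X) (hny : n ≤ y)
    (hl : 1 ≤ ℓ) (hα : 1 ≤ α) (hκ : 1 ≤ κ) (hk : 1 ≤ k) (hυ : 0 ≤ υ) (hd1 : 1 ≤ d)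
    (hN1 : 1 ≤ N) (hd : (d : ℝ) ≤ k * n) (hN : (N : ℝ) ≤ k * n) (hA : (A : ℝ) ≤ α * y)
    (hr : (r : ℝ) ≤ 11 * k * (n * X))
    (hm : 24 * (α ^ 2 + 3 * k) * k + 6 * Real.log y + 1 ≤ κ * ℓ)
    (hU : (U : ℝ) ≤ υ * (y ^ 2 * N)) {S O : ℕ}
    (hS : S ≤ d * (3 * (r * ((A ^ 2 + 3 * N) * (3 * N)))))
    (hO : O ≤ d * stepCost d r (3 * N) (A ^ 2 + 3 * N) A U) :
    (S : ℝ) ≤ costConst k α κ υ * (d * (n * X * y ^ 2 * N)) ∧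
    (O : ℝ) ≤ costConst k α κ υ * (d * y ^ 3 + d * (n * X * y ^ 2 * N * ℓ)) := by
  have hy : 1 ≤ y := hn.trans hny
  have hNy : (N : ℝ) ≤ k * y := hN.trans (by gcongr)
  obtain ⟨h1, h2⟩ := stepCost_le (U := U) (ρ := 11 * k) hn hX hy hl hα (by positivity) hκ hk hd1 hN1
    hd hNy hA hr rfl ((clog_size_le hα hk hy hN1 hA hNy).trans hm)
  set a := α ^ 2 + 3 * k with ha
  have hS' : (S : ℝ) ≤ d * (3 * ((r : ℝ) * (((A ^ 2 + 3 * N : ℕ) : ℝ) * ((3 * N : ℕ) : ℝ)))) := by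
    exact_mod_cast hS
  have hO' : (O : ℝ) ≤ d * (stepCost d r (3 * N) (A ^ 2 + 3 * N) A U : ℝ) := by exact_mod_cast hO
  set K1 := 9 * (11 * k) * a with hK1
  set K2 := 7 + 15 * α * k + k * (10 * α ^ 2 * κ + 2 * a + 3 * α) + 672 * (11 * k) * a * κ +
    12 * (11 * k) * α with hK2
  have hC : costConst k α κ υ = K1 + K2 + 2 * a ^ 2 + 2 * (11 * k) * υ := rfl
  have ha0 : 0 ≤ a := by positivity
  have hK10 : 0 ≤ K1 := by positivity
  have hK20 : 0 ≤ K2 := by positivity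
  have h30 : 0 ≤ 2 * a ^ 2 := by positivity
  have h40 : 0 ≤ 2 * (11 * k) * υ := by positivity
  constructor
  · calc (S : ℝ) ≤ d * (K1 * (n * X * y ^ 2 * N)) := hS'.trans (by gcongr)
      _ = K1 * (d * (n * X * y ^ 2 * N)) := by ring
      _ ≤ costConst k α κ υ * (d * (n * X * y ^ 2 * N)) := by
        rw [hC]; gcongr; linarith
  · set Z := n * X * y ^ 2 * N * ℓ with hZ
    have hUZ : n * X * U ≤ υ * Z := by
      calc n * X * U ≤ n * X * (υ * (y ^ 2 * N)) := by gcongr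
        _ = υ * (n * X * y ^ 2 * N) := by ring
        _ ≤ υ * Z := by
          exact mul_le_mul_of_nonneg_left (le_mul_of_one_le_right (by positivity) hl) hυ
    calc (O : ℝ) ≤ d * (K2 * Z + 2 * a ^ 2 * y ^ 3 + 2 * (11 * k) * (υ * Z)) :=
          hO'.trans (by gcongr; exact h2.trans (by gcongr))
      _ = (2 * a ^ 2) * (d * y ^ 3) + (K2 + 2 * (11 * k) * υ) * (d * Z) := by ring
      _ ≤ costConst k α κ υ * (d * y ^ 3) + costConst k α κ υ * (d * Z) := by
        have hZ0 : 0 ≤ Z := by positivity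
        rw [hC]
        gcongr <;> linarith
      _ = costConst k α κ υ * (d * y ^ 3 + d * Z) := by ring

lemma costConst_pos {k α κ υ : ℝ} (hα : 1 ≤ α) (hκ : 1 ≤ κ) (hk : 1 ≤ k) (hυ : 0 ≤ υ) :
    0 < costConst k α κ υ := by
  unfold costConst; positivity

/-- The bounds on the event that all projections are seen: `total_cost_le` with `y = n`. -/
lemma likely_bounds (h : Admissible c N Γ phat δ s ε) {ω : Randomness d (iterations phat ε)}
    (hω : AllSeen phat δ ω) :
    let k := boundConst c
    let C := 2 * costConst k 1 (24 * (1 + 3 * k) * k + 7) 2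
    ((singleLatticeSFFT Γ (trigPoly phat) δ s s ω).samples : ℝ) ≤
      C * (d * (phat.support.card : ℝ) ^ 3 * N * logFactor phat.support.card * logFactor ε) ∧
    ((singleLatticeSFFT Γ (trigPoly phat) δ s s ω).ops : ℝ) ≤
      C * (d * (phat.support.card : ℝ) ^ 3 * N * logFactor phat.support.card ^ 2 *
        logFactor ε) := by
  intro k C
  have hk : 1 ≤ k := one_le_boundConst c
  have hκ : 1 ≤ 24 * (1 + 3 * k) * k + 7 := by
    have : 0 ≤ 24 * (1 + 3 * k) * k := by positivity
    linarith
  have hr := iterations_pos h.supp_nonempty h.one_le_d h.eps_pos h.eps_lt_one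
  obtain ⟨hS, hO⟩ := cost_of_allSeen h hr hω
  have hn := h.one_le_card
  have hNn := h.N_le'
  have hdn := h.d_le'
  have hri := h.iterations_le
  have hN1 : (1 : ℝ) ≤ N := by exact_mod_cast h.one_le_N
  set n : ℝ := ((phat.support.card : ℕ) : ℝ) with hnd
  have hl := one_le_logFactor n
  have hm := one_le_logFactor ε
  have hX : 1 ≤ logFactor n * logFactor ε := one_le_mul_of_one_le_of_one_le hl hm
  obtain ⟨h1, h2⟩ := total_cost_le (n := n) (X := logFactor n * logFactor ε) (y := n)
    (ℓ := logFactor n) (α := 1) (κ := 24 * (1 + 3 * k) * k + 7) (k := k) (υ := 2)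
    hn hX le_rfl hl le_rfl hκ hk (by norm_num) h.one_le_d h.one_le_N hdn hNn
    (by rw [one_mul]) hri (by
      have := log_le_logFactor n
      have : 24 * (1 + 3 * k) * k ≤ 24 * (1 + 3 * k) * k * logFactor n :=
        le_mul_of_one_le_right (by positivity) hl
      rw [one_pow, add_mul]
      linarith) (by
      push_cast
      rw [← hnd]
      have e1 : n ^ 2 ≤ n ^ 2 * N := le_mul_of_one_le_right (by positivity) hN1
      nlinarith) hS hO
  have hC0 : 0 < costConst k 1 (24 * (1 + 3 * k) * k + 7) 2 :=
    costConst_pos le_rfl hκ hk (by norm_num)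
  set C' := costConst k 1 (24 * (1 + 3 * k) * k + 7) 2 with hC'
  constructor
  · refine h1.trans ?_
    have : (0 : ℝ) ≤ d * n ^ 3 * N * logFactor n * logFactor ε := by positivity
    calc C' * (d * (n * (logFactor n * logFactor ε) * n ^ 2 * N))
        = C' * (d * n ^ 3 * N * logFactor n * logFactor ε) := by ring
      _ ≤ 2 * C' * (d * n ^ 3 * N * logFactor n * logFactor ε) := by gcongr; linarith
  · refine h2.trans ?_
    have e1 : (d : ℝ) * n ^ 3 ≤ d * n ^ 3 * (N * logFactor n ^ 2 * logFactor ε) :=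
      le_mul_of_one_le_right (by positivity) (one_le_mul_of_one_le_of_one_le
        (one_le_mul_of_one_le_of_one_le hN1 (one_le_pow₀ hl)) hm)
    calc C' * (d * n ^ 3 + d * (n * (logFactor n * logFactor ε) * n ^ 2 * N * logFactor n))
        ≤ C' * (d * n ^ 3 * (N * logFactor n ^ 2 * logFactor ε) +
          d * (n * (logFactor n * logFactor ε) * n ^ 2 * N * logFactor n)) := by gcongr
      _ = 2 * C' * (d * n ^ 3 * N * logFactor n ^ 2 * logFactor ε) := by ring

lemma log_logFactor_le (ε : ℝ) : Real.log (logFactor ε) ≤ logFactor |Real.log ε| := by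
  unfold logFactor
  rcases le_total |Real.log ε| 1 with h | h
  · rw [max_eq_left h, Real.log_one]
    exact zero_le_one.trans (le_max_left _ _)
  · rw [max_eq_right h]
    exact (le_abs_self _).trans (le_max_right _ _)

/-- The bounds for all random choices: `total_cost_le` with `y = n ^ 2 * X`, where `n * X` is the
order of the number of iterations. Here the logarithm of the transform lengths involves
`log (logFactor ε)`. -/
lemma certain_bounds (h : Admissible c N Γ phat δ s ε) {C₀ : ℝ} (hC₀ : 1 ≤ C₀)
    (hs : (s : ℝ) ≤ C₀ * phat.support.card) (ω : Randomness d (iterations phat ε)) :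
    let k := boundConst c
    let α := 11 * k * C₀
    let C := costConst k α (24 * (α ^ 2 + 3 * k) * k + 25) (4 * α * C₀)
    ((singleLatticeSFFT Γ (trigPoly phat) δ s s ω).samples : ℝ) ≤
      C * (d * (phat.support.card : ℝ) ^ 5 * N *
        logFactor phat.support.card ^ 3 * logFactor ε ^ 3) ∧
    ((singleLatticeSFFT Γ (trigPoly phat) δ s s ω).ops : ℝ) ≤
      C * (d * (phat.support.card : ℝ) ^ 6 * logFactor phat.support.card ^ 3 * logFactor ε ^ 3 +
        d * (phat.support.card : ℝ) ^ 5 * N * logFactor phat.support.card ^ 4 * logFactor ε ^ 3 *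
          logFactor |Real.log ε|) := by
  intro k α C
  have hk : 1 ≤ k := one_le_boundConst c
  have hα : 1 ≤ α := one_le_mul_of_one_le_of_one_le (by linarith) hC₀
  have hκ : 1 ≤ 24 * (α ^ 2 + 3 * k) * k + 25 := by
    have : 0 ≤ 24 * (α ^ 2 + 3 * k) * k := by positivity
    linarith
  have hr := iterations_pos h.supp_nonempty h.one_le_d h.eps_pos h.eps_lt_one
  obtain ⟨hS, hO⟩ := cost_of_any h hr ω
  have hn := h.one_le_card
  have hNn := h.N_le'
  have hdn := h.d_le'
  have hri := h.iterations_le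
  have hN1 : (1 : ℝ) ≤ N := by exact_mod_cast h.one_le_N
  set n : ℝ := ((phat.support.card : ℕ) : ℝ) with hnd
  have hl := one_le_logFactor n
  have hm := one_le_logFactor ε
  have hν := one_le_logFactor |Real.log ε|
  have hX : 1 ≤ logFactor n * logFactor ε := one_le_mul_of_one_le_of_one_le hl hm
  have hlogX : Real.log (logFactor n * logFactor ε) ≤ logFactor n + logFactor |Real.log ε| := by
    rw [Real.log_mul (by positivity) (by positivity)]
    exact add_le_add (Real.log_le_self (by positivity)) (log_logFactor_le ε)
  set X := logFactor n * logFactor ε with hXdef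
  set r : ℝ := ((iterations phat ε : ℕ) : ℝ) with hrdef
  have hy : n ≤ n ^ 2 * X := by
    have : 1 ≤ n * X := one_le_mul_of_one_le_of_one_le hn hX
    calc n ≤ n * (n * X) := le_mul_of_one_le_right (by linarith) this
      _ = n ^ 2 * X := by ring
  have hA : ((iterations phat ε * s : ℕ) : ℝ) ≤ α * (n ^ 2 * X) := by
    push_cast
    calc r * s ≤ 11 * k * (n * X) * (C₀ * n) := by gcongr
      _ = α * (n ^ 2 * X) := by ring
  obtain ⟨h1, h2⟩ := total_cost_le (n := n) (X := X) (y := n ^ 2 * X)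
    (ℓ := logFactor n * logFactor |Real.log ε|) (α := α)
    (κ := 24 * (α ^ 2 + 3 * k) * k + 25) (k := k) (υ := 4 * α * C₀)
    hn hX hy (one_le_mul_of_one_le_of_one_le hl hν) hα hκ hk (by positivity) h.one_le_d h.one_le_N
    hdn hNn hA hri (by
      rw [Real.log_mul (by positivity) (by positivity), Real.log_pow]
      have e1 := log_le_logFactor n
      have e2 : logFactor n ≤ logFactor n * logFactor |Real.log ε| :=
        le_mul_of_one_le_right (by linarith) hν
      have e3 : logFactor |Real.log ε| ≤ logFactor n * logFactor |Real.log ε| :=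
        le_mul_of_one_le_left (by linarith) hl
      have e4 : 24 * (α ^ 2 + 3 * k) * k ≤
          24 * (α ^ 2 + 3 * k) * k * (logFactor n * logFactor |Real.log ε|) :=
        le_mul_of_one_le_right (by positivity) (one_le_mul_of_one_le_of_one_le hl hν)
      rw [add_mul]
      push_cast
      linarith) (by
      have e1 : ((iterations phat ε * s * (3 * N) + 1 : ℕ) : ℝ) ≤ 4 * (α * (n ^ 2 * X) * N) := by
        have e2 : 1 ≤ α * (n ^ 2 * X) * N := one_le_mul_of_one_le_of_one_le
          (one_le_mul_of_one_le_of_one_le hα (hn.trans hy)) hN1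
        have e3 : ((iterations phat ε * s : ℕ) : ℝ) * N ≤ α * (n ^ 2 * X) * N := by gcongr
        push_cast at e3 ⊢
        linarith
      rw [Nat.cast_mul]
      calc ((iterations phat ε * s * (3 * N) + 1 : ℕ) : ℝ) * s
          ≤ 4 * (α * (n ^ 2 * X) * N) * (C₀ * (n ^ 2 * X)) := by
            have : (s : ℝ) ≤ C₀ * (n ^ 2 * X) := hs.trans (by gcongr)
            gcongr
        _ = 4 * α * C₀ * ((n ^ 2 * X) ^ 2 * N) := by ring) hS hO
  refine ⟨h1.trans_eq ?_, h2.trans_eq ?_⟩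
  · rw [hXdef]; ring
  · rw [hXdef]; ring

end Parameters

end SparseFFT
end

open SparseFFT
theorem theorem4p7 (c : ℝ) :
    (∃ C : ℝ, 0 < C ∧
      ∀ (d N : ℕ) (Γ : Finset (Fin d → ℤ)) (phat : (Fin d → ℤ) →₀ ℂ) (δ : ℝ) (s : ℕ) (ε : ℝ),
        Admissible c N Γ phat δ s ε →
        ∃ E : Set (Randomness d (iterations phat ε)),
          MeasurableSet E ∧ ENNReal.ofReal (1 - ε) ≤ uniformLaw d (iterations phat ε) E ∧
          ∀ ω ∈ E,
            indexSet (singleLatticeSFFT Γ (trigPoly phat) δ s s ω).val = phat.support ∧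
            ((singleLatticeSFFT Γ (trigPoly phat) δ s s ω).samples : ℝ) ≤
              C * (d * (phat.support.card : ℝ) ^ 3 * N *
                logFactor phat.support.card * logFactor ε) ∧
            ((singleLatticeSFFT Γ (trigPoly phat) δ s s ω).ops : ℝ) ≤
              C * (d * (phat.support.card : ℝ) ^ 3 * N *
                logFactor phat.support.card ^ 2 * logFactor ε)) ∧
    (∀ C₀ : ℝ, 1 ≤ C₀ → ∃ C : ℝ, 0 < C ∧
      ∀ (d N : ℕ) (Γ : Finset (Fin d → ℤ)) (phat : (Fin d → ℤ) →₀ ℂ) (δ : ℝ) (s : ℕ) (ε : ℝ),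
        Admissible c N Γ phat δ s ε →
        (s : ℝ) ≤ C₀ * phat.support.card →
        ∀ ω : Randomness d (iterations phat ε),
          ((singleLatticeSFFT Γ (trigPoly phat) δ s s ω).samples : ℝ) ≤
            C * (d * (phat.support.card : ℝ) ^ 5 * N *
              logFactor phat.support.card ^ 3 * logFactor ε ^ 3) ∧
          ((singleLatticeSFFT Γ (trigPoly phat) δ s s ω).ops : ℝ) ≤
            C * (d * (phat.support.card : ℝ) ^ 6 *
                logFactor phat.support.card ^ 3 * logFactor ε ^ 3 +
              d * (phat.support.card : ℝ) ^ 5 * N *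
                logFactor phat.support.card ^ 4 * logFactor ε ^ 3 *
                logFactor |Real.log ε|)) := by
  have hk : 1 ≤ boundConst c := one_le_boundConst c
  constructor
  · refine ⟨2 * costConst (boundConst c) 1 (24 * (1 + 3 * boundConst c) * boundConst c + 7) 2,
      mul_pos two_pos (costConst_pos le_rfl ?_ hk (by norm_num)), ?_⟩
    · have : 0 ≤ 24 * (1 + 3 * boundConst c) * boundConst c := by positivity
      linarith
    · intro d N Γ phat δ s ε h
      refine ⟨{ω | AllSeen phat δ ω}, measurableSet_allSeen phat δ _,
        prob_allSeen h.supp_nonempty h.one_le_d h.eps_pos h.eps_lt_one h.delta_pos h.delta_le,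
        fun ω hω => ⟨?_, likely_bounds h hω⟩⟩
      exact indexSet_eq h.one_le_d h.supp_subset h.delta_pos h.supp_le_s
        (iterations_pos h.supp_nonempty h.one_le_d h.eps_pos h.eps_lt_one) h.delta_le_norm hω
  · intro C₀ hC₀
    have hα : 1 ≤ 11 * boundConst c * C₀ := one_le_mul_of_one_le_of_one_le (by linarith) hC₀
    refine ⟨_, costConst_pos hα ?_ hk (by positivity), fun d N Γ phat δ s ε h hs ω =>
      certain_bounds h hC₀ hs ω⟩
    have : 0 ≤ 24 * ((11 * boundConst c * C₀) ^ 2 + 3 * boundConst c) * boundConst c := by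
      positivity
    linarith
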